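/- Let $L>0$ and $\gamma>0$. Let $\dot H^2_{\rm per}$ be the space of real $L$-periodic functions of mean zero on one period whose weak derivatives up to order two are in $L^2(0,L)$, and let $f\in\dot H^2_{\rm per}$ be time independent. Consider the damped and driven Korteweg–de Vries equation with $L$-periodic boundary conditions, $$u_t+uu_x+u_{xxx}+\gamma u=f .\qquad (1)$$ Solutions are continuous in time with values in $\dot H^2_{\rm per}$ and satisfy (1) in the sense of distributions in $x$ (equivalently, in $\dot H^{-1}$). Let $\mathcal A\subset\dot H^2_{\rm per}$ be the global attractor, i.e. the maximal compact (in $H^2$) invariant set of the solution operator of (1); an attractor trajectory is a solution $u:\mathbb R\to\dot H^2_{\rm per}$ of (1) on all of $\mathbb R$ with $u(s)\in\mathcal A$ for all $s\in\mathbb R$. For $m\in\mathbb N$ let $P_m$ be the orthogonal projection of $L^2(0,L)$ onto $H_m=\operatorname{span}\{e^{2\pi i kx/L}:0<|k|\le m\}$. Write $|f|=(\int_0^L f^2)^{1/2}$, $|f|_{H^2}=(\int_0^L f_{xx}^2)^{1/2}$, $|f|_\infty=\sup_{[0,L]}|f|$, and set $$\mathcal R_0^0=\frac{|f|}{\gamma},\qquad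 (\mathcal R_1^0)^2=\frac2\gamma\Big\{2\gamma(\mathcal R_0^0)^{10/3}+|f|_{H^2}(\mathcal R_0^0)^2+2|f|_{H^2}\mathcal R_0^0\Big\},\qquad \mathcal R_\infty^0=(\mathcal R_0^0)^{1/2}(\mathcal R_1^0)^{1/2},$$ $$C_1=3\gamma(\mathcal R_0^0)^{3/2}(\mathcal R_1^0)^{1/2}+3|f|_\infty\mathcal R_0^0+\tfrac{18}5|f|_{H^2}+6|f|_{H^2}\mathcal R_0^0,$$ $$C_2=\tfrac32(\mathcal R_0^0)^{3/2}(\mathcal R_1^0)^{1/2}|f|_{H^2}+|f|_{H^2}(\mathcal R_0^0)^{5/2}(\mathcal R_1^0)^{1/2},$$ $$\mathcal R_2^0=\Big(\frac{5}{36\gamma^2}C_1^2+\frac1\gamma C_2+\frac{45}{64}(\mathcal R_0^0)^3\mathcal R_1^0\Big)^{1/2},\qquad \mathcal R'^0=\tfrac12(\mathcal R_0^0)^{3/2}(\mathcal R_1^0)^{1/2}+\mathcal R_2^0+\gamma\mathcal R_0^0+|f| .$$ (a) Suppose that $m\in\mathbb N$ satisfies $$\frac{L^2}{4\pi^2(m+1)^2}\,\frac1\gamma\Big[2\gamma\mathcal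 R_\infty^0+2(\mathcal R'^0)^4\gamma^{-3}\Big]\le\frac12 .\qquad (2)$$ Then $P_m$ is determining for (1): if $u,\bar u$ are attractor trajectories with $P_mu(s)=P_m\bar u(s)$ for all $s\in\mathbb R$, then $u(s)=\bar u(s)$ for all $s\in\mathbb R$. (b) The number of modes required by (2) is $O(\gamma^{-26/3},|f|_{H^2}^{14/3})$ as $\gamma\to0$ and $|f|_{H^2}\to\infty$: for all $\gamma_0,F_0>0$ there is a constant $C$, depending only on $L,\gamma_0,F_0$, such that for all $0<\gamma\le\gamma_0$ and all $f\in\dot H^2_{\rm per}$ with $|f|_{H^2}\ge F_0$ there is $m\in\mathbb N$ satisfying (2) with $m\le C\,\gamma^{-26/3}|f|_{H^2}^{14/3}$. -/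

import Mathlib

open MeasureTheory Set

noncomputable section

namespace KdV

/-- Real-valued square integrable functions on one period `(0, L]`. -/
abbrev L2 (L : ℝ) : Type := Lp ℝ 2 (volume.restrict (Ioc (0 : ℝ) L))

/-- Smooth `L`-periodic functions on the real line (the test functions). -/
def IsTest (L : ℝ) (φ : ℝ → ℝ) : Prop :=
  ContDiff ℝ ((⊤ : ℕ∞) : WithTop ℕ∞) φ ∧ Function.Periodic φ L

/-- `g` is the weak derivative of `u` as `L`-periodic functions. As the test functions are periodic
and need not vanish at the end points, no jump across the end of the period is allowed. -/
def IsWeakDeriv (L : ℝ) (u g : L2 L) : Prop :=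
  ∀ φ : ℝ → ℝ, IsTest L φ →
    (∫ x in Ioc (0 : ℝ) L, u x * deriv φ x) = -∫ x in Ioc (0 : ℝ) L, g x * φ x

/-- The space of `L`-periodic functions of spatial mean zero with weak derivatives up to order two
in `L²`. A point is the triple `(u, u_x, u_xx)`; the topology is the one of `L² × L² × L²`, which is
the `H²` topology. -/
abbrev H2per (L : ℝ) : Type :=
  {p : L2 L × L2 L × L2 L //
    (∫ x in Ioc (0 : ℝ) L, p.1 x) = 0 ∧ IsWeakDeriv L p.1 p.2.1 ∧ IsWeakDeriv L p.2.1 p.2.2}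

/-- The function `u` underlying a point of `H2per L`. -/
def H2per.val {L : ℝ} (u : H2per L) : L2 L := u.1.1

/-- `|u|`, the `L²` norm. -/
def normL2 {L : ℝ} (u : H2per L) : ℝ := ‖u.1.1‖

/-- `|u|_{H²}`, the `L²` norm of `u_xx`. -/
def normH2 {L : ℝ} (u : H2per L) : ℝ := ‖u.1.2.2‖

/-- `|u|_∞`; the essential supremum is the supremum of the continuous representative. -/
def normSup {L : ℝ} (u : H2per L) : ℝ :=
  (eLpNorm u.val ⊤ (volume.restrict (Ioc (0 : ℝ) L))).toReal

/-- The pairing of `-u u_x - u_xxx - γ u + f` with the test function `φ`. -/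
def pairing {L : ℝ} (γ : ℝ) (f u : H2per L) (φ : ℝ → ℝ) : ℝ :=
  (1 / 2) * (∫ x in Ioc (0 : ℝ) L, u.val x ^ 2 * deriv φ x)
    + (∫ x in Ioc (0 : ℝ) L, u.val x * iteratedDeriv 3 φ x)
    - γ * (∫ x in Ioc (0 : ℝ) L, u.val x * φ x)
    + ∫ x in Ioc (0 : ℝ) L, f.val x * φ x

/-- `u` is a solution of `u_t + u u_x + u_xxx + γ u = f` on the time interval `I`: it is continuous
in time with values in `H²`, and the equation holds in the sense of distributions in space. -/
def IsSolutionOn {L : ℝ} (γ : ℝ) (f : H2per L) (I : Set ℝ) (u : ℝ → H2per L) : Prop :=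
  ContinuousOn u I ∧
    ∀ φ : ℝ → ℝ, IsTest L φ → ∀ t ∈ I,
      HasDerivWithinAt (fun s => ∫ x in Ioc (0 : ℝ) L, (u s).val x * φ x)
        (pairing γ f (u t) φ) I t

/-- The image `S(t) K` of a set of initial data under the solution operator at time `t`. -/
def flowImage {L : ℝ} (γ : ℝ) (f : H2per L) (t : ℝ) (K : Set (H2per L)) : Set (H2per L) :=
  {w | ∃ u : ℝ → H2per L, IsSolutionOn γ f (Ici 0) u ∧ u 0 ∈ K ∧ u t = w}

/-- `S(t) K = K` for all `t ≥ 0`. -/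
def IsInvariant {L : ℝ} (γ : ℝ) (f : H2per L) (K : Set (H2per L)) : Prop :=
  ∀ t : ℝ, 0 ≤ t → flowImage γ f t K = K

/-- The global attractor: the maximal compact invariant set of the solution operator, obtained as
the union of all compact invariant sets. -/
def globalAttractor {L : ℝ} (γ : ℝ) (f : H2per L) : Set (H2per L) :=
  ⋃₀ {K | IsCompact K ∧ IsInvariant γ f K}

theorem globalAttractor_eq {L : ℝ} {γ : ℝ} {f : H2per L} {A : Set (H2per L)}
    (hA : IsGreatest {K | IsCompact K ∧ IsInvariant γ f K} A) : globalAttractor γ f = A :=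
  Subset.antisymm (sUnion_subset fun _ hK => hA.2 hK) (subset_sUnion_of_mem hA.1)

/-- `u(·) ⊂ A`: a solution defined for all times, with values in the global attractor. -/
def IsAttractorTrajectory {L : ℝ} (γ : ℝ) (f : H2per L) (u : ℝ → H2per L) : Prop :=
  IsSolutionOn γ f univ u ∧ ∀ s, u s ∈ globalAttractor γ f

theorem memLp_of_continuous (L : ℝ) {g : ℝ → ℝ} (hg : Continuous g) :
    MemLp g 2 (volume.restrict (Ioc (0 : ℝ) L)) := by
  obtain ⟨C, hC⟩ := (isCompact_Icc (a := (0 : ℝ)) (b := L)).exists_bound_of_continuousOn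
    hg.continuousOn
  refine MemLp.of_bound hg.aestronglyMeasurable C ?_
  filter_upwards [ae_restrict_mem measurableSet_Ioc] with x hx
  exact hC x (Ioc_subset_Icc_self hx)

/-- `cos (2 π k x / L)` as an element of `L²`. -/
def cosMode (L : ℝ) (k : ℕ) : L2 L :=
  (memLp_of_continuous L
    (g := fun x => Real.cos (2 * Real.pi * k * x / L)) (by fun_prop)).toLp _

/-- `sin (2 π k x / L)` as an element of `L²`. -/
def sinMode (L : ℝ) (k : ℕ) : L2 L :=
  (memLp_of_continuous L
    (g := fun x => Real.sin (2 * Real.pi * k * x / L)) (by fun_prop)).toLp _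

/-- `H_m`, the real-valued functions in the span of `exp (i k x 2 π / L)`, `0 < |k| ≤ m`. -/
def modeSpace (L : ℝ) (m : ℕ) : Submodule ℝ (L2 L) :=
  Submodule.span ℝ (cosMode L '' Icc 1 m ∪ sinMode L '' Icc 1 m)

instance (L : ℝ) (m : ℕ) : FiniteDimensional ℝ (modeSpace L m) :=
  FiniteDimensional.span_of_finite ℝ
    (((finite_Icc 1 m).image _).union ((finite_Icc 1 m).image _))

/-- `P_m`, the `L²` orthogonal projection onto `H_m`. -/
def P (L : ℝ) (m : ℕ) : L2 L →L[ℝ] L2 L := (modeSpace L m).starProjection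

/-- `P_m` is determining: attractor trajectories with the same projection for all times agree. -/
def IsDetermining {L : ℝ} (γ : ℝ) (f : H2per L) (m : ℕ) : Prop :=
  ∀ u v : ℝ → H2per L, IsAttractorTrajectory γ f u → IsAttractorTrajectory γ f v →
    (∀ s, P L m (u s).val = P L m (v s).val) → ∀ s, u s = v s

/-- The `L²` bound at `μ = 0`. -/
def R0 {L : ℝ} (γ : ℝ) (f : H2per L) : ℝ := normL2 f / γ

/-- The `H¹` bound at `μ = 0`. -/
def R1 {L : ℝ} (γ : ℝ) (f : H2per L) : ℝ :=
  Real.sqrt ((2 / γ) *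
    ((γ ^ (4 / 3 : ℝ) / γ ^ (1 / 3 : ℝ) + γ) * R0 γ f ^ (10 / 3 : ℝ)
      + normH2 f * R0 γ f ^ 2 + 2 * normH2 f * R0 γ f))

/-- The `L^∞` bound at `μ = 0`. -/
def Rinf {L : ℝ} (γ : ℝ) (f : H2per L) : ℝ :=
  R0 γ f ^ (1 / 2 : ℝ) * R1 γ f ^ (1 / 2 : ℝ)

def C1 {L : ℝ} (γ : ℝ) (f : H2per L) : ℝ :=
  3 * γ * R0 γ f ^ (3 / 2 : ℝ) * R1 γ f ^ (1 / 2 : ℝ) + 3 * normSup f * R0 γ f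
    + (18 / 5) * normH2 f + 6 * normH2 f * R0 γ f

def C2 {L : ℝ} (γ : ℝ) (f : H2per L) : ℝ :=
  (3 / 2) * R0 γ f ^ (3 / 2 : ℝ) * R1 γ f ^ (1 / 2 : ℝ) * normH2 f
    + normH2 f * R0 γ f ^ (5 / 2 : ℝ) * R1 γ f ^ (1 / 2 : ℝ)

/-- The `H²` bound at `μ = 0`. -/
def R2 {L : ℝ} (γ : ℝ) (f : H2per L) : ℝ :=
  Real.sqrt (5 / (36 * γ ^ 2) * C1 γ f ^ 2 + (1 / γ) * C2 γ f
    + (45 / 64) * R0 γ f ^ 3 * R1 γ f)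

/-- The bound at `μ = 0` for the time derivative in `H^{-1}`. -/
def Rprime {L : ℝ} (γ : ℝ) (f : H2per L) : ℝ :=
  (1 / 2) * R0 γ f ^ (3 / 2 : ℝ) * R1 γ f ^ (1 / 2 : ℝ) + R2 γ f + γ * R0 γ f + normL2 f

/-- The condition on the number `m` of modes. -/
def ModesCondition {L : ℝ} (γ : ℝ) (f : H2per L) (m : ℕ) : Prop :=
  L ^ 2 / (4 * Real.pi ^ 2 * ((m : ℝ) + 1) ^ 2) * (1 / γ) *
    (2 * γ * Rinf γ f + 2 * Rprime γ f ^ 4 * γ ^ (-3 : ℝ)) ≤ 1 / 2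

end KdV

end

open MeasureTheory Set Filter Topology
open scoped RealInnerProductSpace

set_option linter.unusedSectionVars false

noncomputable section

namespace KdV

/-! Determining modes. For two attractor trajectories u, ū put w = u − ū and v = (u + ū)/2. Then w_t
+ w_xxx + (v w)_x + γ w = 0, and Φ = |w_x|² − ∫ v w² satisfies Φ' = −2γΦ − ∫ v_t w², because both
parts of Φ produce the same term 2(w_xx, (v w)_x) (`Sol.hasDerivAt_Phi`). If the modes of w up to m
vanish, then |w| ≤ ε|w_x| with ε = L/(2π(m+1)). Hence Φ differs from |w_x|² by at most a|w_x|² with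
a = ε²R_∞. Moreover u_t = −(u_xx + u²/2)_x + f − γu is tested with w², whose derivative 2 w w_x has
norm at most 2√ε|w_x|², so ∫ v_t w² is at most 2γ(β + a)|w_x|² with β proportional to √ε. The
condition on m bounds a + β⁴ by 1/4, which suffices for Φ' ≤ −(γ/4)Φ. Since Φ is bounded above for
all times, starting further and further in the past gives Φ ≤ 0, and then w = 0 since Φ ≥ (1 −
a)|w_x|² with a < 1.

A priori bounds. The attractor is a union of compact invariant sets K. Every point of K has
arbitrarily long histories inside K, so an inequality J' ≤ −cJ + m along trajectories in K forces J
≤ m/c on K (`le_of_isInvariant`). This is applied to |u|² and to the KdV invariants `J1` and `J2`,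
which damping and forcing perturb. The number m may contain the maximum of |u_x| or |u_xx| over K;
evaluated at a maximizer the estimate becomes a closed inequality for that maximum (`norm_le_R1`,
`norm_le_R2`).

Regularity. Solutions are only H²-valued, so u_t lies in H⁻¹ and the energy identities are not
formal computations. `Evolves` is the equation integrated in time and tested with H¹ functions.
Products are differentiated by telescoping their increments (`Evolves.tendsto_slope`), |w_x|² by
truncation in frequency (`Evolves.norm_sq_deriv`), and |u_xx|² and ∫ u u_x² by applying the previous
two to difference quotients in x and passing to the limit (`Sol.integral_of_quot`).

Counting modes. If |f|_{H²}/γ and R_0 are at most Z³ with Z ≥ 1, the constants R_1, R_∞, R_2 are of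
order Z⁵, Z⁴, Z⁷, so that m of order Z¹⁴/γ² is enough; Z is then chosen as a multiple of
(|f|_{H²}/γ)^{1/3}. -/

/-! ### Continuous functions as elements of `L2` -/

/-- The class in `L2 L` of a continuous function. -/
def ofCont (L : ℝ) (g : ℝ → ℝ) (hg : Continuous g) : L2 L := (memLp_of_continuous L hg).toLp g

theorem coeFn_ofCont (L : ℝ) {g : ℝ → ℝ} (hg : Continuous g) :
    ofCont L g hg =ᵐ[volume.restrict (Ioc (0 : ℝ) L)] g :=
  MemLp.coeFn_toLp _

theorem inner_eq_integral {L : ℝ} (a b : L2 L) :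
    ⟪a, b⟫ = ∫ x in Ioc (0 : ℝ) L, a x * b x := by
  rw [L2.inner_def]
  refine integral_congr_ae (Eventually.of_forall fun x => ?_)
  simp [mul_comm]

theorem inner_ofCont {L : ℝ} {g : ℝ → ℝ} (hg : Continuous g) (u : L2 L) :
    ⟪u, ofCont L g hg⟫ = ∫ x in Ioc (0 : ℝ) L, u x * g x := by
  rw [inner_eq_integral]
  refine integral_congr_ae ?_
  filter_upwards [coeFn_ofCont L hg] with x hx
  rw [hx]

theorem IsTest.continuous {L : ℝ} {φ : ℝ → ℝ} (h : IsTest L φ) : Continuous φ := h.1.continuous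

theorem IsTest.deriv {L : ℝ} {φ : ℝ → ℝ} (h : IsTest L φ) : IsTest L (deriv φ) := by
  refine ⟨(contDiff_infty_iff_deriv.1 h.1).2, fun x => ?_⟩
  have : φ = fun y => φ (y + L) := funext fun y => (h.2 y).symm
  conv_rhs => rw [this]
  rw [deriv_comp_add_const]

theorem IsTest.differentiable {L : ℝ} {φ : ℝ → ℝ} (h : IsTest L φ) : Differentiable ℝ φ :=
  (contDiff_infty_iff_deriv.1 h.1).1

theorem IsTest.mul {L : ℝ} {φ ψ : ℝ → ℝ} (h : IsTest L φ) (h' : IsTest L ψ) :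
    IsTest L (fun x => φ x * ψ x) :=
  ⟨h.1.mul h'.1, h.2.mul h'.2⟩

theorem IsTest.const {L : ℝ} (c : ℝ) : IsTest L (fun _ => c) :=
  ⟨contDiff_const, fun _ => rfl⟩

theorem isWeakDeriv_iff {L : ℝ} {u g : L2 L} :
    IsWeakDeriv L u g ↔ ∀ φ : ℝ → ℝ, ∀ h : IsTest L φ,
      ⟪u, ofCont L _ h.deriv.continuous⟫ = -⟪g, ofCont L _ h.continuous⟫ := by
  simp only [inner_ofCont, IsWeakDeriv]

/-- The space of periodic functions with a square integrable weak derivative, as the space of pairs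
of a function and its derivative. -/
def H1 (L : ℝ) : Submodule ℝ (L2 L × L2 L) where
  carrier := {p | IsWeakDeriv L p.1 p.2}
  add_mem' := by
    intro a b ha hb
    simp only [mem_ofPred_eq, isWeakDeriv_iff] at *
    intro φ h
    simp only [Prod.fst_add, Prod.snd_add, inner_add_left, ha φ h, hb φ h]
    ring
  zero_mem' := by simp [isWeakDeriv_iff]
  smul_mem' := by
    intro c a ha
    simp only [mem_ofPred_eq, isWeakDeriv_iff] at *
    intro φ h
    simp only [Prod.smul_fst, Prod.smul_snd, real_inner_smul_left, ha φ h]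
    ring

theorem mem_H1 {L : ℝ} {p : L2 L × L2 L} : p ∈ H1 L ↔ IsWeakDeriv L p.1 p.2 := Iff.rfl

/-- Each test function imposes one closed linear condition. Closedness lets Leibniz' rule pass from
smooth factors to general ones. -/
theorem isClosed_H1 (L : ℝ) : IsClosed (H1 L : Set (L2 L × L2 L)) := by
  have : (H1 L : Set (L2 L × L2 L)) = ⋂ φ : {φ // IsTest L φ},
      {p | ⟪p.1, ofCont L _ φ.2.deriv.continuous⟫ = -⟪p.2, ofCont L _ φ.2.continuous⟫} := by
    ext p
    simp [mem_H1, isWeakDeriv_iff]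
  rw [this]
  exact isClosed_iInter fun φ => isClosed_eq (by fun_prop) (by fun_prop)

/-! ### The Hartley basis -/

/-- The frequency `2 π k / L`. -/
def freq (L : ℝ) (k : ℤ) : ℝ := 2 * Real.pi * k / L

theorem freq_neg (L : ℝ) (k : ℤ) : freq L (-k) = -freq L k := by
  simp [freq]; ring

/-- The normalized function `cos + sin` at frequency `k`. -/
def casFun (L : ℝ) (k : ℤ) (x : ℝ) : ℝ :=
  (Real.cos (freq L k * x) + Real.sin (freq L k * x)) / √L

theorem continuous_casFun (L : ℝ) (k : ℤ) : Continuous (casFun L k) := by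
  unfold casFun; fun_prop

/-- Differentiation exchanges the frequencies k and −k, so it has a single nonzero entry per row in
this real basis and no complex scalars are needed. -/
theorem deriv_casFun (L : ℝ) (k : ℤ) :
    deriv (casFun L k) = fun x => freq L k * casFun L (-k) x := by
  funext x
  have h : HasDerivAt (casFun L k)
      ((-Real.sin (freq L k * x) * (freq L k * 1) + Real.cos (freq L k * x) * (freq L k * 1)) / √L)
      x := by
    unfold casFun
    have h0 : HasDerivAt (fun x => freq L k * x) (freq L k * 1) x :=
      (hasDerivAt_id x).const_mul _
    exact (h0.cos.add h0.sin).div_const _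
  rw [h.deriv]
  simp only [casFun, freq_neg, neg_mul, Real.cos_neg, Real.sin_neg]
  ring

variable {L : ℝ} [hL : Fact (0 < L)]

theorem freq_mul_period (k : ℤ) : freq L k * L = k * (2 * Real.pi) := by
  have := hL.out.ne'
  unfold freq
  field_simp

theorem isTest_casFun (k : ℤ) : IsTest L (casFun L k) := by
  refine ⟨?_, fun x => ?_⟩
  · unfold casFun
    exact ((contDiff_const.mul contDiff_id).cos.add (contDiff_const.mul contDiff_id).sin).div_const _
  · simp only [casFun, mul_add, freq_mul_period, Real.cos_add_int_mul_two_pi,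
      Real.sin_add_int_mul_two_pi]

/-- The Hartley basis functions as elements of `L2`. -/
def cas (L : ℝ) (k : ℤ) : L2 L := ofCont L (casFun L k) (continuous_casFun L k)

theorem integral_cos_freq (k : ℤ) (hk : k ≠ 0) :
    ∫ x in (0 : ℝ)..L, Real.cos (freq L k * x) = 0 := by
  have h0 : freq L k ≠ 0 := by
    have := hL.out.ne'
    unfold freq; positivity
  rw [intervalIntegral.integral_comp_mul_left (fun x => Real.cos x) h0, integral_cos,
    freq_mul_period]
  have := Real.sin_int_mul_pi (k * 2)
  push_cast at this
  rw [mul_assoc] at this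
  simp [this]

theorem integral_sin_freq (k : ℤ) :
    ∫ x in (0 : ℝ)..L, Real.sin (freq L k * x) = 0 := by
  rcases eq_or_ne k 0 with rfl | hk
  · simp [freq]
  have h0 : freq L k ≠ 0 := by
    have := hL.out.ne'
    unfold freq; positivity
  rw [intervalIntegral.integral_comp_mul_left (fun x => Real.sin x) h0, integral_sin,
    freq_mul_period]
  simp [Real.cos_int_mul_two_pi]

/-- The product of two basis functions is cos at frequency k − l plus sin at frequency k + l; only
the cosine with k = l has a nonzero mean. -/
theorem orthonormal_cas : Orthonormal ℝ (cas L) := by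
  have hL0 := hL.out
  have hs : √L * √L = L := Real.mul_self_sqrt hL0.le
  have hs0 : √L ≠ 0 := by positivity
  rw [orthonormal_iff_ite]
  intro k l
  have h1 : ⟪cas L k, cas L l⟫ = ∫ x in Ioc (0 : ℝ) L, casFun L k x * casFun L l x := by
    rw [cas, cas, inner_ofCont]
    refine integral_congr_ae ?_
    filter_upwards [coeFn_ofCont L (continuous_casFun L k)] with x hx
    rw [hx]
  have h2 : ∀ x, casFun L k x * casFun L l x =
      (Real.cos (freq L (k - l) * x) + Real.sin (freq L (k + l) * x)) / L := by
    intro x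
    have e1 : freq L (k - l) * x = freq L k * x - freq L l * x := by
      unfold freq; push_cast; ring
    have e2 : freq L (k + l) * x = freq L k * x + freq L l * x := by
      unfold freq; push_cast; ring
    rw [e1, e2, Real.cos_sub, Real.sin_add, casFun, casFun, div_mul_div_comm, hs]
    ring
  rw [h1, ← intervalIntegral.integral_of_le hL0.le]
  simp_rw [h2]
  rw [intervalIntegral.integral_div, intervalIntegral.integral_add
    (Continuous.intervalIntegrable (by fun_prop) _ _)
    (Continuous.intervalIntegrable (by fun_prop) _ _), integral_sin_freq]
  split_ifs with h
  · subst h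
    simp [freq, hL0.ne']
  · rw [integral_cos_freq _ (sub_ne_zero.2 h)]
    simp

theorem inner_cas (u : L2 L) (k : ℤ) :
    ⟪cas L k, u⟫ = ∫ x in Ioc (0 : ℝ) L, u x * casFun L k x := by
  rw [real_inner_comm, cas, inner_ofCont]

theorem integrable_mul_continuous (u : L2 L) {g : ℝ → ℝ} (hg : Continuous g) :
    Integrable (fun x => u x * g x) (volume.restrict (Ioc (0 : ℝ) L)) :=
  (Lp.memLp u).integrable_mul (memLp_of_continuous L hg)

/-- Sum and difference of the coefficients at k and −k give the cosine and sine coefficients, hence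
all complex Fourier coefficients, and Parseval's identity for these yields completeness. -/
theorem eq_zero_of_inner_cas (u : L2 L) (h : ∀ k, ⟪cas L k, u⟫ = 0) : u = 0 := by
  have hL0 := hL.out
  have hs0 : √L ≠ 0 := by positivity
  have key : ∀ k, (∫ x in Ioc (0 : ℝ) L, u x * Real.cos (freq L k * x)) = 0 ∧
      (∫ x in Ioc (0 : ℝ) L, u x * Real.sin (freq L k * x)) = 0 := by
    intro k
    have hc := integrable_mul_continuous u
      (g := fun x => Real.cos (freq L k * x)) (by fun_prop)
    have hsn := integrable_mul_continuous u
      (g := fun x => Real.sin (freq L k * x)) (by fun_prop)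
    have e : ∀ x, u x * casFun L k x =
        (u x * Real.cos (freq L k * x) + u x * Real.sin (freq L k * x)) / √L := by
      intro x; unfold casFun; ring
    have e' : ∀ x, u x * casFun L (-k) x =
        (u x * Real.cos (freq L k * x) - u x * Real.sin (freq L k * x)) / √L := by
      intro x
      simp only [casFun, freq_neg, neg_mul, Real.cos_neg, Real.sin_neg]
      ring
    have h1 := h k
    have h2 := h (-k)
    rw [inner_cas] at h1 h2
    simp_rw [e] at h1
    simp_rw [e'] at h2
    rw [integral_div, integral_add hc hsn, div_eq_zero_iff, or_iff_left hs0] at h1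
    rw [integral_div, integral_sub hc hsn, div_eq_zero_iff, or_iff_left hs0] at h2
    constructor <;> linarith
  have hm : MemLp (fun x => (u x : ℂ)) 2 (volume.restrict (Ioc (0 : ℝ) L)) := (Lp.memLp u).ofReal
  have hp := hasSum_sq_fourierCoeffOn hL0 hm
  have hz : ∀ i, fourierCoeffOn hL0 (fun x => (u x : ℂ)) i = 0 := by
    intro i
    rw [fourierCoeffOn_eq_integral, intervalIntegral.integral_of_le hL0.le]
    have e : ∀ x : ℝ, fourier (-i) (x : AddCircle (L - 0)) • (u x : ℂ) =
        ((u x * Real.cos (freq L i * x) : ℝ) : ℂ) -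
          ((u x * Real.sin (freq L i * x) : ℝ) : ℂ) * Complex.I := by
      intro x
      rw [fourier_coe_apply]
      have : (2 * Real.pi * Complex.I * ((-i : ℤ) : ℂ) * (x : ℂ) / ((L - 0 : ℝ) : ℂ)) =
          ((-(freq L i * x) : ℝ) : ℂ) * Complex.I := by
        unfold freq; push_cast; ring
      rw [this, Complex.exp_mul_I, ← Complex.ofReal_cos, ← Complex.ofReal_sin, Real.cos_neg,
        Real.sin_neg]
      simp only [smul_eq_mul]
      push_cast
      ring
    simp_rw [e]
    have hc := integrable_mul_continuous u
      (g := fun x => Real.cos (freq L i * x)) (by fun_prop)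
    have hsn := integrable_mul_continuous u
      (g := fun x => Real.sin (freq L i * x)) (by fun_prop)
    rw [integral_sub hc.ofReal (hsn.ofReal.mul_const _), integral_mul_const,
      integral_complex_ofReal, integral_complex_ofReal, (key i).1, (key i).2]
    simp
  simp only [hz, norm_zero, ne_eq, OfNat.ofNat_ne_zero, not_false_eq_true, zero_pow] at hp
  have h0 := hp.unique hasSum_zero
  rw [intervalIntegral.integral_of_le hL0.le] at h0
  have h1 : ∫ x in Ioc (0 : ℝ) L, u x * u x = 0 := by
    have : ∫ x in Ioc (0 : ℝ) L, ‖(u x : ℂ)‖ ^ 2 = 0 := by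
      simpa [hL0.ne'] using h0
    refine Eq.trans ?_ this
    refine integral_congr_ae (Eventually.of_forall fun x => ?_)
    simp [pow_two]
  rw [← inner_eq_integral, inner_self_eq_zero] at h1
  exact h1

/-- The Hilbert basis `cos (2 π k x / L) + sin (2 π k x / L)` of `L2`, normalized. -/
def casBasis (L : ℝ) [Fact (0 < L)] : HilbertBasis ℤ ℝ (L2 L) :=
  HilbertBasis.mkOfOrthogonalEqBot orthonormal_cas (by
    rw [Submodule.eq_bot_iff]
    intro u hu
    refine eq_zero_of_inner_cas u fun k => ?_
    exact (Submodule.mem_orthogonal _ _).1 hu _ (Submodule.subset_span ⟨k, rfl⟩))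

@[simp] theorem casBasis_apply (k : ℤ) : casBasis L k = cas L k := by
  simp [casBasis]

theorem hasSum_inner (u v : L2 L) :
    HasSum (fun k => ⟪cas L k, u⟫ * ⟪cas L k, v⟫) ⟪u, v⟫ := by
  have := (casBasis L).hasSum_inner_mul_inner u v
  simpa [real_inner_comm] using this

theorem hasSum_norm_sq (u : L2 L) : HasSum (fun k => ⟪cas L k, u⟫ ^ 2) (‖u‖ ^ 2) := by
  have := hasSum_inner u u
  simpa [real_inner_self_eq_norm_sq, pow_two] using this

theorem hasSum_cas (u : L2 L) : HasSum (fun k => ⟪cas L k, u⟫ • cas L k) u := by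
  have := (casBasis L).hasSum_repr u
  simpa [HilbertBasis.repr_apply_apply] using this

theorem ext_inner_cas {u v : L2 L} (h : ∀ k, ⟪cas L k, u⟫ = ⟪cas L k, v⟫) : u = v := by
  rw [← sub_eq_zero]
  exact eq_zero_of_inner_cas _ fun k => by rw [inner_sub_right, h k, sub_self]

theorem IsTest.mem_H1 {φ : ℝ → ℝ} (h : IsTest L φ) :
    (ofCont L φ h.continuous, ofCont L _ h.deriv.continuous) ∈ H1 L := by
  rw [KdV.mem_H1]
  intro ψ hψ
  have hL0 := hL.out
  have e1 : ∫ x in Ioc (0 : ℝ) L, ofCont L φ h.continuous x * _root_.deriv ψ x =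
      ∫ x in (0 : ℝ)..L, φ x * _root_.deriv ψ x := by
    rw [intervalIntegral.integral_of_le hL0.le]
    refine integral_congr_ae ?_
    filter_upwards [coeFn_ofCont L h.continuous] with x hx
    rw [hx]
  have e2 : ∫ x in Ioc (0 : ℝ) L, ofCont L _ h.deriv.continuous x * ψ x =
      ∫ x in (0 : ℝ)..L, _root_.deriv φ x * ψ x := by
    rw [intervalIntegral.integral_of_le hL0.le]
    refine integral_congr_ae ?_
    filter_upwards [coeFn_ofCont L h.deriv.continuous] with x hx
    rw [hx]
  simp only [e1, e2]
  rw [intervalIntegral.integral_mul_deriv_eq_deriv_mul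
    (fun x _ => (h.differentiable x).hasDerivAt) (fun x _ => (hψ.differentiable x).hasDerivAt)
    (h.deriv.continuous.intervalIntegrable _ _) (hψ.deriv.continuous.intervalIntegrable _ _)]
  have p1 := h.2 0
  have p2 := hψ.2 0
  simp only [zero_add] at p1 p2
  rw [p1, p2]
  ring

theorem ofCont_deriv_casFun (k : ℤ) :
    ofCont L _ (isTest_casFun (L := L) k).deriv.continuous = freq L k • cas L (-k) := by
  refine Lp.ext ?_
  filter_upwards [coeFn_ofCont L (isTest_casFun (L := L) k).deriv.continuous,
    Lp.coeFn_smul (freq L k) (cas L (-k)), coeFn_ofCont L (continuous_casFun L (-k))] with x h1 h2 h3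
  rw [h1, h2, deriv_casFun]
  simp [cas, h3]

/-- `(e, e')` for a basis function `e`. -/
theorem cas_mem_H1 (k : ℤ) : (cas L k, freq L k • cas L (-k)) ∈ H1 L := by
  rw [← ofCont_deriv_casFun]
  exact (isTest_casFun k).mem_H1

theorem inner_cas_deriv {p : L2 L × L2 L} (hp : p ∈ H1 L) (k : ℤ) :
    ⟪cas L k, p.2⟫ = -(freq L k * ⟪cas L (-k), p.1⟫) := by
  have := isWeakDeriv_iff.1 (mem_H1.1 hp) _ (isTest_casFun (L := L) k)
  rw [ofCont_deriv_casFun, real_inner_smul_right] at this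
  rw [real_inner_comm (p.1), this, neg_neg, real_inner_comm]
  rfl

/-- Integration by parts. -/
theorem inner_deriv {p q : L2 L × L2 L} (hp : p ∈ H1 L) (hq : q ∈ H1 L) :
    ⟪p.1, q.2⟫ = -⟪p.2, q.1⟫ := by
  have h1 := hasSum_inner p.1 q.2
  have h2 := (hasSum_inner p.2 q.1).neg
  -- Since the derivative exchanges k and −k, the two Parseval sums agree term by term only after
  -- one of them is reindexed by k ↦ −k.
  rw [← (Equiv.neg ℤ).hasSum_iff] at h2
  refine h1.unique (h2.congr_fun ?_)
  intro k
  simp only [inner_cas_deriv hp, inner_cas_deriv hq, Function.comp_apply, Equiv.neg_apply, freq_neg,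
    neg_neg]
  ring

theorem deriv_unique {a b b' : L2 L} (h : (a, b) ∈ H1 L) (h' : (a, b') ∈ H1 L) : b = b' :=
  ext_inner_cas fun k => by rw [inner_cas_deriv h, inner_cas_deriv h']

theorem one_mem_H1 : (ofCont L (fun _ => (1 : ℝ)) continuous_const, (0 : L2 L)) ∈ H1 L := by
  have := (IsTest.const (L := L) 1).mem_H1
  convert this using 2
  refine Lp.ext ?_
  filter_upwards [coeFn_ofCont L (IsTest.const (L := L) 1).deriv.continuous,
    Lp.coeFn_zero ℝ 2 (volume.restrict (Ioc (0 : ℝ) L))] with x h1 h2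
  rw [h1, h2]
  simp

theorem inner_one (u : L2 L) :
    ⟪u, ofCont L (fun _ => (1 : ℝ)) continuous_const⟫ = ∫ x in Ioc (0 : ℝ) L, u x := by
  simp [inner_ofCont]

theorem integral_deriv {p : L2 L × L2 L} (hp : p ∈ H1 L) :
    ∫ x in Ioc (0 : ℝ) L, p.2 x = 0 := by
  rw [← inner_one]
  have := inner_deriv hp one_mem_H1
  simp only [inner_zero_right] at this
  linarith

/-! ### Density of the test functions -/

/-- Partial sums of the expansion in the Hartley basis. -/
def partialSum (L : ℝ) [Fact (0 < L)] (N : ℕ) : L2 L →L[ℝ] L2 L :=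
  ∑ k ∈ Finset.Icc (-N : ℤ) N, (innerSL ℝ (cas L k)).smulRight (cas L k)

theorem partialSum_apply (N : ℕ) (u : L2 L) :
    partialSum L N u = ∑ k ∈ Finset.Icc (-N : ℤ) N, ⟪cas L k, u⟫ • cas L k := by
  simp [partialSum]

theorem tendsto_Icc_neg_nat : Tendsto (fun N : ℕ => Finset.Icc (-N : ℤ) N) atTop atTop := by
  refine tendsto_atTop_finset_of_monotone ?_ ?_
  · intro a b hab
    exact Finset.Icc_subset_Icc (by simpa using hab) (by simpa using hab)
  · intro k
    refine ⟨k.natAbs, ?_⟩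
    simp only [Finset.mem_Icc]
    omega

theorem tendsto_partialSum (u : L2 L) :
    Tendsto (fun N => partialSum L N u) atTop (𝓝 u) := by
  simp only [partialSum_apply]
  exact (hasSum_cas u).comp tendsto_Icc_neg_nat

/-- The range of frequencies is symmetric under k ↦ −k, so truncation commutes with differentiation.
-/
theorem partialSum_deriv {p : L2 L × L2 L} (hp : p ∈ H1 L) (N : ℕ) :
    partialSum L N p.2 =
      ∑ k ∈ Finset.Icc (-N : ℤ) N, ⟪cas L k, p.1⟫ • freq L k • cas L (-k) := by
  rw [partialSum_apply]
  refine Finset.sum_nbij' (fun k => -k) (fun k => -k) ?_ ?_ ?_ ?_ ?_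
  · intro k hk; simp only [Finset.mem_Icc] at *; omega
  · intro k hk; simp only [Finset.mem_Icc] at *; omega
  · intro k _; simp
  · intro k _; simp
  · intro k _
    rw [inner_cas_deriv hp, freq_neg, neg_neg, smul_smul]
    congr 1
    ring

theorem partialSum_mem_H1 {p : L2 L × L2 L} (hp : p ∈ H1 L) (N : ℕ) :
    (partialSum L N p.1, partialSum L N p.2) ∈ H1 L := by
  have : (partialSum L N p.1, partialSum L N p.2) =
      ∑ k ∈ Finset.Icc (-N : ℤ) N, ⟪cas L k, p.1⟫ • (cas L k, freq L k • cas L (-k)) := by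
    rw [partialSum_deriv hp, partialSum_apply]
    ext1
    · simp [Prod.fst_sum]
    · simp [Prod.snd_sum]
  rw [this]
  exact Submodule.sum_mem _ fun k _ => Submodule.smul_mem _ _ (cas_mem_H1 k)

theorem inner_partialSum (N : ℕ) (u v : L2 L) :
    ⟪partialSum L N u, v⟫ = ⟪u, partialSum L N v⟫ := by
  simp only [partialSum_apply, sum_inner, inner_sum, real_inner_smul_left, real_inner_smul_right]
  refine Finset.sum_congr rfl fun k _ => ?_
  rw [real_inner_comm u]
  ring

theorem partialSum_partialSum (N : ℕ) (u : L2 L) :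
    partialSum L N (partialSum L N u) = partialSum L N u := by
  rw [partialSum_apply, partialSum_apply]
  refine Finset.sum_congr rfl fun k hk => ?_
  congr 1
  rw [inner_sum, Finset.sum_eq_single_of_mem k hk]
  · simp [real_inner_smul_right, orthonormal_cas.norm_eq_one]
  · intro j _ hj
    rw [real_inner_smul_right, orthonormal_cas.inner_eq_zero hj.symm, mul_zero]

theorem norm_partialSum_le (N : ℕ) (u : L2 L) : ‖partialSum L N u‖ ≤ ‖u‖ := by
  have h : ‖partialSum L N u‖ ^ 2 ≤ ‖partialSum L N u‖ * ‖u‖ := by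
    rw [← real_inner_self_eq_norm_sq, inner_partialSum, partialSum_partialSum, real_inner_comm]
    exact real_inner_le_norm _ _
  rcases (norm_nonneg (partialSum L N u)).eq_or_lt with h0 | h0
  · rw [← h0]; exact norm_nonneg _
  · rw [pow_two] at h
    exact le_of_mul_le_mul_left h h0

/-- Smooth periodic functions are dense among the functions with a weak derivative. -/
theorem exists_test_seq {p : L2 L × L2 L} (hp : p ∈ H1 L) :
    ∃ φ : ℕ → ℝ → ℝ, ∃ h : ∀ n, IsTest L (φ n),
      Tendsto (fun n => (ofCont L _ (h n).continuous, ofCont L _ (h n).deriv.continuous)) atTop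
        (𝓝 p) := by
  have ht : ∀ N : ℕ, IsTest L
      (fun x => ∑ k ∈ Finset.Icc (-N : ℤ) N, ⟪cas L k, p.1⟫ * casFun L k x) := by
    intro N
    refine ⟨ContDiff.sum fun k _ => contDiff_const.mul (isTest_casFun k).1, fun x => ?_⟩
    refine Finset.sum_congr rfl fun k _ => ?_
    rw [(isTest_casFun k).2]
  refine ⟨_, ht, ?_⟩
  have e1 : ∀ N, ofCont L _ (ht N).continuous = partialSum L N p.1 := by
    intro N
    rw [partialSum_apply]
    refine Lp.ext ?_
    filter_upwards [coeFn_ofCont L (ht N).continuous,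
      Lp.coeFn_finsetSum (Finset.Icc (-N : ℤ) N) (fun k => ⟪cas L k, p.1⟫ • cas L k),
      ae_all_iff.2 fun k : ℤ => Lp.coeFn_smul ⟪cas L k, p.1⟫ (cas L k),
      ae_all_iff.2 fun k : ℤ => coeFn_ofCont L (continuous_casFun L k)] with x h1 h2 h3 h4
    rw [h1, h2]
    simp only [Finset.sum_apply, h3, Pi.smul_apply, smul_eq_mul]
    refine Finset.sum_congr rfl fun k _ => ?_
    rw [cas, h4]
  have e2 : ∀ N, ofCont L _ (ht N).deriv.continuous = partialSum L N p.2 := by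
    intro N
    refine deriv_unique (ht N).mem_H1 ?_
    rw [e1]
    exact partialSum_mem_H1 hp N
  simp only [e1, e2]
  exact (tendsto_partialSum p.1).prodMk_nhds (tendsto_partialSum p.2)

/-! ### The Poincaré inequality -/

/-- The link between the cosine and sine modes that define `P` and the basis in which norms are
computed. -/
theorem inner_cas_eq (u : L2 L) (k : ℕ) (h1 : ⟪cosMode L k, u⟫ = 0) (h2 : ⟪sinMode L k, u⟫ = 0) :
    ⟪cas L k, u⟫ = 0 ∧ ⟪cas L (-k), u⟫ = 0 := by
  have hs : cas L k = (√L)⁻¹ • (cosMode L k + sinMode L k) := by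
    refine Lp.ext ?_
    filter_upwards [coeFn_ofCont L (continuous_casFun L k),
      Lp.coeFn_smul (√L)⁻¹ (cosMode L k + sinMode L k), Lp.coeFn_add (cosMode L k) (sinMode L k),
      MemLp.coeFn_toLp (memLp_of_continuous L
        (g := fun x => Real.cos (2 * Real.pi * k * x / L)) (by fun_prop)),
      MemLp.coeFn_toLp (memLp_of_continuous L
        (g := fun x => Real.sin (2 * Real.pi * k * x / L)) (by fun_prop))] with x e1 e2 e3 e4 e5
    rw [cas, e1, e2, Pi.smul_apply, e3, Pi.add_apply, cosMode, sinMode, e4, e5]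
    have : freq L k * x = 2 * Real.pi * k * x / L := by unfold freq; push_cast; ring
    rw [casFun, this, smul_eq_mul]
    ring
  have hd : cas L (-k) = (√L)⁻¹ • (cosMode L k - sinMode L k) := by
    refine Lp.ext ?_
    filter_upwards [coeFn_ofCont L (continuous_casFun L (-k)),
      Lp.coeFn_smul (√L)⁻¹ (cosMode L k - sinMode L k), Lp.coeFn_sub (cosMode L k) (sinMode L k),
      MemLp.coeFn_toLp (memLp_of_continuous L
        (g := fun x => Real.cos (2 * Real.pi * k * x / L)) (by fun_prop)),
      MemLp.coeFn_toLp (memLp_of_continuous L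
        (g := fun x => Real.sin (2 * Real.pi * k * x / L)) (by fun_prop))] with x e1 e2 e3 e4 e5
    rw [cas, e1, e2, Pi.smul_apply, e3, Pi.sub_apply, cosMode, sinMode, e4, e5]
    have : freq L (-k) * x = -(2 * Real.pi * k * x / L) := by unfold freq; push_cast; ring
    rw [casFun, this, smul_eq_mul, Real.cos_neg, Real.sin_neg]
    ring
  constructor
  · rw [hs, real_inner_smul_left, inner_add_left, h1, h2]; simp
  · rw [hd, real_inner_smul_left, inner_sub_left, h1, h2]; simp

/-- The projection removes the frequencies 0 < |k| ≤ m and the zero mean removes k = 0. On the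
remaining ones |k| ≥ m + 1, so the derivative multiplies each coefficient by at least 2π(m+1)/L in
modulus. -/
theorem norm_le_of_proj_eq_zero {p : L2 L × L2 L} (hp : p ∈ H1 L) (m : ℕ)
    (h0 : ∫ x in Ioc (0 : ℝ) L, p.1 x = 0) (hP : P L m p.1 = 0) :
    ‖p.1‖ ≤ L / (2 * Real.pi * (m + 1)) * ‖p.2‖ := by
  have hL0 := hL.out
  have hpi := Real.pi_pos
  have hperp : p.1 ∈ (modeSpace L m)ᗮ := by
    rwa [P, Submodule.starProjection_apply_eq_zero_iff] at hP
  have hz : ∀ k : ℤ, |k| ≤ m → ⟪cas L k, p.1⟫ = 0 := by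
    have hnat : ∀ k : ℕ, k ≤ m → ⟪cas L k, p.1⟫ = 0 ∧ ⟪cas L (-k), p.1⟫ = 0 := by
      intro k hk
      rcases Nat.eq_zero_or_pos k with rfl | hk0
      · have : ⟪cas L 0, p.1⟫ = 0 := by
          rw [inner_cas]
          simp only [casFun, freq, Int.cast_zero, mul_zero, zero_div, zero_mul, Real.cos_zero,
            Real.sin_zero, add_zero]
          rw [integral_mul_const, h0, zero_mul]
        simp [this]
      · have hk' : k ∈ Icc 1 m := ⟨hk0, hk⟩
        refine inner_cas_eq _ _ ?_ ?_
        · exact (Submodule.mem_orthogonal _ _).1 hperp _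
            (Submodule.subset_span (Or.inl ⟨k, hk', rfl⟩))
        · exact (Submodule.mem_orthogonal _ _).1 hperp _
            (Submodule.subset_span (Or.inr ⟨k, hk', rfl⟩))
    intro k hk
    rw [Int.abs_eq_natAbs] at hk
    rcases Int.natAbs_eq k with h | h
    · rw [h]; exact (hnat k.natAbs (by omega)).1
    · rw [h]; exact (hnat k.natAbs (by omega)).2
  have hle : ‖p.1‖ ^ 2 ≤ (L / (2 * Real.pi * (m + 1)) * ‖p.2‖) ^ 2 := by
    rw [mul_pow]
    have hs2 := ((Equiv.neg ℤ).hasSum_iff.2 (hasSum_norm_sq p.2)).mul_left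
      ((L / (2 * Real.pi * (m + 1))) ^ 2)
    refine hasSum_le (fun k => ?_) (hasSum_norm_sq p.1) hs2
    simp only [Function.comp_apply, Equiv.neg_apply]
    rw [inner_cas_deriv hp, neg_neg, freq_neg]
    rcases le_or_gt |k| (m : ℤ) with hk | hk
    · rw [hz k hk]; simp
    · have hk1 : ((m : ℝ) + 1) ≤ |(k : ℝ)| := by
        have : ((m : ℤ) + 1) ≤ |k| := hk
        exact_mod_cast this
      have : (L / (2 * Real.pi * (m + 1))) ^ 2 * (-(-freq L k * ⟪cas L k, p.1⟫)) ^ 2 =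
          (|(k : ℝ)| / (m + 1)) ^ 2 * ⟪cas L k, p.1⟫ ^ 2 := by
        rw [div_pow |(k : ℝ)|, sq_abs, freq]
        field_simp
      rw [this]
      have h1 : 1 ≤ |(k : ℝ)| / (m + 1) := by
        rw [le_div_iff₀ (by positivity)]; linarith
      have h2 : 1 ≤ (|(k : ℝ)| / (m + 1)) ^ 2 := one_le_pow₀ h1
      nlinarith [sq_nonneg ⟪cas L k, p.1⟫]
  exact (pow_le_pow_iff_left₀ (norm_nonneg _) (by positivity) two_ne_zero).1 hle

theorem norm_le_norm_deriv {p : L2 L × L2 L} (hp : p ∈ H1 L)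
    (h0 : ∫ x in Ioc (0 : ℝ) L, p.1 x = 0) : ‖p.1‖ ≤ L / (2 * Real.pi) * ‖p.2‖ := by
  have hm : modeSpace L 0 = ⊥ := by simp [modeSpace]
  have := norm_le_of_proj_eq_zero hp 0 h0 (by
    rw [P, Submodule.starProjection_apply_eq_zero_iff, hm]; simp)
  simpa using this

/-! ### The supremum bound -/

theorem inner_ofCont_ofCont {g h : ℝ → ℝ} (hg : Continuous g) (hh : Continuous h) :
    ⟪ofCont L g hg, ofCont L h hh⟫ = ∫ x in (0 : ℝ)..L, g x * h x := by
  rw [inner_ofCont, intervalIntegral.integral_of_le hL.out.le]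
  refine integral_congr_ae ?_
  filter_upwards [coeFn_ofCont L hg] with x hx
  rw [hx]

theorem integral_abs_mul_le {g h : ℝ → ℝ} (hg : Continuous g) (hh : Continuous h) :
    ∫ x in (0 : ℝ)..L, |g x * h x| ≤ ‖ofCont L g hg‖ * ‖ofCont L h hh‖ := by
  have habs : ∀ {k : ℝ → ℝ} (hk : Continuous k), ‖ofCont L _ hk.abs‖ = ‖ofCont L k hk‖ := by
    intro k hk
    rw [← sq_eq_sq₀ (norm_nonneg _) (norm_nonneg _), ← real_inner_self_eq_norm_sq,
      ← real_inner_self_eq_norm_sq, inner_ofCont_ofCont, inner_ofCont_ofCont]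
    simp
  simp_rw [abs_mul]
  rw [← inner_ofCont_ofCont hg.abs hh.abs, ← habs hg, ← habs hh]
  exact real_inner_le_norm _ _

/-- Two points of the circle are joined by two arcs, and ψ varies by at least |ψ b − ψ a| along
each. The resulting factor 2 is what gives the supremum bound the constant 1. -/
theorem two_mul_abs_sub_le {ψ h : ℝ → ℝ} (hψ : ∀ x, HasDerivAt ψ (h x) x) (hh : Continuous h)
    (hper : ψ L = ψ 0) {a b : ℝ} (ha : 0 ≤ a) (hab : a ≤ b) (hb : b ≤ L) :
    2 * |ψ b - ψ a| ≤ ∫ x in (0 : ℝ)..L, |h x| := by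
  have hi : ∀ c d, IntervalIntegrable h volume c d := fun c d => hh.intervalIntegrable c d
  have hi' : ∀ c d, IntervalIntegrable (fun x => |h x|) volume c d :=
    fun c d => hh.abs.intervalIntegrable c d
  have ftc : ∀ c d, ∫ x in c..d, h x = ψ d - ψ c := fun c d =>
    intervalIntegral.integral_eq_sub_of_hasDerivAt (fun x _ => hψ x) (hi c d)
  have bd : ∀ {c d}, c ≤ d → |ψ d - ψ c| ≤ ∫ x in c..d, |h x| := by
    intro c d hcd
    rw [← ftc]
    exact intervalIntegral.abs_integral_le_integral_abs hcd
  have e1 : ψ b - ψ a = -((ψ L - ψ b) + (ψ a - ψ 0)) := by rw [hper]; ring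
  have h1 := bd hab
  have h2 : |ψ b - ψ a| ≤ (∫ x in b..L, |h x|) + ∫ x in (0 : ℝ)..a, |h x| := by
    rw [e1, abs_neg]
    exact (abs_add_le _ _).trans (add_le_add (bd hb) (bd ha))
  have h3 : ∫ x in (0 : ℝ)..L, |h x| =
      (∫ x in (0 : ℝ)..a, |h x|) + (∫ x in a..b, |h x|) + ∫ x in b..L, |h x| := by
    rw [intervalIntegral.integral_add_adjacent_intervals (hi' _ _) (hi' _ _),
      intervalIntegral.integral_add_adjacent_intervals (hi' _ _) (hi' _ _)]
  linarith

theorem IsTest.sq_le {φ : ℝ → ℝ} (h : IsTest L φ) (h0 : ∫ x in (0 : ℝ)..L, φ x = 0) {x : ℝ}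
    (hx : x ∈ Icc 0 L) :
    φ x ^ 2 ≤ ‖ofCont L φ h.continuous‖ * ‖ofCont L _ h.deriv.continuous‖ := by
  have hL0 := hL.out
  -- Rolle's theorem for the primitive of φ, which vanishes at both ends because φ has mean zero.
  obtain ⟨y, hy, hy0⟩ : ∃ y ∈ Ioo 0 L, φ y = 0 := by
    refine exists_hasDerivAt_eq_zero (f := fun t => ∫ x in (0 : ℝ)..t, φ x) hL0 ?_ ?_ ?_
    · exact (intervalIntegral.continuous_primitive
        (fun a b => h.continuous.intervalIntegrable a b) 0).continuousOn
    · simp [h0]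
    · intro t _
      exact intervalIntegral.integral_hasDerivAt_right (h.continuous.intervalIntegrable _ _)
        (h.continuous.stronglyMeasurableAtFilter _ _) h.continuous.continuousAt
  have hd : ∀ x, HasDerivAt (fun x => φ x ^ 2) (2 * (φ x * _root_.deriv φ x)) x := by
    intro x
    refine ((h.differentiable x).hasDerivAt.fun_pow 2).congr_deriv ?_
    push_cast
    ring
  have hc : Continuous fun x => 2 * (φ x * _root_.deriv φ x) :=
    continuous_const.mul (h.continuous.mul h.deriv.continuous)
  have hper : φ L ^ 2 = φ 0 ^ 2 := by
    have := h.2 0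
    rw [zero_add] at this
    rw [this]
  -- The two-arc estimate is applied to φ² between x and the zero y of φ.
  have key : 2 * |φ x ^ 2| ≤ ∫ x in (0 : ℝ)..L, |2 * (φ x * _root_.deriv φ x)| := by
    rcases le_total y x with hyx | hxy
    · have := two_mul_abs_sub_le hd hc hper hy.1.le hyx hx.2
      simpa [hy0] using this
    · have := two_mul_abs_sub_le hd hc hper hx.1 hxy hy.2.le
      simpa [hy0] using this
  have e : ∫ x in (0 : ℝ)..L, |2 * (φ x * _root_.deriv φ x)| =
      2 * ∫ x in (0 : ℝ)..L, |φ x * _root_.deriv φ x| := by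
    simp_rw [abs_mul (2 : ℝ), abs_two]
    rw [intervalIntegral.integral_const_mul]
  rw [e, abs_of_nonneg (sq_nonneg _)] at key
  have := integral_abs_mul_le (L := L) h.continuous h.deriv.continuous
  linarith

/-- The constant function `1`. -/
def one (L : ℝ) : L2 L := ofCont L (fun _ => (1 : ℝ)) continuous_const

theorem norm_one_sq : ‖one L‖ ^ 2 = L := by
  rw [← real_inner_self_eq_norm_sq, one, inner_ofCont_ofCont]
  simp

theorem inner_one_right (u : L2 L) : ⟪u, one L⟫ = ∫ x in Ioc (0 : ℝ) L, u x := inner_one u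

/-- The means of the approximating functions tend to zero, since the mean is a continuous
functional; subtracting them does not change the derivatives. -/
theorem exists_test_seq_mean_zero {p : L2 L × L2 L} (hp : p ∈ H1 L)
    (h0 : ∫ x in Ioc (0 : ℝ) L, p.1 x = 0) :
    ∃ φ : ℕ → ℝ → ℝ, ∃ h : ∀ n, IsTest L (φ n), (∀ n, ∫ x in (0 : ℝ)..L, φ n x = 0) ∧
      Tendsto (fun n => (ofCont L _ (h n).continuous, ofCont L _ (h n).deriv.continuous)) atTop
        (𝓝 p) := by
  have hL0 := hL.out
  obtain ⟨φ, h, ht⟩ := exists_test_seq hp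
  set c : ℕ → ℝ := fun n => (∫ x in (0 : ℝ)..L, φ n x) / L with hc
  have h' : ∀ n, IsTest L (fun x => φ n x - c n) := fun n =>
    ⟨(h n).1.sub contDiff_const, fun x => by simp only [(h n).2 x]⟩
  have e1 : ∀ n, ofCont L _ (h' n).continuous = ofCont L _ (h n).continuous - c n • one L := by
    intro n
    refine Lp.ext ?_
    filter_upwards [coeFn_ofCont L (h' n).continuous, coeFn_ofCont L (h n).continuous,
      Lp.coeFn_sub (ofCont L _ (h n).continuous) (c n • one L), Lp.coeFn_smul (c n) (one L),
      coeFn_ofCont L (g := fun _ => (1 : ℝ)) continuous_const] with x h1 h2 h3 h4 h5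
    rw [h1, h3, Pi.sub_apply, h2, h4, Pi.smul_apply, one, h5]
    simp
  have e2 : ∀ n, ofCont L _ (h' n).deriv.continuous = ofCont L _ (h n).deriv.continuous := by
    intro n
    refine Lp.ext ?_
    filter_upwards [coeFn_ofCont L (h' n).deriv.continuous,
      coeFn_ofCont L (h n).deriv.continuous] with x h1 h2
    rw [h1, h2, deriv_sub_const]
  refine ⟨_, h', fun n => ?_, ?_⟩
  · rw [intervalIntegral.integral_sub ((h n).continuous.intervalIntegrable _ _) (by simp), hc]
    simp
    field_simp
    ring
  · simp only [e1, e2]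
    have t1 : Tendsto (fun n => ofCont L _ (h n).continuous) atTop (𝓝 p.1) :=
      (continuous_fst.tendsto p).comp ht
    have t2 : Tendsto (fun n => ofCont L _ (h n).deriv.continuous) atTop (𝓝 p.2) :=
      (continuous_snd.tendsto p).comp ht
    have t3 : Tendsto c atTop (𝓝 0) := by
      have e : c = fun n => ⟪ofCont L _ (h n).continuous, one L⟫ / L := by
        funext n
        rw [one, inner_ofCont_ofCont]
        simp [hc]
      have := (t1.inner (tendsto_const_nhds (x := one L))).div_const L
      rw [inner_one_right, h0, zero_div] at this
      rwa [e]
    have t4 := t1.sub (t3.smul (tendsto_const_nhds (x := one L)))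
    rw [zero_smul, sub_zero] at t4
    exact t4.prodMk_nhds t2

theorem exists_ae_tendsto {f : ℕ → L2 L} {g : L2 L} (h : Tendsto f atTop (𝓝 g)) :
    ∃ ns : ℕ → ℕ, StrictMono ns ∧ ∀ᵐ x ∂(volume.restrict (Ioc (0 : ℝ) L)),
      Tendsto (fun n => f (ns n) x) atTop (𝓝 (g x)) :=
  (tendstoInMeasure_of_tendsto_Lp h).exists_seq_tendsto_ae

/-- The supremum bound for periodic functions of mean zero. -/
theorem ae_sq_le {p : L2 L × L2 L} (hp : p ∈ H1 L) (h0 : ∫ x in Ioc (0 : ℝ) L, p.1 x = 0) :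
    ∀ᵐ x ∂(volume.restrict (Ioc (0 : ℝ) L)), p.1 x ^ 2 ≤ ‖p.1‖ * ‖p.2‖ := by
  obtain ⟨φ, h, hz, ht⟩ := exists_test_seq_mean_zero hp h0
  have t1 : Tendsto (fun n => ofCont L _ (h n).continuous) atTop (𝓝 p.1) :=
    (continuous_fst.tendsto p).comp ht
  have t2 : Tendsto (fun n => ofCont L _ (h n).deriv.continuous) atTop (𝓝 p.2) :=
    (continuous_snd.tendsto p).comp ht
  obtain ⟨ns, hns, hae⟩ := exists_ae_tendsto t1
  filter_upwards [hae, ae_all_iff.2 fun n => coeFn_ofCont L (h n).continuous,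
    ae_restrict_mem measurableSet_Ioc] with x hx hx' hmem
  refine le_of_tendsto_of_tendsto' (hx.pow 2)
    ((t1.norm.mul t2.norm).comp hns.tendsto_atTop) fun n => ?_
  rw [hx']
  exact (h (ns n)).sq_le (hz _) (Ioc_subset_Icc_self hmem)

theorem ae_abs_le {p : L2 L × L2 L} (hp : p ∈ H1 L) (h0 : ∫ x in Ioc (0 : ℝ) L, p.1 x = 0) :
    ∀ᵐ x ∂(volume.restrict (Ioc (0 : ℝ) L)), |p.1 x| ≤ √(‖p.1‖ * ‖p.2‖) := by
  filter_upwards [ae_sq_le hp h0] with x hx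
  exact Real.abs_le_sqrt hx

/-- A constant of the embedding of `H1` into the bounded functions. -/
def supConst (L : ℝ) : ℝ := ‖one L‖ / L + (1 + ‖one L‖ ^ 2 / L)

/-- The mean is split off and estimated by the L² norm; the rest has mean zero and the same
derivative, so the sharp supremum bound applies to it. -/
theorem ae_abs_le_norm (p : H1 L) :
    ∀ᵐ x ∂(volume.restrict (Ioc (0 : ℝ) L)), |p.1.1 x| ≤ supConst L * ‖p‖ := by
  have hL0 := hL.out
  obtain ⟨⟨a, b⟩, hp⟩ := p
  set n := ‖(⟨(a, b), hp⟩ : H1 L)‖ with hn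
  have hn' : n = max ‖a‖ ‖b‖ := rfl
  have ha : ‖a‖ ≤ n := hn' ▸ le_max_left _ _
  have hb : ‖b‖ ≤ n := hn' ▸ le_max_right _ _
  have hn0 : 0 ≤ n := norm_nonneg _
  set c : ℝ := ⟪a, one L⟫ / L with hc
  have hc1 : |c| ≤ ‖one L‖ / L * n := by
    rw [hc, abs_div, abs_of_pos hL0, div_mul_eq_mul_div]
    gcongr
    calc |⟪a, one L⟫| ≤ ‖a‖ * ‖one L‖ := abs_real_inner_le_norm _ _
      _ ≤ ‖one L‖ * n := by rw [mul_comm]; gcongr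
  have hq : (a - c • one L, b) ∈ H1 L := by
    have := (H1 L).sub_mem hp ((H1 L).smul_mem c (one_mem_H1 (L := L)))
    simpa [one] using this
  have hq0 : ∫ x in Ioc (0 : ℝ) L, (a - c • one L) x = 0 := by
    rw [← inner_one_right, inner_sub_left, real_inner_smul_left, real_inner_self_eq_norm_sq,
      norm_one_sq, hc]
    field_simp
    ring
  have hq1 : ‖a - c • one L‖ ≤ (1 + ‖one L‖ ^ 2 / L) * n := by
    calc ‖a - c • one L‖ ≤ ‖a‖ + |c| * ‖one L‖ := by
          refine (norm_sub_le _ _).trans_eq ?_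
          rw [norm_smul, Real.norm_eq_abs]
      _ ≤ n + (‖one L‖ / L * n) * ‖one L‖ := by gcongr
      _ = _ := by ring
  have hK : 1 ≤ 1 + ‖one L‖ ^ 2 / L := by
    have : 0 ≤ ‖one L‖ ^ 2 / L := by positivity
    linarith
  filter_upwards [ae_abs_le hq hq0, Lp.coeFn_sub a (c • one L), Lp.coeFn_smul c (one L),
    coeFn_ofCont L (g := fun _ => (1 : ℝ)) continuous_const] with x h1 h2 h3 h4
  rw [h2, Pi.sub_apply, h3, Pi.smul_apply, one, h4] at h1
  have h5 : √(‖a - c • one L‖ * ‖b‖) ≤ (1 + ‖one L‖ ^ 2 / L) * n := by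
    rw [Real.sqrt_le_left (by positivity)]
    calc ‖a - c • one L‖ * ‖b‖ ≤ ((1 + ‖one L‖ ^ 2 / L) * n) * ((1 + ‖one L‖ ^ 2 / L) * n) := by
          gcongr
          nlinarith
      _ = _ := by ring
  have h6 : |a x| ≤ |a x - c • 1| + |c| := by
    have := abs_add_le (a x - c • 1) c
    simpa using this
  rw [supConst, add_mul]
  exact h6.trans (by linarith [h1.trans h5])

/-! ### Multiplication -/

theorem memLp_mul (a : H1 L) (b : L2 L) :
    MemLp (fun x => a.1.1 x * b x) 2 (volume.restrict (Ioc (0 : ℝ) L)) := by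
  refine (Lp.memLp b).of_le_mul (c := supConst L * ‖a‖)
    ((Lp.aestronglyMeasurable _).mul (Lp.aestronglyMeasurable _)) ?_
  filter_upwards [ae_abs_le_norm a] with x hx
  rw [norm_mul]
  gcongr
  exact hx

/-- Multiplication of a square integrable function by a function with a weak derivative. -/
def M : H1 L →L[ℝ] L2 L →L[ℝ] L2 L :=
  LinearMap.mkContinuous₂
    (LinearMap.mk₂ ℝ (fun a b => (memLp_mul a b).toLp _)
      (by
        intro a a' b
        refine Lp.ext ?_
        filter_upwards [MemLp.coeFn_toLp (memLp_mul (a + a') b), MemLp.coeFn_toLp (memLp_mul a b),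
          MemLp.coeFn_toLp (memLp_mul a' b), Lp.coeFn_add a.1.1 a'.1.1,
          Lp.coeFn_add ((memLp_mul a b).toLp _) ((memLp_mul a' b).toLp _)] with x h1 h2 h3 h4 h5
        rw [h1, h5, Pi.add_apply, h2, h3]
        have : (a + a').1.1 x = a.1.1 x + a'.1.1 x := h4
        rw [this]
        ring)
      (by
        intro c a b
        refine Lp.ext ?_
        filter_upwards [MemLp.coeFn_toLp (memLp_mul (c • a) b), MemLp.coeFn_toLp (memLp_mul a b),
          Lp.coeFn_smul c a.1.1, Lp.coeFn_smul c ((memLp_mul a b).toLp _)] with x h1 h2 h4 h5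
        rw [h1, h5, Pi.smul_apply, h2]
        have : (c • a).1.1 x = c * a.1.1 x := h4
        rw [this, smul_eq_mul]
        ring)
      (by
        intro a b b'
        refine Lp.ext ?_
        filter_upwards [MemLp.coeFn_toLp (memLp_mul a (b + b')), MemLp.coeFn_toLp (memLp_mul a b),
          MemLp.coeFn_toLp (memLp_mul a b'), Lp.coeFn_add b b',
          Lp.coeFn_add ((memLp_mul a b).toLp _) ((memLp_mul a b').toLp _)] with x h1 h2 h3 h4 h5
        rw [h1, h5, Pi.add_apply, h2, h3, h4, Pi.add_apply]
        ring)
      (by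
        intro c a b
        refine Lp.ext ?_
        filter_upwards [MemLp.coeFn_toLp (memLp_mul a (c • b)), MemLp.coeFn_toLp (memLp_mul a b),
          Lp.coeFn_smul c b, Lp.coeFn_smul c ((memLp_mul a b).toLp _)] with x h1 h2 h4 h5
        rw [h1, h5, Pi.smul_apply, h2, h4, Pi.smul_apply, smul_eq_mul, smul_eq_mul]
        ring))
    (supConst L)
    (by
      intro a b
      simp only [LinearMap.mk₂_apply]
      refine Lp.norm_le_mul_norm_of_ae_le_mul ?_
      filter_upwards [MemLp.coeFn_toLp (memLp_mul a b), ae_abs_le_norm a] with x h1 h2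
      rw [h1, norm_mul]
      gcongr
      exact h2)

theorem coeFn_M (a : H1 L) (b : L2 L) :
    M a b =ᵐ[volume.restrict (Ioc (0 : ℝ) L)] fun x => a.1.1 x * b x :=
  MemLp.coeFn_toLp (memLp_mul a b)

theorem norm_M_le {a : H1 L} {S : ℝ}
    (h : ∀ᵐ x ∂(volume.restrict (Ioc (0 : ℝ) L)), |a.1.1 x| ≤ S) (b : L2 L) :
    ‖M a b‖ ≤ S * ‖b‖ := by
  refine Lp.norm_le_mul_norm_of_ae_le_mul ?_
  filter_upwards [coeFn_M a b, h] with x h1 h2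
  rw [h1, norm_mul]
  gcongr
  exact h2

theorem M_comm (a b : H1 L) : M a b.1.1 = M b a.1.1 := by
  refine Lp.ext ?_
  filter_upwards [coeFn_M a b.1.1, coeFn_M b a.1.1] with x h1 h2
  rw [h1, h2, mul_comm]

theorem M_left_comm (a b : H1 L) (c : L2 L) : M a (M b c) = M b (M a c) := by
  refine Lp.ext ?_
  filter_upwards [coeFn_M a (M b c), coeFn_M b (M a c), coeFn_M a c, coeFn_M b c] with x h1 h2 h3 h4
  rw [h1, h2, h3, h4]
  ring

theorem inner_M_left (a : H1 L) (b c : L2 L) : ⟪M a b, c⟫ = ⟪b, M a c⟫ := by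
  rw [inner_eq_integral, inner_eq_integral]
  refine integral_congr_ae ?_
  filter_upwards [coeFn_M a b, coeFn_M a c] with x h1 h2
  rw [h1, h2]
  ring

theorem inner_M_eq_integral (a : H1 L) (b c : L2 L) :
    ⟪M a b, c⟫ = ∫ x in Ioc (0 : ℝ) L, a.1.1 x * b x * c x := by
  rw [inner_eq_integral]
  refine integral_congr_ae ?_
  filter_upwards [coeFn_M a b] with x h1
  rw [h1]

/-- Leibniz' rule for weak derivatives. -/
theorem mul_mem_H1 (a b : H1 L) : (M a b.1.1, M a b.1.2 + M b a.1.2) ∈ H1 L := by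
  -- When one factor φ is smooth and periodic, φψ is again a test function, and the claim is the
  -- weak derivative of `a` tested with φψ.
  have smooth : ∀ (φ : ℝ → ℝ) (h : IsTest L φ),
      (M a (ofCont L φ h.continuous),
        M a (ofCont L _ h.deriv.continuous) + M ⟨_, h.mem_H1⟩ a.1.2) ∈ H1 L := by
    intro φ h
    rw [KdV.mem_H1, isWeakDeriv_iff]
    intro ψ hψ
    have key := isWeakDeriv_iff.1 (KdV.mem_H1.1 a.2) _ (h.mul hψ)
    have e1 : ofCont L _ (h.mul hψ).deriv.continuous =
        ofCont L _ (h.deriv.mul hψ).continuous + ofCont L _ (h.mul hψ.deriv).continuous := by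
      refine Lp.ext ?_
      filter_upwards [coeFn_ofCont L (h.mul hψ).deriv.continuous,
        coeFn_ofCont L (h.deriv.mul hψ).continuous, coeFn_ofCont L (h.mul hψ.deriv).continuous,
        Lp.coeFn_add (ofCont L _ (h.deriv.mul hψ).continuous)
          (ofCont L _ (h.mul hψ.deriv).continuous)] with x h1 h2 h3 h4
      rw [h1, h4, Pi.add_apply, h2, h3]
      exact deriv_fun_mul (h.differentiable x) (hψ.differentiable x)
    have e2 : ⟪a.1.1, ofCont L _ (h.mul hψ.deriv).continuous⟫ =
        ⟪M a (ofCont L φ h.continuous), ofCont L _ hψ.deriv.continuous⟫ := by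
      rw [inner_M_eq_integral, inner_eq_integral]
      refine integral_congr_ae ?_
      filter_upwards [coeFn_ofCont L (h.mul hψ.deriv).continuous, coeFn_ofCont L h.continuous,
        coeFn_ofCont L hψ.deriv.continuous] with x h1 h2 h3
      rw [h1, h2, h3]
      ring
    have e3 : ⟪a.1.1, ofCont L _ (h.deriv.mul hψ).continuous⟫ =
        ⟪M a (ofCont L _ h.deriv.continuous), ofCont L _ hψ.continuous⟫ := by
      rw [inner_M_eq_integral, inner_eq_integral]
      refine integral_congr_ae ?_
      filter_upwards [coeFn_ofCont L (h.deriv.mul hψ).continuous,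
        coeFn_ofCont L h.deriv.continuous, coeFn_ofCont L hψ.continuous] with x h1 h2 h3
      rw [h1, h2, h3]
      ring
    have e4 : ⟪a.1.2, ofCont L _ (h.mul hψ).continuous⟫ =
        ⟪M ⟨_, h.mem_H1⟩ a.1.2, ofCont L _ hψ.continuous⟫ := by
      rw [inner_M_eq_integral, inner_eq_integral]
      refine integral_congr_ae ?_
      filter_upwards [coeFn_ofCont L (h.mul hψ).continuous,
        coeFn_ofCont L h.continuous, coeFn_ofCont L hψ.continuous] with x h1 h2 h3
      rw [h1, h2, h3]
      ring
    rw [e1, inner_add_right, e2, e3, e4] at key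
    rw [inner_add_left]
    linarith
  -- A general `b` is approximated in `H1`; the products and their derivatives converge in L² by
  -- continuity of `M` in both arguments, and `H1` is closed.
  obtain ⟨φ, h, ht⟩ := exists_test_seq b.2
  have ht' : Tendsto (fun n => (⟨_, (h n).mem_H1⟩ : H1 L)) atTop (𝓝 b) := tendsto_subtype_rng.2 ht
  have t1 : Tendsto (fun n => ofCont L _ (h n).continuous) atTop (𝓝 b.1.1) :=
    (continuous_fst.tendsto _).comp ht
  have t2 : Tendsto (fun n => ofCont L _ (h n).deriv.continuous) atTop (𝓝 b.1.2) :=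
    (continuous_snd.tendsto _).comp ht
  refine (isClosed_H1 L).mem_of_tendsto (b := atTop) (f := fun n => (M a (ofCont L _ (h n).continuous),
    M a (ofCont L _ (h n).deriv.continuous) + M ⟨_, (h n).mem_H1⟩ a.1.2)) ?_
    (Eventually.of_forall fun n => smooth _ (h n))
  refine Tendsto.prodMk_nhds (((M a).continuous.tendsto _).comp t1)
    ((((M a).continuous.tendsto _).comp t2).add ?_)
  have : Continuous fun c : H1 L => M c a.1.2 := by fun_prop
  exact (this.tendsto b).comp ht'

/-- The product in `H1`. -/
def mulH (a b : H1 L) : H1 L := ⟨_, mul_mem_H1 a b⟩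

@[simp] theorem mulH_fst (a b : H1 L) : (mulH a b).1.1 = M a b.1.1 := rfl

@[simp] theorem mulH_snd (a b : H1 L) : (mulH a b).1.2 = M a b.1.2 + M b a.1.2 := rfl

theorem M_mulH (a b : H1 L) (c : L2 L) : M (mulH a b) c = M a (M b c) := by
  refine Lp.ext ?_
  filter_upwards [coeFn_M (mulH a b) c, coeFn_M a (M b c), coeFn_M a b.1.1, coeFn_M b c]
    with x h1 h2 h3 h4
  rw [h1, h2, h4, mulH_fst, h3]
  ring

theorem continuous_mulH {α : Type*} [TopologicalSpace α] {a b : α → H1 L} (ha : Continuous a)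
    (hb : Continuous b) : Continuous fun t => mulH (a t) (b t) := by
  have h1 : Continuous fun t => (a t).1.1 := by fun_prop
  have h2 : Continuous fun t => (a t).1.2 := by fun_prop
  have h3 : Continuous fun t => (b t).1.1 := by fun_prop
  have h4 : Continuous fun t => (b t).1.2 := by fun_prop
  refine Continuous.subtype_mk ?_ _
  fun_prop

theorem inner_deriv' (p q : H1 L) : ⟪p.1.1, q.1.2⟫ = -⟪p.1.2, q.1.1⟫ := inner_deriv p.2 q.2

/-! ### Translations -/

/-- Translation by `h` modulo the period. -/
def shift (L : ℝ) [Fact (0 < L)] (h x : ℝ) : ℝ :=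
  (AddCircle.equivIoc L 0 ((x : AddCircle L) + (h : AddCircle L)) : ℝ)

theorem measurePreserving_shift (h : ℝ) :
    MeasurePreserving (shift L h) (volume.restrict (Ioc (0 : ℝ) L))
      (volume.restrict (Ioc (0 : ℝ) L)) := by
  have h1 := AddCircle.measurePreserving_mk L 0
  have h2 := measurePreserving_add_right (volume : Measure (AddCircle L)) (h : AddCircle L)
  have h3 := AddCircle.measurePreserving_equivIoc L (a := (0 : ℝ))
  have h4 := measurePreserving_subtype_coe (μa := (volume : Measure ℝ))
    (measurableSet_Ioc (a := (0 : ℝ)) (b := 0 + L))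
  have := h4.comp (h3.comp (h2.comp h1))
  simp only [zero_add] at this
  exact this

theorem coe_shift (h x : ℝ) :
    ((shift L h x : ℝ) : AddCircle L) = (x : AddCircle L) + (h : AddCircle L) :=
  AddCircle.coe_equivIoc

theorem _root_.Function.Periodic.comp_shift {φ : ℝ → ℝ} (hφ : Function.Periodic φ L) (h x : ℝ) :
    φ (shift L h x) = φ (x + h) := by
  rw [← hφ.lift_coe, ← hφ.lift_coe, coe_shift, AddCircle.coe_add]

/-- Translation of periodic functions. -/
def trans (h : ℝ) : L2 L →ₗᵢ[ℝ] L2 L :=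
  Lp.compMeasurePreservingₗᵢ ℝ (shift L h) (measurePreserving_shift h)

theorem coeFn_trans (h : ℝ) (u : L2 L) :
    trans h u =ᵐ[volume.restrict (Ioc (0 : ℝ) L)] fun x => u (shift L h x) :=
  Lp.coeFn_compMeasurePreserving u (measurePreserving_shift h)

theorem ae_shift {p : ℝ → Prop} (hp : ∀ᵐ x ∂(volume.restrict (Ioc (0 : ℝ) L)), p x) (h : ℝ) :
    ∀ᵐ x ∂(volume.restrict (Ioc (0 : ℝ) L)), p (shift L h x) :=
  (measurePreserving_shift h).quasiMeasurePreserving.ae hp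

theorem _root_.Function.Periodic.sub_right {φ : ℝ → ℝ} (hφ : Function.Periodic φ L) (h : ℝ) :
    Function.Periodic (fun x => φ (x - h)) L := fun x => by
  simp only [add_sub_right_comm, hφ (x - h)]

theorem inner_trans {φ : ℝ → ℝ} (hc : Continuous φ) (hφ : Function.Periodic φ L) (h : ℝ)
    (u : L2 L) :
    ⟪trans h u, ofCont L φ hc⟫ = ⟪u, ofCont L (fun x => φ (x - h)) (by fun_prop)⟫ := by
  rw [← (trans h).inner_map_map u]
  congr 1
  refine Lp.ext ?_
  filter_upwards [coeFn_ofCont L hc,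
    coeFn_trans h (ofCont L (fun x => φ (x - h)) (by fun_prop)),
    ae_shift (coeFn_ofCont L (g := fun x => φ (x - h)) (by fun_prop)) h] with x h1 h2 h3
  rw [h1, h2, h3, (hφ.sub_right h).comp_shift, add_sub_cancel_right]

theorem trans_mem_H1 (h : ℝ) {p : L2 L × L2 L} (hp : p ∈ H1 L) :
    (trans h p.1, trans h p.2) ∈ H1 L := by
  rw [KdV.mem_H1, isWeakDeriv_iff]
  intro φ hφ
  have ht : IsTest L (fun x => φ (x - h)) :=
    ⟨hφ.1.comp (contDiff_id.sub contDiff_const), hφ.2.sub_right h⟩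
  have := isWeakDeriv_iff.1 (KdV.mem_H1.1 hp) _ ht
  rw [inner_trans _ hφ.deriv.2, inner_trans _ hφ.2, ← this]
  congr 2
  funext x
  exact (deriv_comp_sub_const (f := φ) h x).symm

theorem integral_trans (h : ℝ) (u : L2 L) :
    ∫ x in Ioc (0 : ℝ) L, trans h u x = ∫ x in Ioc (0 : ℝ) L, u x := by
  rw [← inner_one, ← inner_one, inner_trans continuous_const (fun _ => rfl)]

/-- Translation of elements of `H1`. -/
def transH (h : ℝ) (a : H1 L) : H1 L := ⟨_, trans_mem_H1 h a.2⟩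

theorem M_trans (h : ℝ) (a : H1 L) (b : L2 L) : M (transH h a) (trans h b) = trans h (M a b) := by
  refine Lp.ext ?_
  filter_upwards [coeFn_M (transH h a) (trans h b), coeFn_trans h a.1.1, coeFn_trans h b,
    coeFn_trans h (M a b), ae_shift (coeFn_M a b) h] with x h1 h2 h3 h4 h5
  rw [h1, h4, h5, h3]
  exact congrArg (· * _) h2

/-- Translation rotates the pair of coefficients at k and −k by the angle `freq L k * h`.
Convergence of translates and of difference quotients thereby reduces to single coefficients. -/
theorem inner_cas_trans (h : ℝ) (u : L2 L) (k : ℤ) :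
    ⟪cas L k, trans h u⟫ = Real.cos (freq L k * h) * ⟪cas L k, u⟫ -
      Real.sin (freq L k * h) * ⟪cas L (-k), u⟫ := by
  rw [real_inner_comm, cas, inner_trans _ (isTest_casFun k).2]
  have : ofCont L (fun x => casFun L k (x - h))
      ((continuous_casFun L k).comp (continuous_id.sub continuous_const)) =
      Real.cos (freq L k * h) • cas L k - Real.sin (freq L k * h) • cas L (-k) := by
    refine Lp.ext ?_
    filter_upwards [coeFn_ofCont L (g := fun x => casFun L k (x - h))
      ((continuous_casFun L k).comp (continuous_id.sub continuous_const)),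
      Lp.coeFn_sub (Real.cos (freq L k * h) • cas L k) (Real.sin (freq L k * h) • cas L (-k)),
      Lp.coeFn_smul (Real.cos (freq L k * h)) (cas L k),
      Lp.coeFn_smul (Real.sin (freq L k * h)) (cas L (-k)),
      coeFn_ofCont L (continuous_casFun L k),
      coeFn_ofCont L (continuous_casFun L (-k))] with x h1 h2 h3 h4 h5 h6
    rw [h1, h2, Pi.sub_apply, h3, h4, Pi.smul_apply, Pi.smul_apply, cas, cas, h5, h6]
    simp only [casFun, freq_neg, neg_mul, Real.cos_neg, Real.sin_neg, mul_sub, Real.cos_sub,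
      Real.sin_sub, smul_eq_mul]
    ring
  rw [this, inner_sub_right, real_inner_smul_right, real_inner_smul_right, real_inner_comm,
    real_inner_comm u (cas L (-k))]
  rfl

/-- Dominated convergence in Parseval's series. -/
theorem tendsto_zero_of_inner_cas {ι : Type*} {l : Filter ι} {v : ι → L2 L} {b : ℤ → ℝ}
    (hb : Summable b) (hv : ∀ i k, ⟪cas L k, v i⟫ ^ 2 ≤ b k)
    (ht : ∀ k, Tendsto (fun i => ⟪cas L k, v i⟫) l (𝓝 0)) : Tendsto v l (𝓝 0) := by
  rw [tendsto_zero_iff_norm_tendsto_zero]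
  have : Tendsto (fun i => ∑' k, ⟪cas L k, v i⟫ ^ 2) l (𝓝 (∑' _ : ℤ, (0 : ℝ))) := by
    refine tendsto_tsum_of_dominated_convergence hb (fun k => ?_)
      (Eventually.of_forall fun i k => ?_)
    · simpa using (ht k).pow 2
    · rw [Real.norm_of_nonneg (sq_nonneg _)]
      exact hv i k
  simp only [(hasSum_norm_sq _).tsum_eq, tsum_zero] at this
  have h2 := this.sqrt
  simpa [Real.sqrt_sq (norm_nonneg _)] using h2

theorem tendsto_trans (u : L2 L) : Tendsto (fun h => trans h u) (𝓝 0) (𝓝 u) := by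
  rw [← tendsto_sub_nhds_zero_iff]
  have hs : Summable fun k => ⟪cas L k, u⟫ ^ 2 := (hasSum_norm_sq u).summable
  have hs' : Summable fun k => ⟪cas L (-k), u⟫ ^ 2 := (Equiv.neg ℤ).summable_iff.2 hs
  have e : ∀ h k, ⟪cas L k, trans h u - u⟫ = (Real.cos (freq L k * h) - 1) * ⟪cas L k, u⟫ -
      Real.sin (freq L k * h) * ⟪cas L (-k), u⟫ := by
    intro h k
    rw [inner_sub_right, inner_cas_trans]
    ring
  -- The weights come from (p − q)² ≤ 2p² + 2q² with (cos − 1)² ≤ 4 and sin² ≤ 1.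
  refine tendsto_zero_of_inner_cas ((hs.mul_left 8).add (hs'.mul_left 2)) (fun h k => ?_)
    (fun k => ?_)
  · rw [e]
    set c := Real.cos (freq L k * h)
    set s := Real.sin (freq L k * h)
    set x := ⟪cas L k, u⟫
    set y := ⟪cas L (-k), u⟫
    have h1 : (c - 1) ^ 2 ≤ 4 := by
      nlinarith [Real.cos_le_one (freq L k * h), Real.neg_one_le_cos (freq L k * h)]
    have h2 : s ^ 2 ≤ 1 := Real.sin_sq_le_one _
    nlinarith [sq_nonneg ((c - 1) * x + s * y), mul_le_mul_of_nonneg_right h1 (sq_nonneg x),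
      mul_le_mul_of_nonneg_right h2 (sq_nonneg y)]
  · simp only [e]
    have : Continuous fun h => (Real.cos (freq L k * h) - 1) * ⟪cas L k, u⟫ -
      Real.sin (freq L k * h) * ⟪cas L (-k), u⟫ := by fun_prop
    simpa using this.tendsto 0

/-- Difference quotients. -/
def diffQuot (h : ℝ) : L2 L →L[ℝ] L2 L :=
  h⁻¹ • ((trans h).toContinuousLinearMap - ContinuousLinearMap.id ℝ (L2 L))

theorem diffQuot_apply (h : ℝ) (u : L2 L) : diffQuot h u = h⁻¹ • (trans h u - u) := rfl

theorem inner_cas_diffQuot (h : ℝ) {p : L2 L × L2 L} (k : ℤ) :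
    ⟪cas L k, diffQuot h p.1⟫ = (Real.cos (freq L k * h) - 1) / h * ⟪cas L k, p.1⟫ -
      Real.sin (freq L k * h) / h * ⟪cas L (-k), p.1⟫ := by
  rw [diffQuot_apply, real_inner_smul_right, inner_sub_right, inner_cas_trans]
  ring

/-- Sine and cosine are Lipschitz with constant 1, so the bound is uniform in h; at h = 0 the
quotient is zero by convention. It provides the dominating series for the limit h → 0. -/
theorem abs_inner_cas_diffQuot_le (h : ℝ) {p : L2 L × L2 L} (hp : p ∈ H1 L) (k : ℤ) :
    |⟪cas L k, diffQuot h p.1⟫| ≤ |⟪cas L (-k), p.2⟫| + |⟪cas L k, p.2⟫| := by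
  have h1 : |(Real.cos (freq L k * h) - 1) / h| ≤ |freq L k| := by
    rcases eq_or_ne h 0 with rfl | hh
    · simp
    rw [abs_div, div_le_iff₀ (abs_pos.2 hh), ← abs_mul]
    simpa using Real.abs_cos_sub_cos_le (freq L k * h) 0
  have h2 : |Real.sin (freq L k * h) / h| ≤ |freq L k| := by
    rcases eq_or_ne h 0 with rfl | hh
    · simp
    rw [abs_div, div_le_iff₀ (abs_pos.2 hh), ← abs_mul]
    exact Real.abs_sin_le_abs
  rw [inner_cas_diffQuot, inner_cas_deriv hp, inner_cas_deriv hp, freq_neg, neg_neg, neg_mul,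
    neg_neg, abs_neg, abs_mul, abs_mul]
  refine (abs_sub _ _).trans ?_
  rw [abs_mul, abs_mul]
  gcongr

theorem norm_diffQuot_le (h : ℝ) {p : L2 L × L2 L} (hp : p ∈ H1 L) :
    ‖diffQuot h p.1‖ ≤ 2 * ‖p.2‖ := by
  have hs := hasSum_norm_sq p.2
  have hs' := (Equiv.neg ℤ).hasSum_iff.2 hs
  have := hasSum_le (fun k => ?_) (hasSum_norm_sq (diffQuot h p.1))
    ((hs'.mul_left 2).add (hs.mul_left 2))
  · refine (pow_le_pow_iff_left₀ (norm_nonneg _) (by positivity) two_ne_zero).1 ?_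
    linarith
  · have h1 := abs_inner_cas_diffQuot_le h hp k
    have h2 := pow_le_pow_left₀ (abs_nonneg _) h1 2
    rw [sq_abs] at h2
    simp only [Function.comp_apply, Equiv.neg_apply]
    rw [← sq_abs ⟪cas L (-k), p.2⟫, ← sq_abs ⟪cas L k, p.2⟫]
    nlinarith [sq_nonneg (|⟪cas L (-k), p.2⟫| - |⟪cas L k, p.2⟫|)]

/-- Difference quotients converge to the weak derivative. -/
theorem tendsto_diffQuot {p : L2 L × L2 L} (hp : p ∈ H1 L) :
    Tendsto (fun h => diffQuot h p.1) (𝓝[≠] 0) (𝓝 p.2) := by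
  rw [← tendsto_sub_nhds_zero_iff]
  have hs : Summable fun k => ⟪cas L k, p.2⟫ ^ 2 := (hasSum_norm_sq p.2).summable
  have hs' : Summable fun k => ⟪cas L (-k), p.2⟫ ^ 2 := (Equiv.neg ℤ).summable_iff.2 hs
  refine tendsto_zero_of_inner_cas ((hs.mul_left 8).add (hs'.mul_left 2)) (fun h k => ?_)
    (fun k => ?_)
  · have h1 := abs_inner_cas_diffQuot_le h hp k
    rw [inner_sub_right]
    have h2 : |⟪cas L k, diffQuot h p.1⟫ - ⟪cas L k, p.2⟫| ≤
        |⟪cas L (-k), p.2⟫| + 2 * |⟪cas L k, p.2⟫| := by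
      refine (abs_sub _ _).trans ?_
      linarith
    have h3 := pow_le_pow_left₀ (abs_nonneg _) h2 2
    rw [sq_abs] at h3
    rw [← sq_abs ⟪cas L (-k), p.2⟫, ← sq_abs ⟪cas L k, p.2⟫]
    nlinarith [sq_nonneg (|⟪cas L (-k), p.2⟫| - 2 * |⟪cas L k, p.2⟫|)]
  -- For fixed k the coefficient of the difference quotient is the slope at 0 of this function of h.
  · have hc : HasDerivAt (fun h => Real.cos (freq L k * h) * ⟪cas L k, p.1⟫ -
        Real.sin (freq L k * h) * ⟪cas L (-k), p.1⟫) (⟪cas L k, p.2⟫) 0 := by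
      have h0 : HasDerivAt (fun h => freq L k * h) (freq L k * 1) 0 :=
        (hasDerivAt_id (0 : ℝ)).const_mul _
      refine ((h0.cos.mul_const _).sub (h0.sin.mul_const _)).congr_deriv ?_
      rw [inner_cas_deriv hp]
      simp
    have := hc.tendsto_slope
    rw [← tendsto_sub_nhds_zero_iff] at this
    refine this.congr' ?_
    filter_upwards with h
    rw [inner_sub_right, slope_def_field, inner_cas_diffQuot]
    simp
    ring

/-! ### The space of triples `(u, u_x, u_xx)` -/

/-- The vector space underlying `H2per`. -/
def H2 (L : ℝ) [Fact (0 < L)] : Submodule ℝ (L2 L × L2 L × L2 L) where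
  carrier := {p | (∫ x in Ioc (0 : ℝ) L, p.1 x) = 0 ∧ (p.1, p.2.1) ∈ H1 L ∧ (p.2.1, p.2.2) ∈ H1 L}
  add_mem' := by
    rintro a b ⟨ha, ha', ha''⟩ ⟨hb, hb', hb''⟩
    refine ⟨?_, (H1 L).add_mem ha' hb', (H1 L).add_mem ha'' hb''⟩
    rw [← inner_one_right] at *
    rw [Prod.fst_add, inner_add_left, ha, hb, add_zero]
  zero_mem' := by
    refine ⟨?_, (H1 L).zero_mem, (H1 L).zero_mem⟩
    rw [← inner_one_right, Prod.fst_zero, inner_zero_left]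
  smul_mem' := by
    rintro c a ⟨ha, ha', ha''⟩
    refine ⟨?_, (H1 L).smul_mem c ha', (H1 L).smul_mem c ha''⟩
    rw [← inner_one_right] at *
    rw [Prod.smul_fst, real_inner_smul_left, ha, mul_zero]

/-- A point of `H2per` as a vector. -/
def H2per.toH2 (u : H2per L) : H2 L := ⟨u.1, u.2⟩

theorem H2per.continuous_toH2 : Continuous (H2per.toH2 : H2per L → H2 L) :=
  continuous_subtype_val.subtype_mk _

/-- `(u, u_x)`. -/
def j0 : H2 L →L[ℝ] H1 L where
  toFun a := ⟨(a.1.1, a.1.2.1), a.2.2.1⟩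
  map_add' _ _ := rfl
  map_smul' _ _ := rfl
  cont := by fun_prop

/-- `(u_x, u_xx)`. -/
def j1 : H2 L →L[ℝ] H1 L where
  toFun a := ⟨(a.1.2.1, a.1.2.2), a.2.2.2⟩
  map_add' _ _ := rfl
  map_smul' _ _ := rfl
  cont := by fun_prop

@[simp] theorem j0_fst (a : H2 L) : (j0 a).1.1 = a.1.1 := rfl
@[simp] theorem j0_snd (a : H2 L) : (j0 a).1.2 = a.1.2.1 := rfl
@[simp] theorem j1_fst (a : H2 L) : (j1 a).1.1 = a.1.2.1 := rfl
@[simp] theorem j1_snd (a : H2 L) : (j1 a).1.2 = a.1.2.2 := rfl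

/-! ### Evolution in `H⁻¹` -/

/-- `w_t = -A_x + B` for nonnegative times, integrated in time and tested with functions in `H1`. -/
def Evolves (w A B : ℝ → L2 L) : Prop :=
  ∀ φ : H1 L, ∀ s t : ℝ, 0 ≤ s → 0 ≤ t →
    ⟪w t - w s, φ.1.1⟫ = ⟪∫ τ in s..t, A τ, φ.1.2⟫ + ⟪∫ τ in s..t, B τ, φ.1.1⟫

theorem trans_trans_neg (h : ℝ) (u : L2 L) : trans h (trans (-h) u) = u := by
  refine ext_inner_cas fun k => ?_
  simp only [inner_cas_trans, freq_neg, neg_neg, mul_neg, neg_mul, Real.cos_neg, Real.sin_neg]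
  linear_combination ⟪cas L k, u⟫ * Real.sin_sq_add_cos_sq (freq L k * h)

theorem inner_trans_left (h : ℝ) (u v : L2 L) : ⟪trans h u, v⟫ = ⟪u, trans (-h) v⟫ := by
  rw [← (trans h).inner_map_map u, trans_trans_neg]

theorem Evolves.trans {w A B : ℝ → L2 L} (hw : Evolves w A B) (hA : Continuous A)
    (hB : Continuous B) (h : ℝ) :
    Evolves (fun t => trans h (w t)) (fun t => KdV.trans h (A t)) (fun t => KdV.trans h (B t)) := by
  intro φ s t hs ht
  have := hw (transH (-h) φ) s t hs ht
  have c : ∀ {F : ℝ → L2 L}, Continuous F → ∫ τ in s..t, KdV.trans h (F τ) =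
      KdV.trans h (∫ τ in s..t, F τ) := fun hF =>
    (KdV.trans h).toContinuousLinearMap.intervalIntegral_comp_comm (hF.intervalIntegrable _ _)
  rw [c hA, c hB, inner_trans_left, inner_trans_left, ← map_sub, inner_trans_left]
  exact this

theorem Evolves.sub {w A B w' A' B' : ℝ → L2 L} (hw : Evolves w A B) (hw' : Evolves w' A' B')
    (hA : Continuous A) (hB : Continuous B) (hA' : Continuous A') (hB' : Continuous B') :
    Evolves (fun t => w t - w' t) (fun t => A t - A' t) (fun t => B t - B' t) := by
  intro φ s t hs ht
  have h1 := hw φ s t hs ht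
  have h2 := hw' φ s t hs ht
  rw [intervalIntegral.integral_sub (hA.intervalIntegrable _ _) (hA'.intervalIntegrable _ _),
    intervalIntegral.integral_sub (hB.intervalIntegrable _ _) (hB'.intervalIntegrable _ _)]
  simp only [inner_sub_left] at *
  linarith

theorem Evolves.add {w A B w' A' B' : ℝ → L2 L} (hw : Evolves w A B) (hw' : Evolves w' A' B')
    (hA : Continuous A) (hB : Continuous B) (hA' : Continuous A') (hB' : Continuous B') :
    Evolves (fun t => w t + w' t) (fun t => A t + A' t) (fun t => B t + B' t) := by
  intro φ s t hs ht
  have h1 := hw φ s t hs ht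
  have h2 := hw' φ s t hs ht
  rw [intervalIntegral.integral_add (hA.intervalIntegrable _ _) (hA'.intervalIntegrable _ _),
    intervalIntegral.integral_add (hB.intervalIntegrable _ _) (hB'.intervalIntegrable _ _)]
  simp only [inner_sub_left, inner_add_left] at *
  linarith

theorem Evolves.smul {w A B : ℝ → L2 L} (hw : Evolves w A B) (c : ℝ) :
    Evolves (fun t => c • w t) (fun t => c • A t) (fun t => c • B t) := by
  intro φ s t hs ht
  have h1 := hw φ s t hs ht
  rw [intervalIntegral.integral_smul, intervalIntegral.integral_smul, ← smul_sub,
    real_inner_smul_left, real_inner_smul_left, real_inner_smul_left, h1]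
  ring

theorem Evolves.congr {w A B w' A' B' : ℝ → L2 L} (hw : Evolves w A B) (h1 : ∀ t, w t = w' t)
    (h2 : ∀ t, A t = A' t) (h3 : ∀ t, B t = B' t) : Evolves w' A' B' := by
  obtain rfl := funext h1
  obtain rfl := funext h2
  obtain rfl := funext h3
  exact hw

/-- The derivative of a product, one of whose factors is only differentiable in `H⁻¹`. -/
theorem Evolves.tendsto_slope {w A B : ℝ → L2 L} (hw : Evolves w A B) (hA : Continuous A)
    (hB : Continuous B) {t : ℝ} (ht : 0 < t) {φ : ℝ → H1 L} (hφ : ContinuousAt φ t) :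
    Tendsto (fun s => (s - t)⁻¹ * ⟪w s - w t, (φ s).1.1⟫) (𝓝[≠] t)
      (𝓝 (⟪A t, (φ t).1.2⟫ + ⟪B t, (φ t).1.1⟫)) := by
  -- The increments of w are tested integrals of A and B. Their averages converge strongly in L²,
  -- and so do φ and its derivative, so the pairing converges although w need not be differentiable
  -- in L².
  have key : ∀ {F : ℝ → L2 L}, Continuous F →
      Tendsto (fun s => (s - t)⁻¹ • ∫ τ in t..s, F τ) (𝓝[≠] t) (𝓝 (F t)) := by
    intro F hF
    have := (intervalIntegral.integral_hasDerivAt_right (hF.intervalIntegrable t t)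
      (hF.stronglyMeasurableAtFilter _ _) hF.continuousAt).tendsto_slope
    refine this.congr fun s => ?_
    simp [slope_def_module]
  have h1 : Tendsto (fun s => (φ s).1.1) (𝓝[≠] t) (𝓝 (φ t).1.1) :=
    ((continuous_fst.comp continuous_subtype_val).continuousAt.tendsto.comp hφ.tendsto).mono_left
      nhdsWithin_le_nhds
  have h2 : Tendsto (fun s => (φ s).1.2) (𝓝[≠] t) (𝓝 (φ t).1.2) :=
    ((continuous_snd.comp continuous_subtype_val).continuousAt.tendsto.comp hφ.tendsto).mono_left
      nhdsWithin_le_nhds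
  refine (((key hA).inner h2).add ((key hB).inner h1)).congr' ?_
  filter_upwards [nhdsWithin_le_nhds (Ioi_mem_nhds ht)] with s hs
  rw [hw (φ s) t s ht.le (le_of_lt hs), real_inner_smul_left, real_inner_smul_left]
  ring

theorem hasDerivAt_of_tendsto {y : ℝ → ℝ} {t d : ℝ} {q : ℝ → ℝ}
    (hq : ∀ s, y s - y t = q s) (h : Tendsto (fun s => (s - t)⁻¹ * q s) (𝓝[≠] t) (𝓝 d)) :
    HasDerivAt y d t := by
  rw [hasDerivAt_iff_tendsto_slope]
  refine h.congr fun s => ?_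
  rw [slope_def_field, ← hq]
  ring

/-- Telescoping pairs the increment of a with b at the moving time and the increment of b with a at
the fixed time; hence only b has to be continuous in `H1`. -/
theorem Evolves.hasDerivAt_inner {a b : ℝ → H1 L} {A B A' B' : ℝ → L2 L}
    (ha : Evolves (fun t => (a t).1.1) A B) (hb : Evolves (fun t => (b t).1.1) A' B')
    (hA : Continuous A) (hB : Continuous B) (hA' : Continuous A') (hB' : Continuous B')
    (hbc : Continuous b) {t : ℝ} (ht : 0 < t) :
    HasDerivAt (fun s => ⟪(a s).1.1, (b s).1.1⟫)
      (⟪A t, (b t).1.2⟫ + ⟪B t, (b t).1.1⟫ + (⟪A' t, (a t).1.2⟫ + ⟪B' t, (a t).1.1⟫)) t := by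
  refine hasDerivAt_of_tendsto (q := fun s => ⟪(a s).1.1 - (a t).1.1, (b s).1.1⟫ +
    ⟪(b s).1.1 - (b t).1.1, (a t).1.1⟫) (fun s => ?_) ?_
  · simp only [inner_sub_left, inner_sub_right, real_inner_comm (a t).1.1]
    ring
  · simp only [mul_add]
    exact (ha.tendsto_slope hA hB ht hbc.continuousAt).add
      (hb.tendsto_slope hA' hB' ht (φ := fun _ => a t) continuousAt_const)

theorem inner_M_comm (a b c : H1 L) : ⟪M a b.1.1, c.1.1⟫ = ⟪a.1.1, (mulH b c).1.1⟫ := by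
  rw [M_comm, inner_M_left, mulH_fst]

/-- Telescoping in three factors: each increment is paired with the product of the other two, which
is an admissible test function by Leibniz' rule. -/
theorem Evolves.hasDerivAt_inner_M {a b c : ℝ → H1 L} {A B A' B' A'' B'' : ℝ → L2 L}
    (ha : Evolves (fun t => (a t).1.1) A B) (hb : Evolves (fun t => (b t).1.1) A' B')
    (hc : Evolves (fun t => (c t).1.1) A'' B'')
    (hA : Continuous A) (hB : Continuous B) (hA' : Continuous A') (hB' : Continuous B')
    (hA'' : Continuous A'') (hB'' : Continuous B'')
    (hbc : Continuous b) (hcc : Continuous c) {t : ℝ} (ht : 0 < t) :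
    HasDerivAt (fun s => ⟪M (a s) (b s).1.1, (c s).1.1⟫)
      (⟪A t, (mulH (b t) (c t)).1.2⟫ + ⟪B t, (mulH (b t) (c t)).1.1⟫ +
        (⟪A' t, (mulH (a t) (c t)).1.2⟫ + ⟪B' t, (mulH (a t) (c t)).1.1⟫) +
        (⟪A'' t, (mulH (a t) (b t)).1.2⟫ + ⟪B'' t, (mulH (a t) (b t)).1.1⟫)) t := by
  refine hasDerivAt_of_tendsto (q := fun s =>
    ⟪(a s).1.1 - (a t).1.1, (mulH (b s) (c s)).1.1⟫ +
    ⟪(b s).1.1 - (b t).1.1, (mulH (a t) (c s)).1.1⟫ +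
    ⟪(c s).1.1 - (c t).1.1, (mulH (a t) (b t)).1.1⟫) (fun s => ?_) ?_
  · simp only [inner_sub_left, ← inner_M_comm]
    have e1 : ⟪M (b s) (a t).1.1, (c s).1.1⟫ = ⟪M (a t) (b s).1.1, (c s).1.1⟫ := by rw [M_comm]
    have e2 : ⟪M (b t) (a t).1.1, (c s).1.1⟫ = ⟪M (a t) (b t).1.1, (c s).1.1⟫ := by rw [M_comm]
    have e3 : ∀ r, ⟪M (c r) (a t).1.1, (b t).1.1⟫ = ⟪M (a t) (b t).1.1, (c r).1.1⟫ := by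
      intro r
      rw [inner_M_left, M_comm (c r) (b t), ← inner_M_left, M_comm (b t)]
    rw [e1, e2, e3, e3]
    ring
  · simp only [mul_add]
    exact ((ha.tendsto_slope hA hB ht (continuous_mulH hbc hcc).continuousAt).add
      (hb.tendsto_slope hA' hB' ht (continuous_mulH continuous_const hcc).continuousAt)).add
      (hc.tendsto_slope hA'' hB'' ht (φ := fun _ => mulH (a t) (b t)) continuousAt_const)

/-- The increment is factored as x⁴ − y⁴ = (x − y)(x + y)(x² + y²); in the limit the last two
factors become 2a · 2a² = 4a³. -/
theorem Evolves.hasDerivAt_norm_sq_sq {a : ℝ → H1 L} {A B : ℝ → L2 L}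
    (ha : Evolves (fun t => (a t).1.1) A B) (hA : Continuous A) (hB : Continuous B)
    (hac : Continuous a) {t : ℝ} (ht : 0 < t) :
    HasDerivAt (fun s => ‖M (a s) (a s).1.1‖ ^ 2)
      (4 * (⟪A t, (mulH (a t) (mulH (a t) (a t))).1.2⟫ +
        ⟪B t, (mulH (a t) (mulH (a t) (a t))).1.1⟫)) t := by
  refine hasDerivAt_of_tendsto (q := fun s => ⟪(a s).1.1 - (a t).1.1,
    (mulH (a s + a t) (mulH (a s) (a s) + mulH (a t) (a t))).1.1⟫) (fun s => ?_) ?_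
  · have hfst : ∀ x y : H1 L, (x + y).1.1 = x.1.1 + y.1.1 := fun _ _ => rfl
    have h1 : (a s).1.1 - (a t).1.1 = (a s - a t).1.1 := rfl
    rw [h1, ← inner_M_comm, ← real_inner_self_eq_norm_sq, ← real_inner_self_eq_norm_sq]
    simp only [hfst, mulH_fst, map_add, map_sub, sub_apply, inner_sub_left, inner_sub_right, inner_add_left,
      inner_add_right, M_comm (a t) (a s), real_inner_comm (M (a t) (a t).1.1)]
    ring
  · have hφ : ContinuousAt (fun s => mulH (a s + a t) (mulH (a s) (a s) + mulH (a t) (a t))) t :=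
      (continuous_mulH (hac.add continuous_const)
        ((continuous_mulH hac hac).add continuous_const)).continuousAt
    convert ha.tendsto_slope hA hB ht hφ using 2
    have h2 : mulH (a t + a t) (mulH (a t) (a t) + mulH (a t) (a t)) =
        (4 : ℝ) • mulH (a t) (mulH (a t) (a t)) := by
      refine Subtype.ext (Prod.ext ?_ ?_)
      · change M (a t + a t) (M (a t) (a t).1.1 + M (a t) (a t).1.1) =
          (4 : ℝ) • M (a t) (M (a t) (a t).1.1)
        simp only [map_add, add_apply]
        module
      · change M (a t + a t) ((mulH (a t) (a t)).1.2 + (mulH (a t) (a t)).1.2) +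
            M (mulH (a t) (a t) + mulH (a t) (a t)) ((a t).1.2 + (a t).1.2) =
          (4 : ℝ) • (M (a t) (mulH (a t) (a t)).1.2 + M (mulH (a t) (a t)) (a t).1.2)
        simp only [map_add, add_apply]
        module
    rw [h2]
    change _ = ⟪A t, (4 : ℝ) • (mulH (a t) (mulH (a t) (a t))).1.2⟫ +
      ⟪B t, (4 : ℝ) • (mulH (a t) (mulH (a t) (a t))).1.1⟫
    rw [real_inner_smul_right, real_inner_smul_right]
    ring

/-! ### The identity for the derivative -/

/-- The derivative of a partial sum. -/
def partialSumDeriv (L : ℝ) [Fact (0 < L)] (N : ℕ) : L2 L →L[ℝ] L2 L :=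
  ∑ k ∈ Finset.Icc (-N : ℤ) N, (innerSL ℝ (cas L k)).smulRight (freq L k • cas L (-k))

theorem partialSumDeriv_apply (N : ℕ) (u : L2 L) : partialSumDeriv L N u =
    ∑ k ∈ Finset.Icc (-N : ℤ) N, ⟪cas L k, u⟫ • freq L k • cas L (-k) := by
  simp [partialSumDeriv]

theorem partialSum_mem_H1' (N : ℕ) (u : L2 L) :
    (partialSum L N u, partialSumDeriv L N u) ∈ H1 L := by
  have : (partialSum L N u, partialSumDeriv L N u) =
      ∑ k ∈ Finset.Icc (-N : ℤ) N, ⟪cas L k, u⟫ • (cas L k, freq L k • cas L (-k)) := by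
    rw [partialSum_apply, partialSumDeriv_apply]
    ext1
    · simp [Prod.fst_sum]
    · simp [Prod.snd_sum]
  rw [this]
  exact Submodule.sum_mem _ fun k _ => Submodule.smul_mem _ _ (cas_mem_H1 k)

/-- The truncated derivative is antisymmetric. This removes the third-order term from the truncated
energy identity. -/
theorem inner_partialSumDeriv_self (N : ℕ) (u : L2 L) : ⟪u, partialSumDeriv L N u⟫ = 0 := by
  have h : ⟪u, partialSumDeriv L N u⟫ = -⟪u, partialSumDeriv L N u⟫ := by
    rw [partialSumDeriv_apply, inner_sum, ← Finset.sum_neg_distrib]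
    refine Finset.sum_nbij' (fun k => -k) (fun k => -k) ?_ ?_ ?_ ?_ ?_
    · intro k hk; simp only [Finset.mem_Icc] at *; omega
    · intro k hk; simp only [Finset.mem_Icc] at *; omega
    · intro k _; simp
    · intro k _; simp
    · intro k _
      simp only [real_inner_smul_right, freq_neg, neg_neg, real_inner_comm u]
      ring
  linarith

/-- A partial sum as an element of `H1`. -/
def partialSumH (N : ℕ) (u : L2 L) : H1 L := ⟨_, partialSum_mem_H1' N u⟩

theorem continuous_partialSumH (N : ℕ) : Continuous (partialSumH (L := L) N) := by
  refine Continuous.subtype_mk ?_ _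
  fun_prop

theorem norm_sq_partialSum_deriv (N : ℕ) (a b : H2 L) :
    ⟪partialSum L N a.1.2.1, partialSum L N b.1.2.1⟫ = -⟪a.1.1, partialSum L N b.1.2.2⟫ := by
  have h := inner_deriv (j0 a).2 (partialSum_mem_H1 (j1 b).2 N)
  simp only [j0_fst, j0_snd, j1_fst, j1_snd] at h
  rw [h, neg_neg, inner_partialSum, partialSum_partialSum]

/-- If `w_t = -(w_xx + A)_x + B` then `|w_x|²` is absolutely continuous with the derivative
`2 (w_xx, A_x - B)`. -/
theorem Evolves.norm_sq_deriv {w : ℝ → H2 L} {A : ℝ → H1 L} {B : ℝ → L2 L}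
    (hw : Evolves (fun t => (w t).1.1) (fun t => (w t).1.2.2 + (A t).1.1) B)
    (hwc : Continuous w) (hA : Continuous A) (hB : Continuous B) {s t : ℝ} (hs : 0 ≤ s)
    (ht : 0 ≤ t) :
    ∫ τ in s..t, 2 * ⟪(w τ).1.2.2, (A τ).1.2 - B τ⟫ =
      ‖(w t).1.2.1‖ ^ 2 - ‖(w s).1.2.1‖ ^ 2 := by
  have c1 : Continuous fun t => (w t).1.2.1 := by fun_prop
  have c2 : Continuous fun t => (w t).1.2.2 := by fun_prop
  have c3 : Continuous fun t => (A t).1.1 := by fun_prop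
  have c4 : Continuous fun t => (A t).1.2 := by fun_prop
  have fin : ∀ N : ℕ, ∫ τ in s..t, 2 * ⟪partialSum L N (w τ).1.2.2, (A τ).1.2 - B τ⟫ =
      ‖partialSum L N (w t).1.2.1‖ ^ 2 - ‖partialSum L N (w s).1.2.1‖ ^ 2 := by
    intro N
    refine intervalIntegral.integral_eq_sub_of_hasDeriv_right
      (f := fun t => ‖partialSum L N (w t).1.2.1‖ ^ 2) (Continuous.continuousOn (by fun_prop))
      (fun τ hτ => ?_) (Continuous.intervalIntegrable (by fun_prop) _ _)
    have hτ0 : 0 < τ := (le_min hs ht).trans_lt hτ.1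
    refine HasDerivAt.hasDerivWithinAt ?_
    -- The increment of |P_N w_x|² is exactly the increment of w paired with −P_N of the sum of the
    -- two second derivatives: the cross terms cancel by symmetry. The truncated function is smooth,
    -- hence an admissible test function.
    refine hasDerivAt_of_tendsto (q := fun r => ⟪(w r).1.1 - (w τ).1.1,
      (-partialSumH N ((w r).1.2.2 + (w τ).1.2.2)).1.1⟫) (fun r => ?_) ?_
    · have e : (-partialSumH N ((w r).1.2.2 + (w τ).1.2.2)).1.1 =
        -(partialSum L N (w r).1.2.2 + partialSum L N (w τ).1.2.2) := by
        rw [← map_add]; rfl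
      rw [e]
      simp only [inner_neg_right, inner_add_right, inner_sub_left]
      have h1 := norm_sq_partialSum_deriv N (w r) (w r)
      have h2 := norm_sq_partialSum_deriv N (w r) (w τ)
      have h3 := norm_sq_partialSum_deriv N (w τ) (w r)
      have h4 := norm_sq_partialSum_deriv N (w τ) (w τ)
      rw [real_inner_self_eq_norm_sq] at h1 h4
      rw [real_inner_comm] at h3
      linarith
    · have hφ : ContinuousAt (fun r => -partialSumH N ((w r).1.2.2 + (w τ).1.2.2)) τ :=
        ((continuous_partialSumH N).comp (c2.add continuous_const)).neg.continuousAt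
      convert hw.tendsto_slope (c2.add c3) hB hτ0 hφ using 2
      have e1 : (-partialSumH N ((w τ).1.2.2 + (w τ).1.2.2)).1.1 =
          -((2 : ℝ) • partialSum L N (w τ).1.2.2) := by
        rw [← map_smul, two_smul]; rfl
      have e2 : (-partialSumH N ((w τ).1.2.2 + (w τ).1.2.2)).1.2 =
          -((2 : ℝ) • partialSumDeriv L N (w τ).1.2.2) := by
        rw [← map_smul, two_smul]; rfl
      rw [e1, e2]
      simp only [inner_neg_right, real_inner_smul_right, inner_add_left, inner_sub_right,
        inner_partialSumDeriv_self]
      have h5 := inner_deriv (A τ).2 (partialSum_mem_H1' N (w τ).1.2.2)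
      simp only at h5
      rw [h5, real_inner_comm (A τ).1.2, real_inner_comm (B τ)]
      ring
  -- With the third-order term gone, the integrand is controlled by |w_xx| and |A_x − B|, and N → ∞
  -- by dominated convergence.
  have lim1 : Tendsto (fun N : ℕ => ‖partialSum L N (w t).1.2.1‖ ^ 2 -
      ‖partialSum L N (w s).1.2.1‖ ^ 2) atTop (𝓝 (‖(w t).1.2.1‖ ^ 2 - ‖(w s).1.2.1‖ ^ 2)) :=
    ((tendsto_partialSum _).norm.pow 2).sub ((tendsto_partialSum _).norm.pow 2)
  have lim2 : Tendsto
      (fun N : ℕ => ∫ τ in s..t, 2 * ⟪partialSum L N (w τ).1.2.2, (A τ).1.2 - B τ⟫) atTop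
      (𝓝 (∫ τ in s..t, 2 * ⟪(w τ).1.2.2, (A τ).1.2 - B τ⟫)) := by
    refine intervalIntegral.tendsto_integral_filter_of_dominated_convergence
      (fun τ => 2 * (‖(w τ).1.2.2‖ * ‖(A τ).1.2 - B τ‖)) ?_ ?_ ?_ ?_
    · exact Eventually.of_forall fun N => Continuous.aestronglyMeasurable (by fun_prop)
    · refine Eventually.of_forall fun N => Eventually.of_forall fun τ _ => ?_
      rw [norm_mul, Real.norm_two]
      gcongr
      refine (norm_inner_le_norm _ _).trans ?_
      gcongr
      exact norm_partialSum_le _ _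
    · exact Continuous.intervalIntegrable (by fun_prop) _ _
    · refine Eventually.of_forall fun τ _ => ?_
      exact ((tendsto_partialSum _).inner tendsto_const_nhds).const_mul 2
  simp only [fin] at lim2
  exact tendsto_nhds_unique lim2 lim1

theorem hasDerivAt_of_integral_eq {y c : ℝ → ℝ} (hc : Continuous c)
    (h : ∀ s t, 0 ≤ s → 0 ≤ t → ∫ τ in s..t, c τ = y t - y s) {t : ℝ} (ht : 0 < t) :
    HasDerivAt y (c t) t := by
  have h1 : HasDerivAt (fun s => y t + ∫ τ in t..s, c τ) (c t) t := by
    have := (intervalIntegral.integral_hasDerivAt_right (hc.intervalIntegrable t t)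
      (hc.stronglyMeasurableAtFilter _ _) hc.continuousAt).const_add (y t)
    exact this
  refine h1.congr_of_eventuallyEq ?_
  filter_upwards [Ioi_mem_nhds ht] with s hs
  rw [h t s ht.le (le_of_lt hs)]
  ring

/-! ### Solutions as curves in `H2` -/

/-- `u² / 2`. -/
def halfSq (u : H2 L) : H1 L := (1 / 2 : ℝ) • mulH (j0 u) (j0 u)

theorem halfSq_fst (u : H2 L) : (halfSq u).1.1 = (1 / 2 : ℝ) • M (j0 u) u.1.1 := rfl

theorem halfSq_snd (u : H2 L) : (halfSq u).1.2 = M (j0 u) u.1.2.1 := by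
  change (1 / 2 : ℝ) • (M (j0 u) u.1.2.1 + M (j0 u) u.1.2.1) = _
  module

theorem continuous_halfSq {α : Type*} [TopologicalSpace α] {u : α → H2 L} (hu : Continuous u) :
    Continuous fun t => halfSq (u t) :=
  (continuous_mulH (j0.continuous.comp hu) (j0.continuous.comp hu)).const_smul (1 / 2 : ℝ)

/-- Solutions for nonnegative times, as curves in `H2`. -/
structure Sol (γ : ℝ) (F : H2 L) (U : ℝ → H2 L) : Prop where
  continuous : Continuous U
  evolves : Evolves (fun t => (U t).1.1) (fun t => (U t).1.2.2 + (halfSq (U t)).1.1)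
    (fun t => F.1.1 - γ • (U t).1.1)

/-- Two of the three derivatives on the test function are moved to u, which is what H² regularity
permits; one derivative remains, so that the test functions may later be taken in `H1`. -/
theorem pairing_eq (γ : ℝ) (f u : H2per L) {φ : ℝ → ℝ} (h : IsTest L φ) :
    pairing γ f u φ =
      ⟪u.toH2.1.2.2 + (halfSq u.toH2).1.1, ofCont L _ h.deriv.continuous⟫ +
        ⟪f.toH2.1.1 - γ • u.toH2.1.1, ofCont L _ h.continuous⟫ := by
  have h1 : ⟪u.toH2.1.2.2, ofCont L _ h.deriv.continuous⟫ =
      ∫ x in Ioc (0 : ℝ) L, u.val x * iteratedDeriv 3 φ x := by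
    have e1 := isWeakDeriv_iff.1 (KdV.mem_H1.1 (j1 u.toH2).2) _ h.deriv
    have e2 := isWeakDeriv_iff.1 (KdV.mem_H1.1 (j0 u.toH2).2) _ h.deriv.deriv
    simp only [j0_fst, j0_snd, j1_fst, j1_snd] at e1 e2
    have e3 : iteratedDeriv 3 φ = deriv (deriv (deriv φ)) := by
      simp [iteratedDeriv_succ, iteratedDeriv_zero]
    rw [← neg_eq_iff_eq_neg.2 e1, ← e2, inner_ofCont, e3]
    rfl
  have h2 : ⟪(halfSq u.toH2).1.1, ofCont L _ h.deriv.continuous⟫ =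
      (1 / 2) * ∫ x in Ioc (0 : ℝ) L, u.val x ^ 2 * deriv φ x := by
    rw [halfSq_fst, real_inner_smul_left, inner_M_eq_integral]
    congr 1
    refine integral_congr_ae ?_
    filter_upwards [coeFn_ofCont L h.deriv.continuous] with x hx
    rw [hx, pow_two]
    rfl
  have h3 : ∀ v : H2per L, ⟪v.toH2.1.1, ofCont L _ h.continuous⟫ =
      ∫ x in Ioc (0 : ℝ) L, v.val x * φ x := fun v => inner_ofCont _ _
  rw [inner_add_left, h1, h2, inner_sub_left, real_inner_smul_left, h3, h3, pairing]
  ring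

/-- Freezing the solution at its initial value for negative times makes the curve continuous on the
whole line. The weak equation is integrated in time for smooth test functions and extended to `H1`
by density. -/
theorem IsSolutionOn.sol {γ : ℝ} {f : H2per L} {u : ℝ → H2per L}
    (hu : IsSolutionOn γ f (Ici 0) u) : Sol γ f.toH2 (fun t => (u (max t 0)).toH2) := by
  have hc : Continuous fun t : ℝ => (u (max t 0)).toH2 := by
    have h1 : Continuous fun t : ℝ => u (max t 0) :=
      hu.1.comp_continuous (by fun_prop) fun t => le_max_right t 0
    exact H2per.continuous_toH2.comp h1
  have hmax : ∀ τ : ℝ, 0 ≤ τ → max τ 0 = τ := fun τ hτ => max_eq_left hτ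
  generalize hU : (fun t : ℝ => (u (max t 0)).toH2) = U at hc
  have hU' : ∀ t, (u (max t 0)).toH2 = U t := fun t => congrFun hU t
  have hs2 := continuous_halfSq hc
  have c1 : Continuous fun t : ℝ => (U t).1.2.2 + (halfSq (U t)).1.1 := by fun_prop
  have c2 : Continuous fun t : ℝ => f.toH2.1.1 - γ • (U t).1.1 := by fun_prop
  refine ⟨hc, ?_⟩
  intro φ s t hs ht
  have test : ∀ (ψ : ℝ → ℝ) (h : IsTest L ψ),
      ⟪(U t).1.1 - (U s).1.1, ofCont L _ h.continuous⟫ =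
      ⟪∫ τ in s..t, ((U τ).1.2.2 + (halfSq (U τ)).1.1), ofCont L _ h.deriv.continuous⟫ +
      ⟪∫ τ in s..t, (f.toH2.1.1 - γ • (U τ).1.1), ofCont L _ h.continuous⟫ := by
    intro ψ h
    have e0 : ∀ {F : ℝ → L2 L}, Continuous F → ∀ v : L2 L, ⟪∫ τ in s..t, F τ, v⟫ =
        ∫ τ in s..t, ⟪F τ, v⟫ := by
      intro F hF v
      have := (innerSL ℝ v).intervalIntegral_comp_comm (hF.intervalIntegrable (μ := volume) s t)
      simp only [innerSL_apply_apply] at this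
      rw [real_inner_comm, ← this]
      simp only [real_inner_comm v]
    have ftc : ∫ τ in s..t, pairing γ f (u (max τ 0)) ψ =
        (∫ x in Ioc (0 : ℝ) L, (u (max t 0)).val x * ψ x) -
          ∫ x in Ioc (0 : ℝ) L, (u (max s 0)).val x * ψ x := by
      refine intervalIntegral.integral_eq_sub_of_hasDeriv_right
        (f := fun τ => ∫ x in Ioc (0 : ℝ) L, (u (max τ 0)).val x * ψ x) ?_ (fun τ hτ => ?_) ?_
      · refine Continuous.continuousOn ?_
        have : Continuous fun τ : ℝ => ⟪(U τ).1.1, ofCont L _ h.continuous⟫ := by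
          fun_prop
        refine this.congr fun τ => ?_
        rw [← hU', inner_ofCont]
        rfl
      · have hτ0 : 0 < τ := (le_min hs ht).trans_lt hτ.1
        have := (hu.2 ψ h τ hτ0.le).mono (s := Ioi τ) fun x hx =>
          mem_Ici.2 (hτ0.le.trans (mem_Ioi.1 hx).le)
        rw [max_eq_left hτ0.le]
        refine this.congr (fun x hx => ?_) ?_
        · rw [hmax x (hτ0.le.trans (mem_Ioi.1 hx).le)]
        · rw [max_eq_left hτ0.le]
      · refine Continuous.intervalIntegrable ?_ _ _
        simp only [pairing_eq γ f _ h, hU']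
        fun_prop
    rw [e0 c1, e0 c2, ← intervalIntegral.integral_add
      (Continuous.intervalIntegrable (by fun_prop) _ _)
      (Continuous.intervalIntegrable (by fun_prop) _ _), inner_sub_left]
    simp only [pairing_eq γ f _ h, hU'] at ftc
    rw [ftc, ← hU', ← hU']
    exact congrArg₂ (· - ·) (inner_ofCont _ _) (inner_ofCont _ _)
  obtain ⟨ψ, h, hψ⟩ := exists_test_seq φ.2
  have t1 : Tendsto (fun n => ofCont L _ (h n).continuous) atTop (𝓝 φ.1.1) :=
    (continuous_fst.tendsto _).comp hψ
  have t2 : Tendsto (fun n => ofCont L _ (h n).deriv.continuous) atTop (𝓝 φ.1.2) :=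
    (continuous_snd.tendsto _).comp hψ
  refine tendsto_nhds_unique (tendsto_const_nhds.inner t1) ?_
  simp only [test _ (h _)]
  exact (tendsto_const_nhds.inner t2).add (tendsto_const_nhds.inner t1)

/-- Solutions of the linear equation `w_t = -w_xxx - (v w)_x + g - γ w`. -/
def LinSol (γ : ℝ) (v : ℝ → H2 L) (g : H2 L) (W : ℝ → H2 L) : Prop :=
  Evolves (fun t => (W t).1.1) (fun t => (W t).1.2.2 + (mulH (j0 (v t)) (j0 (W t))).1.1)
    (fun t => g.1.1 - γ • (W t).1.1)

theorem Sol.continuous_flux {γ : ℝ} {F : H2 L} {U : ℝ → H2 L} (hU : Sol γ F U) :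
    Continuous fun t => (U t).1.2.2 + (halfSq (U t)).1.1 := by
  have := hU.continuous
  have := continuous_halfSq hU.continuous
  fun_prop

theorem Sol.continuous_source {γ : ℝ} {F : H2 L} {U : ℝ → H2 L} (hU : Sol γ F U) :
    Continuous fun t => F.1.1 - γ • (U t).1.1 := by
  have := hU.continuous
  fun_prop

/-- Since u² − v² = (u + v)(u − v), the difference solves an exactly linear equation whose
coefficient is the arithmetic mean. -/
theorem Sol.linSol_sub {γ : ℝ} {F G : H2 L} {U V : ℝ → H2 L} (hU : Sol γ F U) (hV : Sol γ G V) :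
    LinSol γ (fun t => (1 / 2 : ℝ) • (U t + V t)) (F - G) (fun t => U t - V t) := by
  refine (hU.evolves.sub hV.evolves hU.continuous_flux hU.continuous_source hV.continuous_flux
    hV.continuous_source).congr (fun t => rfl) (fun t => ?_) (fun t => ?_)
  · change (U t).1.2.2 + (1 / 2 : ℝ) • M (j0 (U t)) (U t).1.1 -
      ((V t).1.2.2 + (1 / 2 : ℝ) • M (j0 (V t)) (V t).1.1) =
      (U t).1.2.2 - (V t).1.2.2 + M (j0 ((1 / 2 : ℝ) • (U t + V t))) ((U t).1.1 - (V t).1.1)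
    have := M_comm (j0 (V t)) (j0 (U t))
    simp only [j0_fst] at this
    simp only [map_smul, map_add, map_sub, add_apply, smul_apply, this]
    module
  · change F.1.1 - γ • (U t).1.1 - (G.1.1 - γ • (V t).1.1) =
      (F.1.1 - G.1.1) - γ • ((U t).1.1 - (V t).1.1)
    module

theorem LinSol.smul {γ : ℝ} {v : ℝ → H2 L} {g : H2 L} {W : ℝ → H2 L} (hW : LinSol γ v g W) (c : ℝ) :
    LinSol γ v (c • g) (fun t => c • W t) := by
  refine (Evolves.smul hW c).congr (fun t => rfl) (fun t => ?_) (fun t => ?_)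
  · change c • ((W t).1.2.2 + M (j0 (v t)) (W t).1.1) =
      c • (W t).1.2.2 + M (j0 (v t)) (c • (W t).1.1)
    rw [map_smul, smul_add]
  · change c • (g.1.1 - γ • (W t).1.1) = c • g.1.1 - γ • c • (W t).1.1
    module

/-- Translation in `H2`. -/
def transH2 (h : ℝ) (a : H2 L) : H2 L :=
  ⟨(trans h a.1.1, trans h a.1.2.1, trans h a.1.2.2),
    (integral_trans h _).trans a.2.1, trans_mem_H1 h a.2.2.1, trans_mem_H1 h a.2.2.2⟩

theorem continuous_transH2 (h : ℝ) : Continuous (transH2 (L := L) h) := by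
  refine Continuous.subtype_mk ?_ _
  have := (trans (L := L) h).continuous
  fun_prop

theorem norm_transH2 (h : ℝ) (a : H2 L) : ‖transH2 h a‖ = ‖a‖ := by
  change max ‖trans h a.1.1‖ (max ‖trans h a.1.2.1‖ ‖trans h a.1.2.2‖) =
    max ‖a.1.1‖ (max ‖a.1.2.1‖ ‖a.1.2.2‖)
  simp

theorem Sol.trans {γ : ℝ} {F : H2 L} {U : ℝ → H2 L} (hU : Sol γ F U) (h : ℝ) :
    Sol γ (transH2 h F) (fun t => transH2 h (U t)) := by
  refine ⟨(continuous_transH2 h).comp hU.continuous, ?_⟩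
  refine (hU.evolves.trans hU.continuous_flux hU.continuous_source h).congr (fun t => rfl)
    (fun t => ?_) (fun t => ?_)
  · change KdV.trans h ((U t).1.2.2 + (1 / 2 : ℝ) • M (j0 (U t)) (U t).1.1) =
      KdV.trans h (U t).1.2.2 + (1 / 2 : ℝ) • M (transH h (j0 (U t))) (KdV.trans h (U t).1.1)
    rw [M_trans, map_add, map_smul]
  · change KdV.trans h (F.1.1 - γ • (U t).1.1) = KdV.trans h F.1.1 - γ • KdV.trans h (U t).1.1
    rw [map_sub, map_smul]

/-- The difference quotient in `H2`. -/
def quotH2 (h : ℝ) (a : H2 L) : H2 L := h⁻¹ • (transH2 h a - a)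

theorem continuous_quotH2 (h : ℝ) : Continuous (quotH2 (L := L) h) :=
  ((continuous_transH2 (L := L) h).sub continuous_id).const_smul h⁻¹

/-- The translate of a solution solves the equation with the translated force. The linear equation
for the quotient replaces the differentiated equation, for which H² is not regular enough. -/
theorem Sol.linSol_quot {γ : ℝ} {F : H2 L} {U : ℝ → H2 L} (hU : Sol γ F U) (h : ℝ) :
    LinSol γ (fun t => (1 / 2 : ℝ) • (transH2 h (U t) + U t)) (quotH2 h F)
      (fun t => quotH2 h (U t)) := by
  have h1 := Sol.linSol_sub (hU.trans h) hU
  have h2 := LinSol.smul h1 h⁻¹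
  unfold quotH2
  exact h2

/-- Only the quotient and its first derivative are bounded uniformly in h; its second derivative
would require a third derivative of the solution. -/
theorem norm_j0_quotH2_le (h : ℝ) (a : H2 L) : ‖j0 (quotH2 h a)‖ ≤ 2 * ‖a‖ := by
  have e : ‖a‖ = max ‖a.1.1‖ (max ‖a.1.2.1‖ ‖a.1.2.2‖) := rfl
  have h1 : ‖diffQuot h a.1.1‖ ≤ 2 * ‖a.1.2.1‖ := norm_diffQuot_le (p := (a.1.1, a.1.2.1)) h a.2.2.1
  have h2 : ‖diffQuot h a.1.2.1‖ ≤ 2 * ‖a.1.2.2‖ := norm_diffQuot_le (p := (a.1.2.1, a.1.2.2)) h a.2.2.2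
  have h3 : ‖a.1.2.1‖ ≤ ‖a‖ := e ▸ (le_max_left _ _).trans (le_max_right _ _)
  have h4 : ‖a.1.2.2‖ ≤ ‖a‖ := e ▸ (le_max_right _ _).trans (le_max_right _ _)
  change max ‖diffQuot h a.1.1‖ ‖diffQuot h a.1.2.1‖ ≤ _
  exact max_le (by linarith) (by linarith)

theorem tendsto_j0_quotH2 (a : H2 L) :
    Tendsto (fun h => j0 (quotH2 h a)) (𝓝[≠] 0) (𝓝 (j1 a)) :=
  tendsto_subtype_rng.2 ((tendsto_diffQuot (p := (a.1.1, a.1.2.1)) a.2.2.1).prodMk_nhds (tendsto_diffQuot (p := (a.1.2.1, a.1.2.2)) a.2.2.2))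

theorem tendsto_half_transH2_add (a : H2 L) :
    Tendsto (fun h => (1 / 2 : ℝ) • (transH2 h a + a)) (𝓝[≠] 0) (𝓝 a) := by
  have h1 : Tendsto (fun h => transH2 h a) (𝓝[≠] 0) (𝓝 a) :=
    tendsto_subtype_rng.2 (((tendsto_trans a.1.1).prodMk_nhds
      ((tendsto_trans a.1.2.1).prodMk_nhds (tendsto_trans a.1.2.2))).mono_left nhdsWithin_le_nhds)
  have h2 := (h1.add (tendsto_const_nhds (x := a))).const_smul (1 / 2 : ℝ)
  have h3 : (1 / 2 : ℝ) • (a + a) = a := by module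
  rwa [h3] at h2

theorem norm_half_transH2_add_le (h : ℝ) (a : H2 L) :
    ‖(1 / 2 : ℝ) • (transH2 h a + a)‖ ≤ ‖a‖ := by
  rw [norm_smul, Real.norm_of_nonneg (by norm_num)]
  have := norm_add_le (transH2 h a) a
  rw [norm_transH2] at this
  linarith

/-- Passage to the limit in an identity for difference quotients. -/
theorem Sol.integral_of_quot {γ : ℝ} {F : H2 L} {U : ℝ → H2 L} (hU : Sol γ F U)
    {Q : H2 L × H2 L × H1 L × H1 L → ℝ} (hQ : Continuous Q)
    (hQb : ∀ R : ℝ, ∃ C, ∀ x : H2 L × H2 L × H1 L × H1 L, ‖x‖ ≤ R → |Q x| ≤ C)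
    {y : ℝ → ℝ → ℝ} {y' : ℝ → ℝ} {s t : ℝ}
    (hs : Tendsto (fun h => y h s) (𝓝[≠] 0) (𝓝 (y' s)))
    (ht : Tendsto (fun h => y h t) (𝓝[≠] 0) (𝓝 (y' t)))
    (hy : ∀ h, ∫ τ in s..t, Q (U τ, (1 / 2 : ℝ) • (transH2 h (U τ) + U τ), j0 (quotH2 h (U τ)),
      j0 (quotH2 h F)) = y h t - y h s) :
    ∫ τ in s..t, Q (U τ, U τ, j1 (U τ), j1 F) = y' t - y' s := by
  refine tendsto_nhds_unique ?_ (ht.sub hs)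
  simp only [← hy]
  have hUc := hU.continuous
  obtain ⟨R, hR⟩ := (isCompact_uIcc (a := s) (b := t)).exists_bound_of_continuousOn
    hUc.continuousOn
  -- This radius covers all four entries in the argument of `Q`; the factor 2 comes from the bound
  -- for difference quotients.
  obtain ⟨C, hC⟩ := hQb (2 * |R| + 2 * ‖F‖)
  refine intervalIntegral.tendsto_integral_filter_of_dominated_convergence (fun _ => C) ?_ ?_ ?_ ?_
  · refine Eventually.of_forall fun h => Continuous.aestronglyMeasurable ?_
    have := continuous_transH2 (L := L) h
    have := continuous_quotH2 (L := L) h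
    fun_prop
  · refine Eventually.of_forall fun h => Eventually.of_forall fun τ hτ => ?_
    have h1 : ‖U τ‖ ≤ |R| := (hR τ (uIoc_subset_uIcc hτ)).trans (le_abs_self R)
    refine hC _ ?_
    have n1 := norm_nonneg F
    have n2 := abs_nonneg R
    refine norm_prod_le_iff.2 ⟨by linarith, norm_prod_le_iff.2 ⟨?_, norm_prod_le_iff.2 ⟨?_, ?_⟩⟩⟩
    · exact (norm_half_transH2_add_le h _).trans (by linarith)
    · exact (norm_j0_quotH2_le h _).trans (by linarith)
    · exact (norm_j0_quotH2_le h _).trans (by linarith)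
  · simp
  · refine Eventually.of_forall fun τ _ => ?_
    exact (hQ.tendsto _).comp (tendsto_const_nhds.prodMk_nhds
      ((tendsto_half_transH2_add _).prodMk_nhds
        ((tendsto_j0_quotH2 _).prodMk_nhds (tendsto_j0_quotH2 F))))

/-! ### Energy identities -/

theorem inner_self_deriv (a : H1 L) : ⟪a.1.1, a.1.2⟫ = 0 := by
  have := inner_deriv' a a
  rw [real_inner_comm a.1.1] at this
  linarith

theorem inner_self_deriv' (a : H1 L) : ⟪a.1.2, a.1.1⟫ = 0 := by
  rw [real_inner_comm, inner_self_deriv]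

theorem inner_M_deriv_self (a b : H1 L) : ⟪M a b.1.1, b.1.2⟫ = -(1 / 2) * ⟪M b a.1.2, b.1.1⟫ := by
  have h := inner_deriv' (mulH a b) b
  simp only [mulH_fst, mulH_snd, inner_add_left] at h
  rw [inner_M_left a b.1.2, real_inner_comm (M a b.1.1)] at h
  linarith

/-- The integrand is a third of the derivative of a³. This cancellation, and the analogous ones for
a⁴ and a⁵, eliminate the action of the nonlinearity on itself from the energy identities. -/
theorem inner_sq_deriv (a : H1 L) : ⟪M a a.1.1, a.1.2⟫ = 0 := by
  have h := inner_M_deriv_self a a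
  rw [inner_M_left a a.1.2, real_inner_comm (M a a.1.1)] at h
  linarith

theorem inner_sq_sq_deriv (a : H1 L) : ⟪M a a.1.1, M a a.1.2⟫ = 0 := by
  have h := inner_self_deriv (mulH a a)
  simp only [mulH_fst, mulH_snd, inner_add_right] at h
  linarith

theorem mulH_mulH_snd (a : H1 L) : (mulH a (mulH a a)).1.2 = (3 : ℝ) • M a (M a a.1.2) := by
  simp only [mulH_snd, M_mulH, map_add]
  module

theorem inner_sq_cube_deriv (a : H1 L) : ⟪M a a.1.1, M a (M a a.1.2)⟫ = 0 := by
  have h := inner_deriv' (mulH a (mulH a a)) (mulH a a)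
  rw [mulH_mulH_snd] at h
  simp only [mulH_fst, mulH_snd, inner_add_right, real_inner_smul_left] at h
  rw [inner_M_left, real_inner_comm] at h
  have e : ⟪M a (M a a.1.2), M a a.1.1⟫ = ⟪M a a.1.1, M a (M a a.1.2)⟫ := real_inner_comm _ _
  linarith

theorem Sol.evolves_j0 {γ : ℝ} {F : H2 L} {U : ℝ → H2 L} (hU : Sol γ F U) :
    Evolves (fun t => (j0 (U t)).1.1) (fun t => (U t).1.2.2 + (halfSq (U t)).1.1)
      (fun t => F.1.1 - γ • (U t).1.1) := hU.evolves

theorem Sol.hasDerivAt_norm_sq {γ : ℝ} {F : H2 L} {U : ℝ → H2 L} (hU : Sol γ F U) {t : ℝ}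
    (ht : 0 < t) :
    HasDerivAt (fun s => ‖(U s).1.1‖ ^ 2)
      (-(2 * γ) * ‖(U t).1.1‖ ^ 2 + 2 * ⟪F.1.1, (U t).1.1⟫) t := by
  have hc : Continuous fun t => j0 (U t) := j0.continuous.comp hU.continuous
  have h := hU.evolves_j0.hasDerivAt_inner hU.evolves_j0 hU.continuous_flux hU.continuous_source
    hU.continuous_flux hU.continuous_source hc ht
  simp only [real_inner_self_eq_norm_sq] at h
  refine h.congr_deriv ?_
  have e1 := inner_self_deriv' (j1 (U t))
  have e2 := inner_sq_deriv (j0 (U t))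
  simp only [j0_fst, j0_snd, j1_fst, j1_snd] at e1 e2
  simp only [j0_fst, j0_snd, halfSq_fst, inner_add_left, inner_sub_left, real_inner_smul_left, e1,
    e2, real_inner_self_eq_norm_sq]
  ring

/-- The functional whose conservation controls the first derivative. -/
def J1 (u : H2 L) : ℝ := ‖u.1.2.1‖ ^ 2 - 1 / 3 * ⟪M (j0 u) u.1.1, u.1.1⟫

theorem continuous_J1 : Continuous (J1 : H2 L → ℝ) := by
  unfold J1; fun_prop

theorem inner_fst_snd (a b : H2 L) : ⟪a.1.1, b.1.2.2⟫ = -⟪a.1.2.1, b.1.2.1⟫ :=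
  inner_deriv (p := (a.1.1, a.1.2.1)) (q := (b.1.2.1, b.1.2.2)) a.2.2.1 b.2.2.2

theorem inner_snd_fst (a b : H2 L) : ⟪a.1.2.2, b.1.1⟫ = -⟪a.1.2.1, b.1.2.1⟫ := by
  rw [real_inner_comm, inner_fst_snd, real_inner_comm]

theorem Sol.hasDerivAt_norm_sq_deriv {γ : ℝ} {F : H2 L} {U : ℝ → H2 L} (hU : Sol γ F U) {t : ℝ}
    (ht : 0 < t) :
    HasDerivAt (fun s => ‖(U s).1.2.1‖ ^ 2)
      (2 * ⟪(U t).1.2.2, (halfSq (U t)).1.2 - (F.1.1 - γ • (U t).1.1)⟫) t := by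
  have hc := hU.continuous
  have hq := continuous_halfSq hc
  exact hasDerivAt_of_integral_eq
    (c := fun t => 2 * ⟪(U t).1.2.2, (halfSq (U t)).1.2 - (F.1.1 - γ • (U t).1.1)⟫) (by fun_prop)
    (fun s t hs ht => hU.evolves.norm_sq_deriv hc hq hU.continuous_source hs ht) ht

/-- Without damping and force `J1` is conserved, being a multiple of the KdV Hamiltonian. Damping
acts with rate 2γ on the quadratic part and 3γ on the cubic part; the mismatch is the term with γ/3.
-/
theorem Sol.hasDerivAt_J1 {γ : ℝ} {F : H2 L} {U : ℝ → H2 L} (hU : Sol γ F U) {t : ℝ}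
    (ht : 0 < t) :
    HasDerivAt (fun s => J1 (U s))
      (-(2 * γ) * J1 (U t) + (γ / 3 * ⟪M (j0 (U t)) (U t).1.1, (U t).1.1⟫ -
        2 * ⟪(U t).1.1, F.1.2.2⟫ - ⟪F.1.1, M (j0 (U t)) (U t).1.1⟫)) t := by
  have hc : Continuous fun t => j0 (U t) := j0.continuous.comp hU.continuous
  have h := hU.evolves_j0.hasDerivAt_inner_M hU.evolves_j0 hU.evolves_j0 hU.continuous_flux
    hU.continuous_source hU.continuous_flux hU.continuous_source hU.continuous_flux
    hU.continuous_source hc hc ht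
  refine ((hU.hasDerivAt_norm_sq_deriv ht).sub (h.const_mul (1 / 3))).congr_deriv ?_
  have e1 := inner_sq_sq_deriv (j0 (U t))
  have e2 := inner_snd_fst (U t) (U t)
  have e3 := inner_snd_fst (U t) F
  have e4 := inner_fst_snd (U t) F
  have e5 := real_inner_comm (U t).1.1 (M (j0 (U t)) (U t).1.1)
  simp only [j0_fst, j0_snd] at e1
  rw [real_inner_self_eq_norm_sq] at e2
  simp only [J1, mulH_fst, mulH_snd, j0_fst, j0_snd, halfSq_fst, halfSq_snd, inner_add_left,
    inner_add_right, inner_sub_right, inner_sub_left, real_inner_smul_left, real_inner_smul_right,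
    e1, e2, e3, e4, e5]
  ring

/-! ### Second-order energy identities as limits of difference quotients -/

theorem norm_M_le_of_le {c : H1 L} {y : L2 L} {R Y : ℝ} (hc : ‖c‖ ≤ R) (hy : ‖y‖ ≤ Y) :
    ‖M c y‖ ≤ ‖(M : H1 L →L[ℝ] L2 L →L[ℝ] L2 L)‖ * R * Y := by
  refine (M.le_opNorm₂ c y).trans ?_
  have : 0 ≤ R := (norm_nonneg _).trans hc
  gcongr

theorem abs_inner_le_of_le {x y : L2 L} {X Y : ℝ} (hx : ‖x‖ ≤ X) (hy : ‖y‖ ≤ Y) :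
    |⟪x, y⟫| ≤ X * Y := by
  refine (abs_real_inner_le_norm x y).trans ?_
  have : 0 ≤ X := (norm_nonneg _).trans hx
  gcongr

/-- The time derivative of `|w_x|²` for a solution `w` of the linear equation, in terms of the
coefficient, `(w, w_x)` and the source. -/
def rateDeriv (γ : ℝ) (x : H2 L × H2 L × H1 L × H1 L) : ℝ :=
  -3 * ⟪M (j1 x.2.1) x.2.2.1.1.2, x.2.2.1.1.2⟫ - 2 * ⟪M x.2.2.1 x.2.1.1.2.2, x.2.2.1.1.2⟫ -
    2 * γ * ⟪x.2.2.1.1.2, x.2.2.1.1.2⟫ + 2 * ⟪x.2.2.1.1.2, x.2.2.2.1.2⟫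

theorem continuous_rateDeriv (γ : ℝ) : Continuous (rateDeriv (L := L) γ) := by
  unfold rateDeriv; fun_prop

theorem H1.norm_fst_le (a : H1 L) : ‖a.1.1‖ ≤ ‖a‖ := _root_.norm_fst_le a.1
theorem H1.norm_snd_le (a : H1 L) : ‖a.1.2‖ ≤ ‖a‖ := _root_.norm_snd_le a.1

theorem norm_le_of_prod {R : ℝ} {x : H2 L × H2 L × H1 L × H1 L} (hx : ‖x‖ ≤ R) :
    ‖x.1‖ ≤ R ∧ ‖x.2.1‖ ≤ R ∧ ‖x.2.2.1‖ ≤ R ∧ ‖x.2.2.2‖ ≤ R := by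
  simpa only [norm_prod_le_iff] using hx

theorem norm_j0_le (a : H2 L) : ‖j0 a‖ ≤ ‖a‖ := by
  change max ‖a.1.1‖ ‖a.1.2.1‖ ≤ max ‖a.1.1‖ (max ‖a.1.2.1‖ ‖a.1.2.2‖)
  gcongr
  exact le_max_left _ _

theorem norm_j1_le (a : H2 L) : ‖j1 a‖ ≤ ‖a‖ := by
  change max ‖a.1.2.1‖ ‖a.1.2.2‖ ≤ max ‖a.1.1‖ (max ‖a.1.2.1‖ ‖a.1.2.2‖)
  exact le_max_right _ _

theorem rateDeriv_bounded (γ R : ℝ) : ∃ C, ∀ x : H2 L × H2 L × H1 L × H1 L, ‖x‖ ≤ R →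
    |rateDeriv γ x| ≤ C := by
  set K := ‖(M : H1 L →L[ℝ] L2 L →L[ℝ] L2 L)‖ with hK
  refine ⟨3 * (K * R * R * R) + 2 * (K * R * R * R) + 2 * |γ| * (R * R) + 2 * (R * R),
    fun x hx => ?_⟩
  obtain ⟨-, h2, h3, h4⟩ := norm_le_of_prod hx
  have a1 := (norm_j1_le x.2.1).trans h2
  have a2 := (H1.norm_snd_le (j1 x.2.1)).trans a1
  have a3 := (H1.norm_snd_le x.2.2.1).trans h3
  have a4 := (H1.norm_snd_le x.2.2.2).trans h4
  have b1 := abs_inner_le_of_le (norm_M_le_of_le a1 a3) a3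
  have b2 := abs_inner_le_of_le (norm_M_le_of_le h3 a2) a3
  have b3 := abs_inner_le_of_le a3 a3
  have b4 := abs_inner_le_of_le a3 a4
  have b5 : |γ * ⟪x.2.2.1.1.2, x.2.2.1.1.2⟫| ≤ |γ| * (R * R) := by
    rw [abs_mul]; gcongr
  rw [rateDeriv]
  simp only [j1_snd] at b2
  rw [← hK] at b1 b2
  rw [abs_le] at *
  constructor <;> linarith

/-- The time derivative of `∫ u w²` for a solution `u` and a solution `w` of the linear equation. -/
def rateMul (γ : ℝ) (F : H2 L) (x : H2 L × H2 L × H1 L × H1 L) : ℝ :=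
  2 * ⟪x.1.1.2.2 + (halfSq x.1).1.1, M x.2.2.1 x.2.2.1.1.2⟫ +
    ⟪F.1.1 - γ • x.1.1.1, M x.2.2.1 x.2.2.1.1.1⟫ +
    2 * (-(3 / 2) * ⟪M (j1 x.1) x.2.2.1.1.2, x.2.2.1.1.2⟫ - ⟪M x.2.2.1 x.1.1.2.2, x.2.2.1.1.2⟫ +
      ⟪M (j0 x.2.1) x.2.2.1.1.1, M (j0 x.1) x.2.2.1.1.2 + M x.2.2.1 x.1.1.2.1⟫ +
      ⟪x.2.2.2.1.1 - γ • x.2.2.1.1.1, M (j0 x.1) x.2.2.1.1.1⟫)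

theorem continuous_rateMul (γ : ℝ) (F : H2 L) : Continuous (rateMul γ F) := by
  have := continuous_halfSq (continuous_fst : Continuous (Prod.fst :
    H2 L × H2 L × H1 L × H1 L → H2 L))
  unfold rateMul; fun_prop

theorem rateMul_bounded (γ : ℝ) (F : H2 L) (R : ℝ) :
    ∃ C, ∀ x : H2 L × H2 L × H1 L × H1 L, ‖x‖ ≤ R → |rateMul γ F x| ≤ C := by
  set K := ‖(M : H1 L →L[ℝ] L2 L →L[ℝ] L2 L)‖ with hK
  refine ⟨2 * ((R + 1 / 2 * (K * R * R)) * (K * R * R)) + (‖F.1.1‖ + |γ| * R) * (K * R * R) +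
    2 * (3 / 2 * (K * R * R * R) + K * R * R * R + K * R * R * (K * R * R + K * R * R) +
      (R + |γ| * R) * (K * R * R)), fun x hx => ?_⟩
  obtain ⟨h1, h2, h3, h4⟩ := norm_le_of_prod hx
  have a1 := (norm_j1_le x.1).trans h1
  have a2 := (norm_j0_le x.1).trans h1
  have a3 := (norm_j0_le x.2.1).trans h2
  have b1 := (H1.norm_fst_le (j0 x.1)).trans a2
  have b2 := (H1.norm_fst_le (j1 x.1)).trans a1
  have b3 := (H1.norm_snd_le (j1 x.1)).trans a1
  have b4 := (H1.norm_fst_le x.2.2.1).trans h3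
  have b5 := (H1.norm_snd_le x.2.2.1).trans h3
  have b6 := (H1.norm_fst_le x.2.2.2).trans h4
  have sm : ∀ {y : L2 L}, ‖y‖ ≤ R → ‖γ • y‖ ≤ |γ| * R := by
    intro y hy
    rw [norm_smul, Real.norm_eq_abs]
    gcongr
  have c1 : ‖x.1.1.2.2 + (halfSq x.1).1.1‖ ≤ R + 1 / 2 * (K * R * R) := by
    refine (norm_add_le _ _).trans (add_le_add b3 ?_)
    rw [halfSq_fst, norm_smul, Real.norm_of_nonneg (by norm_num)]
    gcongr
    exact norm_M_le_of_le a2 b1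
  have d1 := abs_inner_le_of_le c1 (norm_M_le_of_le h3 b5)
  have d2 := abs_inner_le_of_le ((norm_sub_le F.1.1 (γ • x.1.1.1)).trans (add_le_add le_rfl (sm b1)))
    (norm_M_le_of_le h3 b4)
  have d3 := abs_inner_le_of_le (norm_M_le_of_le a1 b5) b5
  have d4 := abs_inner_le_of_le (norm_M_le_of_le h3 b3) b5
  have d5 := abs_inner_le_of_le (norm_M_le_of_le a3 b4)
    ((norm_add_le (M (j0 x.1) x.2.2.1.1.2) (M x.2.2.1 x.1.1.2.1)).trans
      (add_le_add (norm_M_le_of_le a2 b5) (norm_M_le_of_le h3 b2)))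
  have d6 := abs_inner_le_of_le ((norm_sub_le x.2.2.2.1.1 (γ • x.2.2.1.1.1)).trans
    (add_le_add b6 (sm b4))) (norm_M_le_of_le a2 b4)
  rw [rateMul]
  simp only [j1_snd] at d4
  rw [← hK] at d1 d2 d3 d4 d5 d6
  rw [abs_le] at *
  constructor <;> linarith

theorem LinSol.continuous_flux {v W : ℝ → H2 L} (hv : Continuous v) (hW : Continuous W) :
    Continuous fun t => (W t).1.2.2 + (mulH (j0 (v t)) (j0 (W t))).1.1 := by
  have := continuous_mulH (j0.continuous.comp hv) (j0.continuous.comp hW)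
  simp only [Function.comp_apply] at this
  fun_prop

theorem LinSol.continuous_source {γ : ℝ} {g : H2 L} {W : ℝ → H2 L} (hW : Continuous W) :
    Continuous fun t => g.1.1 - γ • (W t).1.1 := by
  fun_prop

theorem LinSol.norm_sq_deriv {γ : ℝ} {v : ℝ → H2 L} {g : H2 L} {W : ℝ → H2 L}
    (h : LinSol γ v g W) (hv : Continuous v) (hW : Continuous W) {s t : ℝ} (hs : 0 ≤ s)
    (ht : 0 ≤ t) :
    ∫ τ in s..t, 2 * ⟪(W τ).1.2.2, (mulH (j0 (v τ)) (j0 (W τ))).1.2 - (g.1.1 - γ • (W τ).1.1)⟫ =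
      ‖(W t).1.2.1‖ ^ 2 - ‖(W s).1.2.1‖ ^ 2 :=
  Evolves.norm_sq_deriv (A := fun t => mulH (j0 (v t)) (j0 (W t))) h hW
    (continuous_mulH (j0.continuous.comp hv) (j0.continuous.comp hW))
    (LinSol.continuous_source hW) hs ht

/-- Integration by parts eliminates w_xx. What remains depends on w only through (w, w_x), the part
of the difference quotient that converges as h → 0. -/
theorem rateDeriv_eq (γ : ℝ) (u v w g : H2 L) :
    2 * ⟪w.1.2.2, (mulH (j0 v) (j0 w)).1.2 - (g.1.1 - γ • w.1.1)⟫ =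
      rateDeriv γ (u, v, j0 w, j0 g) := by
  have e1 := inner_M_deriv_self (j0 v) (j1 w)
  have e2 := inner_deriv' (mulH (j0 w) (j1 v)) (j1 w)
  have e3 := inner_snd_fst w w
  have e4 := inner_snd_fst w g
  have e5 := M_comm (j1 w) (j1 v)
  simp only [j0_snd, j1_fst, j1_snd, mulH_fst, mulH_snd, inner_add_left] at e1 e2 e5
  rw [real_inner_comm] at e1 e2
  rw [e5] at e1
  simp only [rateDeriv, mulH_snd, j0_snd, inner_sub_right, inner_add_right,
    real_inner_smul_right, e1, e2, e3, e4]
  ring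

/-- The identity for the second derivative. -/
theorem Sol.integral_norm_sq_deriv2 {γ : ℝ} {F : H2 L} {U : ℝ → H2 L} (hU : Sol γ F U) {s t : ℝ}
    (hs : 0 ≤ s) (ht : 0 ≤ t) :
    ∫ τ in s..t, rateDeriv γ (U τ, U τ, j1 (U τ), j1 F) =
      ‖(U t).1.2.2‖ ^ 2 - ‖(U s).1.2.2‖ ^ 2 := by
  have lim : ∀ r, Tendsto (fun h => ‖(quotH2 h (U r)).1.2.1‖ ^ 2) (𝓝[≠] 0)
      (𝓝 (‖(U r).1.2.2‖ ^ 2)) := by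
    intro r
    have h1 : Continuous fun a : H1 L => ‖a.1.2‖ ^ 2 := by fun_prop
    have h2 : Tendsto (fun h => ‖(j0 (quotH2 h (U r))).1.2‖ ^ 2) (𝓝[≠] 0)
        (𝓝 (‖(j1 (U r)).1.2‖ ^ 2)) := (h1.tendsto (j1 (U r))).comp (tendsto_j0_quotH2 (U r))
    simpa only [j0_snd, j1_snd] using h2
  refine hU.integral_of_quot (Q := rateDeriv γ) (continuous_rateDeriv γ) (fun R => rateDeriv_bounded γ R)
    (y := fun h r => ‖(quotH2 h (U r)).1.2.1‖ ^ 2) (y' := fun r => ‖(U r).1.2.2‖ ^ 2)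
    (lim s) (lim t) (fun h => ?_)
  have hv : Continuous fun t => (1 / 2 : ℝ) • (transH2 h (U t) + U t) :=
    (((continuous_transH2 h).comp hU.continuous).add hU.continuous).const_smul (1 / 2 : ℝ)
  rw [← (hU.linSol_quot h).norm_sq_deriv hv ((continuous_quotH2 h).comp hU.continuous) hs ht]
  refine intervalIntegral.integral_congr fun τ _ => ?_
  exact (rateDeriv_eq γ _ _ _ _).symm

/-- Here too w_xx is eliminated: (w_xx, (u w)_x) becomes −(3/2)∫ u_x w_x² − ∫ w u_xx w_x. -/
theorem rateMul_eq (γ : ℝ) (F u v w g : H2 L) :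
    ⟪u.1.2.2 + (halfSq u).1.1, (mulH (j0 w) (j0 w)).1.2⟫ +
      ⟪F.1.1 - γ • u.1.1, (mulH (j0 w) (j0 w)).1.1⟫ +
      (⟪w.1.2.2 + (mulH (j0 v) (j0 w)).1.1, (mulH (j0 u) (j0 w)).1.2⟫ +
        ⟪g.1.1 - γ • w.1.1, (mulH (j0 u) (j0 w)).1.1⟫) +
      (⟪w.1.2.2 + (mulH (j0 v) (j0 w)).1.1, (mulH (j0 u) (j0 w)).1.2⟫ +
        ⟪g.1.1 - γ • w.1.1, (mulH (j0 u) (j0 w)).1.1⟫) = rateMul γ F (u, v, j0 w, j0 g) := by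
  have e1 := inner_M_deriv_self (j0 u) (j1 w)
  have e2 := inner_deriv' (mulH (j0 w) (j1 u)) (j1 w)
  have e5 := M_comm (j1 w) (j1 u)
  simp only [j0_snd, j1_fst, j1_snd, mulH_fst, mulH_snd, inner_add_left] at e1 e2 e5
  rw [real_inner_comm] at e1 e2
  rw [e5] at e1
  simp only [rateMul, mulH_fst, mulH_snd, j0_fst, j0_snd, inner_add_right, inner_add_left]
  rw [e1, e2]
  ring

/-- The identity for ∫ u u_x², obtained from that for ∫ u w² with w the difference quotient of u. -/
theorem Sol.integral_mul {γ : ℝ} {F : H2 L} {U : ℝ → H2 L} (hU : Sol γ F U) {s t : ℝ}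
    (hs : 0 ≤ s) (ht : 0 ≤ t) :
    ∫ τ in s..t, rateMul γ F (U τ, U τ, j1 (U τ), j1 F) =
      ⟪M (j0 (U t)) (U t).1.2.1, (U t).1.2.1⟫ - ⟪M (j0 (U s)) (U s).1.2.1, (U s).1.2.1⟫ := by
  have lim : ∀ r, Tendsto
      (fun h => ⟪M (j0 (U r)) (quotH2 h (U r)).1.1, (quotH2 h (U r)).1.1⟫) (𝓝[≠] 0)
      (𝓝 (⟪M (j0 (U r)) (U r).1.2.1, (U r).1.2.1⟫)) := by
    intro r
    have h1 : Continuous fun a : H1 L => ⟪M (j0 (U r)) a.1.1, a.1.1⟫ := by fun_prop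
    have h2 : Tendsto (fun h => ⟪M (j0 (U r)) (j0 (quotH2 h (U r))).1.1,
        (j0 (quotH2 h (U r))).1.1⟫) (𝓝[≠] 0)
        (𝓝 (⟪M (j0 (U r)) (j1 (U r)).1.1, (j1 (U r)).1.1⟫)) :=
      (h1.tendsto (j1 (U r))).comp (tendsto_j0_quotH2 (U r))
    simpa only [j0_fst, j1_fst] using h2
  refine hU.integral_of_quot (Q := rateMul γ F) (continuous_rateMul γ F) (fun R => rateMul_bounded γ F R)
    (y := fun h r => ⟪M (j0 (U r)) (quotH2 h (U r)).1.1, (quotH2 h (U r)).1.1⟫)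
    (y' := fun r => ⟪M (j0 (U r)) (U r).1.2.1, (U r).1.2.1⟫)
    (lim s) (lim t) (fun h => ?_)
  have hUc := hU.continuous
  have hv : Continuous fun t => (1 / 2 : ℝ) • (transH2 h (U t) + U t) :=
    (((continuous_transH2 h).comp hU.continuous).add hU.continuous).const_smul (1 / 2 : ℝ)
  have hq : Continuous fun t => quotH2 h (U t) := (continuous_quotH2 h).comp hU.continuous
  have hq0 : Continuous fun t => j0 (quotH2 h (U t)) := j0.continuous.comp hq
  have hlin : Evolves (fun t => (j0 (quotH2 h (U t))).1.1) _ _ := hU.linSol_quot h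
  refine intervalIntegral.integral_eq_sub_of_hasDeriv_right
    (f := fun r => ⟪M (j0 (U r)) (quotH2 h (U r)).1.1, (quotH2 h (U r)).1.1⟫)
    (Continuous.continuousOn (by fun_prop)) (fun τ hτ => ?_) ?_
  · have hτ0 : 0 < τ := (le_min hs ht).trans_lt hτ.1
    have := hU.evolves_j0.hasDerivAt_inner_M hlin hlin hU.continuous_flux hU.continuous_source
      (LinSol.continuous_flux hv hq) (LinSol.continuous_source hq)
      (LinSol.continuous_flux hv hq) (LinSol.continuous_source hq) hq0 hq0 hτ0
    rw [rateMul_eq] at this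
    exact this.hasDerivWithinAt
  · exact Continuous.intervalIntegrable ((continuous_rateMul γ F).comp (by fun_prop)) _ _

/-- The functional whose conservation controls the second derivative. -/
def J2 (u : H2 L) : ℝ :=
  9 / 5 * ‖u.1.2.2‖ ^ 2 - 3 * ⟪M (j0 u) u.1.2.1, u.1.2.1⟫ + 1 / 4 * ‖M (j0 u) u.1.1‖ ^ 2

theorem continuous_J2 : Continuous (J2 : H2 L → ℝ) := by
  unfold J2; fun_prop

/-- The coefficients 9/5, 3, 1/4 are those of the next KdV invariant, so all terms free of γ and F
cancel. The parts of degree 2, 3 and 4 are damped with rates 2γ, 3γ and 4γ, and splitting off the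
common rate 2γ leaves the two terms with γ. -/
theorem Sol.hasDerivAt_J2 {γ : ℝ} {F : H2 L} {U : ℝ → H2 L} (hU : Sol γ F U) {t : ℝ}
    (ht : 0 < t) :
    HasDerivAt (fun s => J2 (U s))
      (-(2 * γ) * J2 (U t) + (3 * γ * ⟪M (j0 (U t)) (U t).1.2.1, (U t).1.2.1⟫ -
        1 / 2 * γ * ‖M (j0 (U t)) (U t).1.1‖ ^ 2 + 18 / 5 * ⟪(U t).1.2.2, F.1.2.2⟫ -
        3 * ⟪F.1.1, M (j1 (U t)) (U t).1.2.1⟫ + 3 * ⟪F.1.2.2, M (j0 (U t)) (U t).1.1⟫ +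
        ⟪F.1.1, M (j0 (U t)) (M (j0 (U t)) (U t).1.1)⟫)) t := by
  have hUc := hU.continuous
  have hc : Continuous fun t => j0 (U t) := j0.continuous.comp hU.continuous
  have hd2 := hasDerivAt_of_integral_eq (y := fun s => ‖(U s).1.2.2‖ ^ 2)
    (c := fun τ => rateDeriv γ (U τ, U τ, j1 (U τ), j1 F))
    ((continuous_rateDeriv γ).comp (by fun_prop))
    (fun s t hs ht => hU.integral_norm_sq_deriv2 hs ht) ht
  have hdm := hasDerivAt_of_integral_eq
    (y := fun s => ⟪M (j0 (U s)) (U s).1.2.1, (U s).1.2.1⟫)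
    (c := fun τ => rateMul γ F (U τ, U τ, j1 (U τ), j1 F))
    ((continuous_rateMul γ F).comp (by fun_prop))
    (fun s t hs ht => hU.integral_mul hs ht) ht
  have hd4 := hU.evolves_j0.hasDerivAt_norm_sq_sq hU.continuous_flux hU.continuous_source hc ht
  refine (((hd2.const_mul (9 / 5)).sub (hdm.const_mul 3)).add (hd4.const_mul (1 / 4))).congr_deriv ?_
  generalize U t = u
  have e1 : M (j1 u) u.1.1 = M (j0 u) u.1.2.1 := M_comm (j1 u) (j0 u)
  have e2 := inner_sq_cube_deriv (j0 u)
  have e3 := inner_self_deriv (mulH (j0 u) (j1 u))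
  have e4 := inner_deriv' (mulH (j0 u) (j0 u)) (j1 F)
  have e5 : ⟪M (j0 u) u.1.1, M (j1 u) u.1.2.2⟫ = ⟪u.1.2.2, M (j0 u) (M (j0 u) u.1.2.1)⟫ := by
    rw [real_inner_comm, inner_M_left, M_left_comm, e1]
  have e6 := real_inner_comm (M (j1 u) u.1.2.2) u.1.2.2
  have e7 : ⟪u.1.1, M (j1 u) u.1.2.1⟫ = ⟪M (j0 u) u.1.2.1, u.1.2.1⟫ := by
    rw [← inner_M_left, e1]
  have e8 : ⟪u.1.1, M (j0 u) (M (j0 u) u.1.1)⟫ = ‖M (j0 u) u.1.1‖ ^ 2 := by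
    rw [← inner_M_left, real_inner_self_eq_norm_sq]
  have e9 := real_inner_comm (M (j0 u) u.1.2.1) F.1.2.1
  have e10 := real_inner_comm (M (j0 u) u.1.2.1) u.1.2.1
  have e11 := real_inner_comm (M (j0 u) u.1.1) F.1.2.2
  simp only [j0_fst, j0_snd, j1_fst, j1_snd, mulH_fst, mulH_snd, inner_add_left, inner_add_right]
    at e2 e3 e4
  rw [mulH_mulH_snd]
  simp only [J2, rateDeriv, rateMul, mulH_fst, j0_fst, j0_snd, j1_fst, j1_snd, halfSq_fst,
    inner_add_left, inner_add_right, inner_sub_left, real_inner_smul_left, real_inner_smul_right,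
    real_inner_self_eq_norm_sq, e5, e7, e8]
  simp only [e2, e6, e10]
  linarith

/-- The functional controlling the difference of two solutions. -/
def Phi (v w : H2 L) : ℝ := ‖w.1.2.1‖ ^ 2 - ⟪M (j0 v) w.1.1, w.1.1⟫

/-- The pairing of `-u_t` with `w²` along solutions. -/
def dissip (γ : ℝ) (F u w : H2 L) : ℝ :=
  2 * ⟪u.1.2.2 + (halfSq u).1.1, M (j0 w) w.1.2.1⟫ + ⟪F.1.1 - γ • u.1.1, M (j0 w) w.1.1⟫

/-- The time derivatives of |w_x|² and of ∫ v w² both contain 2(w_xx, (v w)_x), which cancels, and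
the common force disappears from the equation for w. What remains besides damping is −∫ v_t w²,
where v_t is the mean of the two time derivatives. -/
theorem Sol.hasDerivAt_Phi {γ : ℝ} {F : H2 L} {U V : ℝ → H2 L} (hU : Sol γ F U) (hV : Sol γ F V)
    {t : ℝ} (ht : 0 < t) :
    HasDerivAt (fun s => Phi ((1 / 2 : ℝ) • (U s + V s)) (U s - V s))
      (-(2 * γ) * Phi ((1 / 2 : ℝ) • (U t + V t)) (U t - V t) -
        1 / 2 * (dissip γ F (U t) (U t - V t) + dissip γ F (V t) (U t - V t))) t := by
  have hUc := hU.continuous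
  have hVc := hV.continuous
  have hv : Continuous fun t => (1 / 2 : ℝ) • (U t + V t) := (hUc.add hVc).const_smul (1 / 2 : ℝ)
  have hw : Continuous fun t => U t - V t := hUc.sub hVc
  have hv0 : Continuous fun t => j0 ((1 / 2 : ℝ) • (U t + V t)) := j0.continuous.comp hv
  have hw0 : Continuous fun t => j0 (U t - V t) := j0.continuous.comp hw
  have hlin := hU.linSol_sub hV
  have hm : Continuous fun t => mulH (j0 ((1 / 2 : ℝ) • (U t + V t))) (j0 (U t - V t)) :=
    continuous_mulH hv0 hw0
  have d1 := hasDerivAt_of_integral_eq (y := fun s => ‖(U s - V s).1.2.1‖ ^ 2)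
    (c := fun τ => 2 * ⟪(U τ - V τ).1.2.2, (mulH (j0 ((1 / 2 : ℝ) • (U τ + V τ)))
      (j0 (U τ - V τ))).1.2 - ((F - F).1.1 - γ • (U τ - V τ).1.1)⟫) (by fun_prop)
    (fun s t hs ht => hlin.norm_sq_deriv hv hw hs ht) ht
  have hlin' : Evolves (fun t => (j0 (U t - V t)).1.1) _ _ := hlin
  have hev : Evolves (fun t => (j0 ((1 / 2 : ℝ) • (U t + V t))).1.1)
      (fun t => (1 / 2 : ℝ) • (((U t).1.2.2 + (halfSq (U t)).1.1) +
        ((V t).1.2.2 + (halfSq (V t)).1.1)))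
      (fun t => (1 / 2 : ℝ) • ((F.1.1 - γ • (U t).1.1) + (F.1.1 - γ • (V t).1.1))) :=
    (hU.evolves.add hV.evolves hU.continuous_flux hU.continuous_source hV.continuous_flux
      hV.continuous_source).smul (1 / 2)
  have d2 := hev.hasDerivAt_inner_M hlin' hlin'
    ((hU.continuous_flux.add hV.continuous_flux).const_smul (1 / 2 : ℝ))
    ((hU.continuous_source.add hV.continuous_source).const_smul (1 / 2 : ℝ))
    (LinSol.continuous_flux hv hw) (LinSol.continuous_source hw)
    (LinSol.continuous_flux hv hw) (LinSol.continuous_source hw) hw0 hw0 ht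
  have d3 := d1.sub d2
  beta_reduce at d3
  refine d3.congr_deriv ?_
  generalize U t = u
  generalize V t = v
  simp only [Phi]
  have hF : (F - F).1.1 = 0 := by simp
  rw [hF]
  generalize (1 / 2 : ℝ) • (u + v) = z
  generalize u - v = w
  have e1 := inner_self_deriv (mulH (j0 z) (j0 w))
  have e2 := inner_snd_fst w w
  have e3 := real_inner_comm (M (j0 z) w.1.1) w.1.1
  rw [real_inner_self_eq_norm_sq] at e2
  simp only [dissip, mulH_fst, mulH_snd, j0_fst, j0_snd, inner_add_left,
    inner_add_right, inner_sub_left, inner_sub_right, real_inner_smul_left, real_inner_smul_right,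
    zero_sub, inner_neg_left, inner_neg_right] at e1 ⊢
  rw [e2, e3]
  linarith

/-! ### Bounds on compact invariant sets -/

theorem gronwall_sub_le {y : ℝ → ℝ} {c m : ℝ} (hc : 0 < c) (hy : Continuous y)
    (h : ∀ t, 0 < t → ∃ d, HasDerivAt y d t ∧ d ≤ -c * y t + m) {T : ℝ} (hT : 0 ≤ T) :
    y T - m / c ≤ Real.exp (-c * T) * (y 0 - m / c) := by
  have hg : AntitoneOn (fun t => Real.exp (c * t) * (y t - m / c)) (Ici 0) := by
    have hd : ∀ t, 0 < t → ∃ d ≤ 0, HasDerivAt (fun t => Real.exp (c * t) * (y t - m / c)) d t := by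
      intro t ht
      obtain ⟨d, hd, hle⟩ := h t ht
      have h0 : HasDerivAt (fun t => c * t) (c * 1) t := (hasDerivAt_id t).const_mul c
      refine ⟨_, ?_, h0.exp.mul (hd.sub_const (m / c))⟩
      have e : Real.exp (c * t) * (c * 1) * (y t - m / c) + Real.exp (c * t) * d =
          Real.exp (c * t) * (c * y t - m + d) := by
        field_simp
      rw [e]
      exact mul_nonpos_of_nonneg_of_nonpos (Real.exp_pos _).le (by linarith)
    refine antitoneOn_of_deriv_nonpos (convex_Ici 0) (Continuous.continuousOn (by fun_prop)) ?_ ?_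
    · intro t ht
      rw [interior_Ici] at ht
      obtain ⟨d, -, hd⟩ := hd t ht
      exact hd.differentiableAt.differentiableWithinAt
    · intro t ht
      rw [interior_Ici] at ht
      obtain ⟨d, hd0, hd⟩ := hd t ht
      rwa [hd.deriv]
  have h1 := hg (self_mem_Ici) (mem_Ici.2 hT) hT
  simp only [mul_zero, Real.exp_zero, one_mul] at h1
  have h2 : Real.exp (-c * T) * Real.exp (c * T) = 1 := by
    rw [← Real.exp_add]; simp
  calc y T - m / c = Real.exp (-c * T) * (Real.exp (c * T) * (y T - m / c)) := by
        rw [← mul_assoc, h2, one_mul]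
    _ ≤ _ := mul_le_mul_of_nonneg_left h1 (Real.exp_pos _).le

theorem tendsto_exp_neg_mul {c : ℝ} (hc : 0 < c) (B : ℝ) :
    Tendsto (fun T : ℝ => Real.exp (-c * T) * B) atTop (𝓝 0) := by
  have h1 : Tendsto (fun T : ℝ => -c * T) atTop atBot :=
    tendsto_id.const_mul_atTop_of_neg (neg_lt_zero.2 hc)
  simpa using (Real.tendsto_exp_atBot.comp h1).mul_const B

/-- A differential inequality along solutions bounds a functional on compact invariant sets. -/
theorem le_of_isInvariant {γ : ℝ} {f : H2per L} {K : Set (H2per L)} (hK : IsCompact K)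
    (hinv : IsInvariant γ f K) {J : H2 L → ℝ} (hJ : Continuous J) {c m : ℝ} (hc : 0 < c)
    (h : ∀ U, Sol γ f.toH2 U → (∀ t, ∃ z ∈ K, U t = z.toH2) → ∀ t, 0 < t →
      ∃ d, HasDerivAt (fun s => J (U s)) d t ∧ d ≤ -c * J (U t) + m) {z : H2per L} (hz : z ∈ K) :
    J z.toH2 ≤ m / c := by
  obtain ⟨B, hB⟩ := hK.exists_bound_of_continuousOn
    (hJ.comp H2per.continuous_toH2).continuousOn
  have key : ∀ T, 0 ≤ T → J z.toH2 - m / c ≤ Real.exp (-c * T) * (B - m / c) := by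
    intro T hT
    -- By invariance z is reached at every time T by a trajectory that starts in K and stays there.
    -- The value of J at its start is bounded independently of T, so its influence disappears as T →
    -- ∞.
    have hz' : z ∈ flowImage γ f T K := by rwa [hinv T hT]
    obtain ⟨u, hu, hu0, huT⟩ := hz'
    have hmem : ∀ t, 0 ≤ t → u t ∈ K := by
      intro t ht
      rw [← hinv t ht]
      exact ⟨u, hu, hu0, rfl⟩
    have := gronwall_sub_le hc (hJ.comp hu.sol.continuous)
      (h _ hu.sol fun t => ⟨_, hmem _ (le_max_right t 0), rfl⟩) hT
    simp only [Function.comp_apply, max_eq_left hT, huT, max_self] at this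
    refine this.trans (mul_le_mul_of_nonneg_left ?_ (Real.exp_pos _).le)
    have := (le_abs_self _).trans (hB _ hu0)
    simp only [Function.comp_apply] at this
    linarith
  have := ge_of_tendsto (tendsto_exp_neg_mul hc (B - m / c))
    ((eventually_ge_atTop 0).mono fun T hT => key T hT)
  linarith

theorem ae_abs_le_j0 (a : H2 L) :
    ∀ᵐ x ∂(volume.restrict (Ioc (0 : ℝ) L)), |(j0 a).1.1 x| ≤ √(‖a.1.1‖ * ‖a.1.2.1‖) :=
  ae_abs_le (j0 a).2 a.2.1

theorem norm_M_j0_le (a : H2 L) (b : L2 L) : ‖M (j0 a) b‖ ≤ √(‖a.1.1‖ * ‖a.1.2.1‖) * ‖b‖ :=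
  norm_M_le (ae_abs_le_j0 a) b

theorem ae_abs_le_normSup (f : H2per L) :
    ∀ᵐ x ∂(volume.restrict (Ioc (0 : ℝ) L)), |(j0 f.toH2).1.1 x| ≤ normSup f := by
  have hfin : eLpNorm f.val ⊤ (volume.restrict (Ioc (0 : ℝ) L)) ≠ ⊤ := by
    refine (MemLp.of_bound (Lp.aestronglyMeasurable _) (√(‖f.toH2.1.1‖ * ‖f.toH2.1.2.1‖)) ?_).2.ne
    exact ae_abs_le_j0 f.toH2
  rw [eLpNorm_exponent_top] at hfin
  filter_upwards [ae_le_eLpNormEssSup (f := f.val) (μ := volume.restrict (Ioc (0 : ℝ) L))] with x hx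
  rw [normSup, eLpNorm_exponent_top]
  have h1 := (ENNReal.toReal_le_toReal enorm_ne_top hfin).2 hx
  rw [toReal_enorm] at h1
  exact h1

theorem normSup_le (f : H2per L) : normSup f ≤ √(‖f.toH2.1.1‖ * ‖f.toH2.1.2.1‖) := by
  refine ENNReal.toReal_le_of_le_ofReal (Real.sqrt_nonneg _) ?_
  rw [eLpNorm_exponent_top]
  refine eLpNormEssSup_le_of_ae_bound ?_
  exact ae_abs_le_j0 f.toH2

theorem normSup_nonneg (f : H2per L) : 0 ≤ normSup f := ENNReal.toReal_nonneg

theorem norm_sq_snd_le (a : H2 L) : ‖a.1.2.1‖ ^ 2 ≤ ‖a.1.1‖ * ‖a.1.2.2‖ := by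
  have h := inner_fst_snd a a
  rw [real_inner_self_eq_norm_sq] at h
  have := neg_le_of_abs_le (abs_real_inner_le_norm a.1.1 a.1.2.2)
  linarith

theorem inner_mul_mul_eq (F u : H2 L) :
    ⟪F.1.1, M (j0 u) u.1.1⟫ = ⟪M (j0 F) u.1.1, u.1.1⟫ := by
  have := M_comm (j0 u) (j0 F)
  simp only [j0_fst] at this
  rw [← inner_M_left, this]

/-- The weighted arithmetic–geometric mean inequality with weights 3/4 and 1/4, from (3a + b)⁴ − 256
a³ b = (b − a)²((b + 7a)² + 32a²). -/
theorem four_mul_le_of_pow_le {x a b : ℝ} (ha : 0 ≤ a) (hb : 0 ≤ b) (h : x ^ 4 ≤ a ^ 3 * b) :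
    4 * x ≤ 3 * a + b := by
  by_contra hlt
  push Not at hlt
  have h1 : (3 * a + b) ^ 4 < (4 * x) ^ 4 := pow_lt_pow_left₀ hlt (by positivity) (by norm_num)
  have h2 : 0 ≤ (b - a) ^ 2 * ((b + 7 * a) ^ 2 + 32 * a ^ 2) := by positivity
  nlinarith

/-! ### The explicit constants, and the bounds of three norms on compact invariant sets -/

variable {γ : ℝ} {f : H2per L}

theorem R0_nonneg (hγ : 0 < γ) : 0 ≤ R0 γ f := div_nonneg (norm_nonneg _) hγ.le

theorem R1_nonneg : 0 ≤ R1 γ f := Real.sqrt_nonneg _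

theorem Rinf_nonneg (hγ : 0 < γ) : 0 ≤ Rinf γ f :=
  mul_nonneg (Real.rpow_nonneg (R0_nonneg hγ) _) (Real.rpow_nonneg R1_nonneg _)

theorem R2_nonneg : 0 ≤ R2 γ f := Real.sqrt_nonneg _

theorem Rinf_sq (hγ : 0 < γ) : Rinf γ f ^ 2 = R0 γ f * R1 γ f := by
  rw [Rinf, mul_pow, ← Real.sqrt_eq_rpow, ← Real.sqrt_eq_rpow, Real.sq_sqrt (R0_nonneg hγ),
    Real.sq_sqrt R1_nonneg]

theorem sqrt_le_Rinf (hγ : 0 < γ) {x y : ℝ} (hy : 0 ≤ y) (h1 : x ≤ R0 γ f) (h2 : y ≤ R1 γ f) :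
    √(x * y) ≤ Rinf γ f := by
  rw [Real.sqrt_le_left (Rinf_nonneg hγ), Rinf_sq hγ]
  have := R0_nonneg (f := f) hγ
  gcongr

theorem rpow_three_halves_mul (hγ : 0 < γ) :
    R0 γ f ^ (3 / 2 : ℝ) * R1 γ f ^ (1 / 2 : ℝ) = R0 γ f * Rinf γ f := by
  rw [Rinf, ← mul_assoc]
  congr 1
  have : (3 / 2 : ℝ) = 1 + 1 / 2 := by norm_num
  rw [this, Real.rpow_add_of_nonneg (R0_nonneg hγ) (by norm_num) (by norm_num), Real.rpow_one]

theorem rpow_five_halves_mul (hγ : 0 < γ) :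
    R0 γ f ^ (5 / 2 : ℝ) * R1 γ f ^ (1 / 2 : ℝ) = R0 γ f ^ 2 * Rinf γ f := by
  rw [Rinf, ← mul_assoc]
  congr 1
  have : (5 / 2 : ℝ) = (2 : ℕ) + 1 / 2 := by norm_num
  rw [this, Real.rpow_add_of_nonneg (R0_nonneg hγ) (by norm_num) (by norm_num), Real.rpow_natCast]

theorem R1_sq (hγ : 0 < γ) : R1 γ f ^ 2 =
    4 * R0 γ f ^ (10 / 3 : ℝ) + 2 * (normH2 f * R0 γ f ^ 2 / γ) + 4 * (normH2 f * R0 γ f / γ) := by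
  have h0 := R0_nonneg (f := f) hγ
  have hF : 0 ≤ normH2 f := norm_nonneg _
  have e : γ ^ (4 / 3 : ℝ) / γ ^ (1 / 3 : ℝ) = γ := by
    rw [← Real.rpow_sub hγ]
    norm_num
  rw [R1, e, Real.sq_sqrt (by positivity)]
  field_simp
  ring

theorem rpow_ten_thirds_pow (hγ : 0 < γ) : (R0 γ f ^ (10 / 3 : ℝ)) ^ 3 = R0 γ f ^ 10 := by
  rw [← Real.rpow_natCast, ← Real.rpow_mul (R0_nonneg hγ), ← Real.rpow_natCast]
  norm_num

theorem norm_eq_mul_R0 (hγ : 0 < γ) : ‖f.toH2.1.1‖ = γ * R0 γ f := by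
  have : R0 γ f = ‖f.toH2.1.1‖ / γ := rfl
  rw [this]
  field_simp

theorem sqrt_pow_four_le (a : H2 L) : √(‖a.1.1‖ * ‖a.1.2.1‖) ^ 4 ≤ ‖a.1.1‖ ^ 3 * ‖a.1.2.2‖ := by
  have e : √(‖a.1.1‖ * ‖a.1.2.1‖) ^ 4 = ‖a.1.1‖ ^ 2 * ‖a.1.2.1‖ ^ 2 := by
    have : √(‖a.1.1‖ * ‖a.1.2.1‖) ^ 4 = (√(‖a.1.1‖ * ‖a.1.2.1‖) ^ 2) ^ 2 := by ring
    rw [this, Real.sq_sqrt (by positivity), mul_pow]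
  rw [e]
  calc ‖a.1.1‖ ^ 2 * ‖a.1.2.1‖ ^ 2 ≤ ‖a.1.1‖ ^ 2 * (‖a.1.1‖ * ‖a.1.2.2‖) := by
        gcongr; exact norm_sq_snd_le a
    _ = _ := by ring

/-- The force obeys the same supremum bound as γu, so f and γu can be estimated alike in u_t. The
fourth power of the left side is at most |f|³|f_xx|, and the square of `R1` contains 4|f|_{H²}R_0/γ.
-/
theorem sqrt_source_le (hγ : 0 < γ) :
    √(‖f.toH2.1.1‖ * ‖f.toH2.1.2.1‖) ≤ γ * Rinf γ f := by
  have h0 := R0_nonneg (f := f) hγ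
  have hi := Rinf_nonneg (f := f) hγ
  have hF : 0 ≤ normH2 f := norm_nonneg _
  refine (pow_le_pow_iff_left₀ (Real.sqrt_nonneg _) (by positivity) (n := 4) (by norm_num)).1 ?_
  refine (sqrt_pow_four_le f.toH2).trans ?_
  have e : (γ * Rinf γ f) ^ 4 = γ ^ 4 * R0 γ f ^ 2 * R1 γ f ^ 2 := by
    have : (γ * Rinf γ f) ^ 4 = γ ^ 4 * (Rinf γ f ^ 2) ^ 2 := by ring
    rw [this, Rinf_sq hγ]
    ring
  rw [e, norm_eq_mul_R0 hγ, R1_sq hγ]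
  change (γ * R0 γ f) ^ 3 * normH2 f ≤ _
  have e2 : (γ * R0 γ f) ^ 3 * normH2 f =
      γ ^ 4 * R0 γ f ^ 2 * (normH2 f * R0 γ f / γ) := by
    field_simp
  rw [e2]
  gcongr
  have : 0 ≤ R0 γ f ^ (10 / 3 : ℝ) := by positivity
  have : 0 ≤ normH2 f * R0 γ f ^ 2 / γ := by positivity
  have : 0 ≤ normH2 f * R0 γ f / γ := by positivity
  linarith

theorem norm_le_R0 (hγ : 0 < γ) {K : Set (H2per L)} (hK : IsCompact K) (hinv : IsInvariant γ f K)
    {z : H2per L} (hz : z ∈ K) : ‖z.toH2.1.1‖ ≤ R0 γ f := by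
  have h := le_of_isInvariant hK hinv (J := fun u => ‖u.1.1‖ ^ 2) (by fun_prop) hγ
    (m := ‖f.toH2.1.1‖ ^ 2 / γ) (fun U hU _ t ht => ⟨_, hU.hasDerivAt_norm_sq ht, ?_⟩) hz
  · refine (pow_le_pow_iff_left₀ (norm_nonneg _) (R0_nonneg hγ) two_ne_zero).1 (h.trans_eq ?_)
    rw [norm_eq_mul_R0 hγ]
    field_simp
  · have h1 := (le_abs_self _).trans (abs_real_inner_le_norm f.toH2.1.1 (U t).1.1)
    have h2 : 2 * (‖f.toH2.1.1‖ * ‖(U t).1.1‖) ≤ γ * ‖(U t).1.1‖ ^ 2 + ‖f.toH2.1.1‖ ^ 2 / γ := by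
      rw [norm_eq_mul_R0 hγ]
      have : (γ * R0 γ f) ^ 2 / γ = γ * R0 γ f ^ 2 := by field_simp
      rw [this]
      nlinarith [mul_nonneg hγ.le (sq_nonneg (R0 γ f - ‖(U t).1.1‖))]
    linarith

/-- The bound for `J1` contains ∫ u³, which is estimated through the maximum D of |u_x| over K. At a
maximizer this is an inequality for D alone, in which ∫ u³ grows only like √D and is absorbed by D².
-/
theorem norm_le_R1 (hγ : 0 < γ) {K : Set (H2per L)} (hK : IsCompact K) (hinv : IsInvariant γ f K)
    {z : H2per L} (hz : z ∈ K) : ‖z.toH2.1.2.1‖ ≤ R1 γ f := by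
  have hcont : Continuous fun z : H2per L => ‖z.toH2.1.2.1‖ := by
    have := H2per.continuous_toH2 (L := L)
    fun_prop
  obtain ⟨z₀, hz₀, hmax⟩ := hK.exists_isMaxOn ⟨z, hz⟩ hcont.continuousOn
  refine (hmax hz).trans ?_
  set D := ‖z₀.toH2.1.2.1‖ with hD
  set ρ := R0 γ f with hρ
  have hρ0 : 0 ≤ ρ := R0_nonneg hγ
  have hD0 : 0 ≤ D := norm_nonneg _
  set C := √(ρ * D) * ρ ^ 2 with hC
  set S := √(‖f.toH2.1.1‖ * ‖f.toH2.1.2.1‖) with hS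
  have hF : 0 ≤ normH2 f := norm_nonneg _
  have hC0 : 0 ≤ C := by positivity
  have cube : ∀ v ∈ K, |⟪M (j0 v.toH2) v.toH2.1.1, v.toH2.1.1⟫| ≤ C := by
    intro v hv
    have h1 : ‖v.toH2.1.1‖ ≤ ρ := norm_le_R0 hγ hK hinv hv
    have h2 : ‖v.toH2.1.2.1‖ ≤ D := hmax hv
    calc |⟪M (j0 v.toH2) v.toH2.1.1, v.toH2.1.1⟫|
        ≤ ‖M (j0 v.toH2) v.toH2.1.1‖ * ‖v.toH2.1.1‖ := abs_real_inner_le_norm _ _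
      _ ≤ (√(ρ * D) * ρ) * ρ := by
          gcongr
          refine (norm_M_j0_le _ _).trans ?_
          gcongr
      _ = C := by rw [hC]; ring
  have h := le_of_isInvariant hK hinv continuous_J1 (c := 2 * γ) (by positivity)
    (m := γ / 3 * C + 2 * (ρ * normH2 f) + S * ρ ^ 2)
    (fun U hU hmem t ht => ⟨_, hU.hasDerivAt_J1 ht, ?_⟩) hz₀
  · have h3 := (le_abs_self _).trans (cube z₀ hz₀)
    have hJ : J1 z₀.toH2 = D ^ 2 - 1 / 3 * ⟪M (j0 z₀.toH2) z₀.toH2.1.1, z₀.toH2.1.1⟫ := rfl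
    set a := ρ ^ (10 / 3 : ℝ) with ha
    have ha0 : 0 ≤ a := by positivity
    have ha3 : a ^ 3 = ρ ^ 10 := rpow_ten_thirds_pow hγ
    set b := normH2 f * ρ / γ with hb
    have hb0 : 0 ≤ b := by positivity
    -- Here C⁴ = ρ¹⁰D² = a³D²; this is the origin of the exponent 10/3.
    have i1 : 4 * C ≤ 3 * a + D ^ 2 := by
      refine four_mul_le_of_pow_le ha0 (sq_nonneg _) (le_of_eq ?_)
      have : C ^ 4 = (√(ρ * D) ^ 2) ^ 2 * ρ ^ 8 := by rw [hC]; ring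
      rw [this, Real.sq_sqrt (by positivity), ha3]
      ring
    -- The same splitting for the force, from S⁴ ≤ |f|³|f_xx| and |f| = γρ.
    have i2 : 4 * (S * ρ ^ 2 / γ) ≤ 3 * a + b := by
      refine four_mul_le_of_pow_le ha0 hb0 ?_
      have e1 : (S * ρ ^ 2 / γ) ^ 4 = S ^ 4 * (ρ ^ 8 / γ ^ 4) := by rw [div_pow]; ring
      have e2 : a ^ 3 * b = (γ * ρ) ^ 3 * normH2 f * (ρ ^ 8 / γ ^ 4) := by
        rw [ha3, hb]
        field_simp
      rw [e1, e2]
      have := sqrt_pow_four_le f.toH2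
      rw [norm_eq_mul_R0 hγ] at this
      gcongr
      rw [hS, norm_eq_mul_R0 hγ]
      exact this
    have e3 : (γ / 3 * C + 2 * (ρ * normH2 f) + S * ρ ^ 2) / (2 * γ) =
        C / 6 + b + S * ρ ^ 2 / γ / 2 := by
      rw [hb]; field_simp; ring
    rw [e3, hJ] at h
    have hR : R1 γ f ^ 2 = 4 * a + 2 * (normH2 f * ρ ^ 2 / γ) + 4 * b := R1_sq hγ
    have hR' : 0 ≤ normH2 f * ρ ^ 2 / γ := by positivity
    refine (pow_le_pow_iff_left₀ hD0 R1_nonneg two_ne_zero).1 ?_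
    rw [hR]
    linarith
  · obtain ⟨v, hv, hvU⟩ := hmem t
    rw [hvU]
    have n1 : ‖v.toH2.1.1‖ ≤ ρ := norm_le_R0 hγ hK hinv hv
    have t1 := (le_abs_self _).trans (cube v hv)
    have t2 : |⟪v.toH2.1.1, f.toH2.1.2.2⟫| ≤ ρ * normH2 f := abs_inner_le_of_le n1 le_rfl
    have t3 : |⟪f.toH2.1.1, M (j0 v.toH2) v.toH2.1.1⟫| ≤ S * ρ * ρ := by
      rw [inner_mul_mul_eq]
      refine abs_inner_le_of_le ((norm_M_j0_le _ _).trans ?_) n1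
      gcongr
    have t4 := mul_le_mul_of_nonneg_left t1 (by positivity : 0 ≤ γ / 3)
    have t5 := neg_le_of_abs_le t2
    have t6 := neg_le_of_abs_le t3
    linarith

/-- With one derivative moved, ∫ u u_x² is at most linear in |u_xx|, the factor being the already
bounded |u²|. -/
theorem mul_deriv_deriv_eq (u : H2 L) :
    ⟪M (j0 u) u.1.2.1, u.1.2.1⟫ = -(1 / 2) * ⟪M (j0 u) u.1.1, u.1.2.2⟫ := by
  have h := inner_deriv' (mulH (j0 u) (j0 u)) (j1 u)
  simp only [mulH_fst, mulH_snd, j0_fst, j0_snd, j1_fst, j1_snd, inner_add_left] at h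
  linarith

theorem sq_sub_le_of_sq_le {y b q : ℝ} (h : y ^ 2 ≤ y * b + q) : y ^ 2 ≤ b ^ 2 + 2 * q := by
  have h1 := sq_nonneg (y - b)
  have h2 : (y - b) ^ 2 = y ^ 2 - 2 * (y * b) + b ^ 2 := by ring
  linarith

/-- Compares the outcome of the `J2` estimate with the definition of `R2`, for a = R_0R_∞, g =
|f|_∞R_0/γ and φ = |f|_{H²}/γ. Only the coefficient of a g is larger on the left, by 5/36, and (a −
g)² ≥ 0 makes up for it. -/
theorem quadratic_form_le {a g φ : ℝ} (ha : 0 ≤ a) (hg : 0 ≤ g) (hφ : 0 ≤ φ) :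
    (5 / 4 * a + φ + 5 / 6 * g) ^ 2 + 2 * (5 / 6 * (a * φ) + 5 / 18 * (a * g)) ≤
      5 / 36 * (3 * a + 3 * g + 18 / 5 * φ) ^ 2 + 3 / 2 * (a * φ) + 45 / 64 * a ^ 2 := by
  have h1 := sq_nonneg (a - g)
  have h2 := mul_nonneg ha hφ
  have h3 := mul_nonneg hg hφ
  have h4 := sq_nonneg a
  have h5 := sq_nonneg g
  have h6 := sq_nonneg φ
  ring_nf at h1 ⊢
  linarith

/-- With Y the maximum of |u_xx| over K, the bound for `J2` at a maximizer is a quadratic inequality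
Y² ≤ bY + q, since |u_x|² ≤ R_0 Y and ∫ u u_x² is linear in Y. -/
theorem norm_le_R2 (hγ : 0 < γ) {K : Set (H2per L)} (hK : IsCompact K) (hinv : IsInvariant γ f K)
    {z : H2per L} (hz : z ∈ K) : ‖z.toH2.1.2.2‖ ≤ R2 γ f := by
  have hcont : Continuous fun z : H2per L => ‖z.toH2.1.2.2‖ := by
    have := H2per.continuous_toH2 (L := L)
    fun_prop
  obtain ⟨z₀, hz₀, hmax⟩ := hK.exists_isMaxOn ⟨z, hz⟩ hcont.continuousOn
  refine (hmax hz).trans ?_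
  set Y := ‖z₀.toH2.1.2.2‖ with hY
  set ρ := R0 γ f with hρ
  have hρ0 : 0 ≤ ρ := R0_nonneg hγ
  have hY0 : 0 ≤ Y := norm_nonneg _
  have hi0 := Rinf_nonneg (f := f) hγ
  set N := ρ * Rinf γ f with hN
  have hN0 : 0 ≤ N := by positivity
  set S := normSup f with hS
  have hS0 : 0 ≤ S := normSup_nonneg f
  have hF : 0 ≤ normH2 f := norm_nonneg _
  have sq : ∀ v ∈ K, ‖M (j0 v.toH2) v.toH2.1.1‖ ≤ N := by
    intro v hv
    have h1 : ‖v.toH2.1.1‖ ≤ ρ := norm_le_R0 hγ hK hinv hv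
    have h2 := norm_le_R1 hγ hK hinv hv
    refine (norm_M_j0_le _ _).trans ?_
    rw [hN, mul_comm ρ]
    gcongr
    exact sqrt_le_Rinf hγ (norm_nonneg _) h1 h2
  have triple : ∀ v ∈ K, ⟪M (j0 v.toH2) v.toH2.1.2.1, v.toH2.1.2.1⟫ ≤ 1 / 2 * (N * Y) := by
    intro v hv
    rw [mul_deriv_deriv_eq]
    have h1 := neg_le_of_abs_le (abs_inner_le_of_le (sq v hv) (hmax hv : ‖v.toH2.1.2.2‖ ≤ Y))
    linarith
  have h := le_of_isInvariant hK hinv continuous_J2 (c := 2 * γ) (by positivity)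
    (m := 3 / 2 * γ * (N * Y) + 18 / 5 * (Y * normH2 f) + 3 * (S * (ρ * Y)) +
      3 * (normH2 f * N) + S * ρ * N)
    (fun U hU hmem t ht => ⟨_, hU.hasDerivAt_J2 ht, ?_⟩) hz₀
  · have h3 := triple z₀ hz₀
    have hJ : J2 z₀.toH2 = 9 / 5 * Y ^ 2 - 3 * ⟪M (j0 z₀.toH2) z₀.toH2.1.2.1, z₀.toH2.1.2.1⟫ +
      1 / 4 * ‖M (j0 z₀.toH2) z₀.toH2.1.1‖ ^ 2 := rfl
    have h4 := sq_nonneg ‖M (j0 z₀.toH2) z₀.toH2.1.1‖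
    set g := S * ρ / γ with hg
    set φ := normH2 f / γ with hφ
    have hg0 : 0 ≤ g := by positivity
    have hφ0 : 0 ≤ φ := by positivity
    have e3 : (3 / 2 * γ * (N * Y) + 18 / 5 * (Y * normH2 f) + 3 * (S * (ρ * Y)) +
        3 * (normH2 f * N) + S * ρ * N) / (2 * γ) =
        3 / 4 * (N * Y) + 9 / 5 * (Y * φ) + 3 / 2 * (g * Y) + 3 / 2 * (φ * N) + 1 / 2 * (g * N) := by
      rw [hg, hφ]; field_simp; ring
    rw [e3, hJ] at h
    have hC1 : C1 γ f = γ * (3 * N + 3 * g + 18 / 5 * φ + 6 * (φ * ρ)) := by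
      rw [C1, mul_assoc (3 * γ), rpow_three_halves_mul hγ, hg, hφ]
      change 3 * γ * N + 3 * S * ρ + 18 / 5 * normH2 f + 6 * normH2 f * ρ = _
      field_simp
    have hC2 : C2 γ f = γ * (3 / 2 * (N * φ) + φ * (ρ * N)) := by
      rw [C2, mul_assoc (3 / 2 : ℝ), mul_assoc (normH2 f), rpow_three_halves_mul hγ,
        rpow_five_halves_mul hγ, hφ]
      change 3 / 2 * N * normH2 f + normH2 f * (ρ ^ 2 * Rinf γ f) = _
      rw [hN]
      field_simp
    have hN2 : R0 γ f ^ 3 * R1 γ f = N ^ 2 := by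
      rw [hN, mul_pow, Rinf_sq hγ]; ring
    rw [R2, mul_assoc (45 / 64 : ℝ), hN2, hC1, hC2]
    refine Real.le_sqrt_of_sq_le ?_
    have e4 : 5 / (36 * γ ^ 2) * (γ * (3 * N + 3 * g + 18 / 5 * φ + 6 * (φ * ρ))) ^ 2 =
        5 / 36 * (3 * N + 3 * g + 18 / 5 * φ + 6 * (φ * ρ)) ^ 2 := by
      field_simp
    have e5 : 1 / γ * (γ * (3 / 2 * (N * φ) + φ * (ρ * N))) =
        3 / 2 * (N * φ) + φ * (ρ * N) := by
      field_simp
    rw [e4, e5]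
    have i1 : (3 * N + 3 * g + 18 / 5 * φ) ^ 2 ≤
        (3 * N + 3 * g + 18 / 5 * φ + 6 * (φ * ρ)) ^ 2 := by
      have : 0 ≤ φ * ρ := by positivity
      exact pow_le_pow_left₀ (by positivity) (by linarith) 2
    have i2 : 0 ≤ φ * (ρ * N) := by positivity
    -- Division by 9/5. The coefficient 5/4 of N Y collects 3/2 from the cubic term of `J2` at the
    -- maximizer and 3/4 from the damping remainder.
    have i3 : Y ^ 2 ≤ Y * (5 / 4 * N + φ + 5 / 6 * g) + (5 / 6 * (N * φ) + 5 / 18 * (N * g)) := by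
      linarith
    have i4 := sq_sub_le_of_sq_le i3
    have i5 := quadratic_form_le hN0 hg0 hφ0
    linarith
  · obtain ⟨v, hv, hvU⟩ := hmem t
    rw [hvU]
    have n1 : ‖v.toH2.1.1‖ ≤ ρ := norm_le_R0 hγ hK hinv hv
    have n2 : ‖v.toH2.1.2.2‖ ≤ Y := hmax hv
    have n3 : ‖v.toH2.1.2.1‖ ^ 2 ≤ ρ * Y := (norm_sq_snd_le _).trans (by gcongr)
    have n4 := sq v hv
    have t1 := mul_le_mul_of_nonneg_left (triple v hv) (by positivity : 0 ≤ 3 * γ)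
    have t2 : ⟪v.toH2.1.2.2, f.toH2.1.2.2⟫ ≤ Y * normH2 f :=
      (le_abs_self _).trans (abs_inner_le_of_le n2 le_rfl)
    have t3 : |⟪f.toH2.1.1, M (j1 v.toH2) v.toH2.1.2.1⟫| ≤ S * (ρ * Y) := by
      have e : M (j1 v.toH2) f.toH2.1.1 = M (j0 f.toH2) v.toH2.1.2.1 :=
        M_comm (j1 v.toH2) (j0 f.toH2)
      rw [← inner_M_left, e]
      calc |⟪M (j0 f.toH2) v.toH2.1.2.1, v.toH2.1.2.1⟫|
          ≤ ‖M (j0 f.toH2) v.toH2.1.2.1‖ * ‖v.toH2.1.2.1‖ := abs_real_inner_le_norm _ _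
        _ ≤ (S * ‖v.toH2.1.2.1‖) * ‖v.toH2.1.2.1‖ := by
            gcongr
            exact norm_M_le (ae_abs_le_normSup f) _
        _ = S * ‖v.toH2.1.2.1‖ ^ 2 := by ring
        _ ≤ _ := by gcongr
    have t4 : ⟪f.toH2.1.2.2, M (j0 v.toH2) v.toH2.1.1⟫ ≤ normH2 f * N :=
      (le_abs_self _).trans (abs_inner_le_of_le le_rfl n4)
    have t5 : ⟪f.toH2.1.1, M (j0 v.toH2) (M (j0 v.toH2) v.toH2.1.1)⟫ ≤ S * ρ * N := by
      have e : M (j0 v.toH2) f.toH2.1.1 = M (j0 f.toH2) v.toH2.1.1 :=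
        M_comm (j0 v.toH2) (j0 f.toH2)
      rw [← inner_M_left, e]
      refine (le_abs_self _).trans (abs_inner_le_of_le ?_ n4)
      refine (norm_M_le (ae_abs_le_normSup f) _).trans ?_
      gcongr
    have t6 := neg_le_of_abs_le t3
    have t7 : 0 ≤ 1 / 2 * γ * ‖M (j0 v.toH2) v.toH2.1.1‖ ^ 2 := by positivity
    linarith

/-! ### Determining modes -/

theorem IsSolutionOn.comp_add {γ : ℝ} {f : H2per L} {u : ℝ → H2per L}
    (hu : IsSolutionOn γ f univ u) (I : Set ℝ) (r : ℝ) :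
    IsSolutionOn γ f I fun t => u (t + r) := by
  refine ⟨Continuous.continuousOn ((continuousOn_univ.1 hu.1).comp (by fun_prop)), ?_⟩
  intro φ hφ t _
  have h := (hu.2 φ hφ (t + r) (mem_univ _)).hasDerivAt univ_mem
  exact (h.comp_add_const t r).hasDerivWithinAt

theorem abs_inner_mul_self_le (u w : H2 L) {S ε : ℝ} (hu : √(‖u.1.1‖ * ‖u.1.2.1‖) ≤ S)
    (hw : ‖w.1.1‖ ≤ ε * ‖w.1.2.1‖) :
    |⟪M (j0 u) w.1.1, w.1.1⟫| ≤ S * ε ^ 2 * ‖w.1.2.1‖ ^ 2 := by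
  have hS : 0 ≤ S := (Real.sqrt_nonneg _).trans hu
  calc |⟪M (j0 u) w.1.1, w.1.1⟫| ≤ ‖M (j0 u) w.1.1‖ * ‖w.1.1‖ := abs_real_inner_le_norm _ _
    _ ≤ (S * ‖w.1.1‖) * ‖w.1.1‖ := by
        gcongr
        exact (norm_M_j0_le _ _).trans (by gcongr)
    _ = S * ‖w.1.1‖ ^ 2 := by ring
    _ ≤ S * (ε * ‖w.1.2.1‖) ^ 2 := by gcongr
    _ = _ := by ring

theorem inner_mul_self_eq (u w : H2 L) :
    ⟪u.1.1, M (j0 w) w.1.1⟫ = ⟪M (j0 u) w.1.1, w.1.1⟫ := by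
  have e : M (j0 w) u.1.1 = M (j0 u) w.1.1 := M_comm (j0 w) (j0 u)
  rw [← inner_M_left, e]

/-- The supremum of w is at most √ε|w_x|, which bounds w w_x by √ε|w_x|² against the flux u_xx +
u²/2. The part f − γu is bounded by 2γS and is paired with w², whose integral is at most ε²|w_x|².
-/
theorem abs_dissip_le {γ : ℝ} (hγ : 0 < γ) (F u w : H2 L) {S N R ε : ℝ} (hε : 0 ≤ ε)
    (hF : √(‖F.1.1‖ * ‖F.1.2.1‖) ≤ γ * S) (hu : √(‖u.1.1‖ * ‖u.1.2.1‖) ≤ S)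
    (hN : ‖M (j0 u) u.1.1‖ ≤ N) (hR : ‖u.1.2.2‖ ≤ R) (hw : ‖w.1.1‖ ≤ ε * ‖w.1.2.1‖) :
    |dissip γ F u w| ≤
      (2 * ((1 / 2 * N + R) * √ε) + 2 * γ * (ε ^ 2 * S)) * ‖w.1.2.1‖ ^ 2 := by
  have h1 : ‖u.1.2.2 + (halfSq u).1.1‖ ≤ 1 / 2 * N + R := by
    refine (norm_add_le _ _).trans ?_
    rw [halfSq_fst, norm_smul]
    norm_num
    linarith
  have h2 : ‖M (j0 w) w.1.2.1‖ ≤ √ε * ‖w.1.2.1‖ ^ 2 := by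
    refine (norm_M_j0_le _ _).trans ?_
    have : √(‖w.1.1‖ * ‖w.1.2.1‖) ≤ √ε * ‖w.1.2.1‖ := by
      rw [← Real.sqrt_sq (norm_nonneg w.1.2.1), ← Real.sqrt_mul hε,
        Real.sqrt_sq (norm_nonneg w.1.2.1)]
      refine Real.sqrt_le_sqrt ?_
      calc ‖w.1.1‖ * ‖w.1.2.1‖ ≤ (ε * ‖w.1.2.1‖) * ‖w.1.2.1‖ := by gcongr
        _ = _ := by ring
    calc _ ≤ (√ε * ‖w.1.2.1‖) * ‖w.1.2.1‖ := by gcongr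
      _ = _ := by ring
  have h3 := abs_le.1 (abs_inner_le_of_le h1 h2)
  have h4 := abs_le.1 (abs_inner_mul_self_le F w hF hw)
  have h5 := abs_le.1 (abs_inner_mul_self_le u w hu hw)
  have h6 := mul_le_mul_of_nonneg_left h5.1 hγ.le
  have h7 := mul_le_mul_of_nonneg_left h5.2 hγ.le
  rw [dissip, inner_sub_left, real_inner_smul_left, inner_mul_self_eq, inner_mul_self_eq, abs_le]
  constructor <;> linarith

theorem abs_Phi_sub_le (u v w : H2 L) {S ε : ℝ} (hu : √(‖u.1.1‖ * ‖u.1.2.1‖) ≤ S)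
    (hv : √(‖v.1.1‖ * ‖v.1.2.1‖) ≤ S) (hw : ‖w.1.1‖ ≤ ε * ‖w.1.2.1‖) :
    |Phi ((1 / 2 : ℝ) • (u + v)) w - ‖w.1.2.1‖ ^ 2| ≤ ε ^ 2 * S * ‖w.1.2.1‖ ^ 2 := by
  have h1 := abs_le.1 (abs_inner_mul_self_le u w hu hw)
  have h2 := abs_le.1 (abs_inner_mul_self_le v w hv hw)
  have e : Phi ((1 / 2 : ℝ) • (u + v)) w = ‖w.1.2.1‖ ^ 2 -
      1 / 2 * (⟪M (j0 u) w.1.1, w.1.1⟫ + ⟪M (j0 v) w.1.1, w.1.1⟫) := by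
    simp only [Phi, map_smul, map_add, smul_apply, add_apply, real_inner_smul_left, inner_add_left]
  rw [e, abs_le]
  constructor <;> linarith

/-- The graph of β⁴ lies above its tangent β/2 − 3/16 at β = 1/2. This turns the fourth power in
`ModesCondition` into a linear smallness condition; the gap between 7/8 and 1 becomes the decay
rate. -/
theorem add_le_of_add_pow_four_le {a β : ℝ} (ha : 0 ≤ a) (hβ : 0 ≤ β) (h : a + β ^ 4 ≤ 1 / 4) :
    β + a ≤ 7 / 8 * (1 - a) := by
  have h1 : 0 ≤ (β - 1 / 2) ^ 2 * (β ^ 2 + β + 3 / 4) := by positivity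
  have h2 : (β - 1 / 2) ^ 2 * (β ^ 2 + β + 3 / 4) = β ^ 4 - β / 2 + 3 / 16 := by ring
  linarith

theorem continuous_Phi {α : Type*} [TopologicalSpace α] {v w : α → H2 L} (hv : Continuous v)
    (hw : Continuous w) : Continuous fun t => Phi (v t) (w t) := by
  unfold Phi
  fun_prop

/-- If the difference of two solutions has no low modes, then `Phi` decays exponentially. -/
theorem Sol.Phi_le {γ : ℝ} (hγ : 0 < γ) {F : H2 L} {U V : ℝ → H2 L} (hU : Sol γ F U)
    (hV : Sol γ F V) {S N R ε : ℝ} (hε : 0 ≤ ε) (hF : √(‖F.1.1‖ * ‖F.1.2.1‖) ≤ γ * S)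
    (bU : ∀ t, √(‖(U t).1.1‖ * ‖(U t).1.2.1‖) ≤ S ∧ ‖M (j0 (U t)) (U t).1.1‖ ≤ N ∧
      ‖(U t).1.2.2‖ ≤ R)
    (bV : ∀ t, √(‖(V t).1.1‖ * ‖(V t).1.2.1‖) ≤ S ∧ ‖M (j0 (V t)) (V t).1.1‖ ≤ N ∧
      ‖(V t).1.2.2‖ ≤ R)
    (hw : ∀ t, ‖(U t - V t).1.1‖ ≤ ε * ‖(U t - V t).1.2.1‖)
    (h : (1 / 2 * N + R) * √ε / γ + ε ^ 2 * S ≤ 7 / 8 * (1 - ε ^ 2 * S)) {T : ℝ} (hT : 0 ≤ T) :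
    Phi ((1 / 2 : ℝ) • (U T + V T)) (U T - V T) ≤
      Real.exp (-(γ / 4) * T) * Phi ((1 / 2 : ℝ) • (U 0 + V 0)) (U 0 - V 0) := by
  have hc : Continuous fun t => Phi ((1 / 2 : ℝ) • (U t + V t)) (U t - V t) :=
    continuous_Phi ((hU.continuous.add hV.continuous).const_smul (1 / 2 : ℝ))
      (hU.continuous.sub hV.continuous)
  have hd : ∀ t, 0 < t → ∃ d, HasDerivAt
      (fun t => Phi ((1 / 2 : ℝ) • (U t + V t)) (U t - V t)) d t ∧
      d ≤ -(γ / 4) * Phi ((1 / 2 : ℝ) • (U t + V t)) (U t - V t) + 0 := by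
    intro t ht
    refine ⟨_, hU.hasDerivAt_Phi hV ht, ?_⟩
    have d1 := (abs_le.1 (abs_dissip_le hγ F (U t) _ hε hF (bU t).1 (bU t).2.1 (bU t).2.2
      (hw t))).1
    have d2 := (abs_le.1 (abs_dissip_le hγ F (V t) _ hε hF (bV t).1 (bV t).2.1 (bV t).2.2
      (hw t))).1
    have l1 := (abs_le.1 (abs_Phi_sub_le (U t) (V t) _ (bU t).1 (bV t).1 (hw t))).1
    -- With q = |w_x|², a = ε²S and b = (N/2 + R)√ε/γ: Φ' ≤ −2γΦ + 2γ(b + a)q ≤ −2γΦ + (7/4)γ(1 −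
    -- a)q ≤ −(γ/4)Φ, the last step by (1 − a)q ≤ Φ.
    have l2 := mul_le_mul_of_nonneg_left h (mul_nonneg hγ.le (sq_nonneg ‖(U t - V t).1.2.1‖))
    have l3 := mul_le_mul_of_nonneg_left l1 hγ.le
    have e : (1 / 2 * N + R) * √ε = γ * ((1 / 2 * N + R) * √ε / γ) := by field_simp
    rw [e] at d1 d2
    clear bU bV hw hF
    generalize dissip γ F (U t) (U t - V t) = x at d1 ⊢
    generalize dissip γ F (V t) (U t - V t) = y at d2 ⊢
    generalize Phi ((1 / 2 : ℝ) • (U t + V t)) (U t - V t) = z at l1 l3 ⊢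
    generalize ‖(U t - V t).1.2.1‖ ^ 2 = q at d1 d2 l1 l2 l3
    generalize (1 / 2 * N + R) * √ε / γ = b at d1 d2 l2
    linarith
  have key := gronwall_sub_le (by positivity : 0 < γ / 4) hc hd hT
  rwa [zero_div, sub_zero, sub_zero] at key

theorem norm_sq_le_of_mem (hγ : 0 < γ) {K : Set (H2per L)} (hK : IsCompact K)
    (hinv : IsInvariant γ f K) {z : H2per L} (hz : z ∈ K) :
    ‖M (j0 z.toH2) z.toH2.1.1‖ ≤ R0 γ f * Rinf γ f := by
  have h1 : ‖z.toH2.1.1‖ ≤ R0 γ f := norm_le_R0 hγ hK hinv hz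
  have h2 := norm_le_R1 hγ hK hinv hz
  have hi := Rinf_nonneg (f := f) hγ
  rw [mul_comm (R0 γ f)]
  refine (norm_M_j0_le _ _).trans (mul_le_mul ?_ h1 (norm_nonneg _) hi)
  exact sqrt_le_Rinf hγ (norm_nonneg _) h1 h2

/-- Expresses the condition through the Poincaré constant ε. The first summand is the relative
distance between Φ and |w_x|², the second will dominate β⁴. -/
theorem modesCondition_iff (hγ : 0 < γ) (m : ℕ) : ModesCondition γ f m ↔
    (L / (2 * Real.pi * (m + 1))) ^ 2 * Rinf γ f +
      (L / (2 * Real.pi * (m + 1))) ^ 2 * (Rprime γ f / γ) ^ 4 ≤ 1 / 4 := by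
  have e : γ ^ (-3 : ℝ) = (γ ^ 3)⁻¹ := by
    rw [Real.rpow_neg hγ.le]
    norm_cast
  have e2 : L ^ 2 / (4 * Real.pi ^ 2 * ((m : ℝ) + 1) ^ 2) * (1 / γ) *
      (2 * γ * Rinf γ f + 2 * Rprime γ f ^ 4 * (γ ^ 3)⁻¹) =
      2 * ((L / (2 * Real.pi * (m + 1))) ^ 2 * Rinf γ f +
        (L / (2 * Real.pi * (m + 1))) ^ 2 * (Rprime γ f / γ) ^ 4) := by
    have : (m : ℝ) + 1 ≠ 0 := by positivity
    field_simp
    ring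
  rw [ModesCondition, e, e2]
  constructor <;> intro h <;> linarith

theorem Rprime_eq (hγ : 0 < γ) : Rprime γ f =
    1 / 2 * (R0 γ f * Rinf γ f) + R2 γ f + γ * R0 γ f + normL2 f := by
  rw [Rprime, mul_assoc (1 / 2 : ℝ), rpow_three_halves_mul hγ]

theorem isDetermining_of_modesCondition (hγ : 0 < γ) {m : ℕ} (hm : ModesCondition γ f m) :
    IsDetermining γ f m := by
  intro u v hu hv hP s
  have hL0 := hL.out
  have hpi := Real.pi_pos
  set ε := L / (2 * Real.pi * (m + 1)) with hε
  have hε0 : 0 ≤ ε := by positivity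
  have hi := Rinf_nonneg (f := f) hγ
  have h0 := R0_nonneg (f := f) hγ
  have h2 : 0 ≤ R2 γ f := R2_nonneg
  set β := (1 / 2 * (R0 γ f * Rinf γ f) + R2 γ f) * √ε / γ with hβ
  have hβ0 : 0 ≤ β := by positivity
  set a := ε ^ 2 * Rinf γ f with ha
  have ha0 : 0 ≤ a := by positivity
  -- Since β contains √ε, its fourth power contains ε², the same power as in a; hence the fourth
  -- power of `Rprime` in the condition.
  have hβ4 : β ^ 4 ≤ ε ^ 2 * (Rprime γ f / γ) ^ 4 := by
    have e : β ^ 4 = (√ε ^ 2) ^ 2 * ((1 / 2 * (R0 γ f * Rinf γ f) + R2 γ f) / γ) ^ 4 := by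
      rw [hβ]; ring
    have hn : 0 ≤ normL2 f := norm_nonneg _
    have h3 : 0 ≤ γ * R0 γ f := by positivity
    have h4 : 1 / 2 * (R0 γ f * Rinf γ f) + R2 γ f ≤ Rprime γ f := by
      rw [Rprime_eq hγ]; linarith
    rw [e, Real.sq_sqrt hε0]
    gcongr
  have hab := add_le_of_add_pow_four_le ha0 hβ0
    (by have := (modesCondition_iff hγ m).1 hm; linarith)
  have bound : ∀ y : ℝ → H2per L, IsAttractorTrajectory γ f y → ∀ t,
      √(‖(y t).toH2.1.1‖ * ‖(y t).toH2.1.2.1‖) ≤ Rinf γ f ∧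
      ‖M (j0 (y t).toH2) (y t).toH2.1.1‖ ≤ R0 γ f * Rinf γ f ∧
      ‖(y t).toH2.1.2.1‖ ≤ R1 γ f ∧ ‖(y t).toH2.1.2.2‖ ≤ R2 γ f := by
    intro y hy t
    obtain ⟨K, ⟨hK, hinv⟩, hyK⟩ := hy.2 t
    have b1 := norm_le_R1 hγ hK hinv hyK
    exact ⟨sqrt_le_Rinf hγ (norm_nonneg _) (norm_le_R0 hγ hK hinv hyK) b1,
      norm_sq_le_of_mem hγ hK hinv hyK, b1, norm_le_R2 hγ hK hinv hyK⟩
  have poinc : ∀ t, ‖((u t).toH2 - (v t).toH2).1.1‖ ≤ ε * ‖((u t).toH2 - (v t).toH2).1.2.1‖ := by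
    intro t
    refine norm_le_of_proj_eq_zero (j0 ((u t).toH2 - (v t).toH2)).2 m
      ((u t).toH2 - (v t).toH2).2.1 ?_
    change P L m ((u t).val - (v t).val) = 0
    rw [map_sub, hP t, sub_self]
  set Ψ : ℝ → ℝ := fun t =>
    Phi ((1 / 2 : ℝ) • ((u t).toH2 + (v t).toH2)) ((u t).toH2 - (v t).toH2) with hΨ
  set n : ℝ → ℝ := fun t => ‖((u t).toH2 - (v t).toH2).1.2.1‖ with hn
  have lower : ∀ t, |Ψ t - n t ^ 2| ≤ a * n t ^ 2 := fun t =>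
    abs_Phi_sub_le _ _ _ (bound u hu t).1 (bound v hv t).1 (poinc t)
  have upper : ∀ t, Ψ t ≤ (1 + a) * (2 * R1 γ f) ^ 2 := by
    intro t
    have h1 := (abs_le.1 (lower t)).2
    have h2 : n t ≤ 2 * R1 γ f := by
      refine (norm_sub_le (u t).toH2.1.2.1 (v t).toH2.1.2.1).trans ?_
      linarith [(bound u hu t).2.2.1, (bound v hv t).2.2.1]
    have h3 : n t ^ 2 ≤ (2 * R1 γ f) ^ 2 := pow_le_pow_left₀ (norm_nonneg _) h2 2
    have h4 := mul_le_mul_of_nonneg_left h3 (by positivity : 0 ≤ 1 + a)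
    linarith
  -- Both trajectories are restarted at time s − T, where Ψ has a bound independent of T.
  have decay : ∀ T, 0 ≤ T → Ψ s ≤ Real.exp (-(γ / 4) * T) * ((1 + a) * (2 * R1 γ f) ^ 2) := by
    intro T hT
    have hU := (hu.1.comp_add (Ici 0) (s - T)).sol
    have hV := (hv.1.comp_add (Ici 0) (s - T)).sol
    have h := hU.Phi_le hγ hV hε0 (sqrt_source_le hγ)
      (fun t => ⟨(bound u hu _).1, (bound u hu _).2.1, (bound u hu _).2.2.2⟩)
      (fun t => ⟨(bound v hv _).1, (bound v hv _).2.1, (bound v hv _).2.2.2⟩)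
      (fun t => poinc _) hab hT
    simp only [max_eq_left hT, max_self, zero_add, add_sub_cancel] at h
    exact h.trans (mul_le_mul_of_nonneg_left (upper _) (Real.exp_pos _).le)
  have hΨs : Ψ s ≤ 0 := ge_of_tendsto (tendsto_exp_neg_mul (by positivity) _)
    ((eventually_ge_atTop 0).mono decay)
  have ha1 : a < 1 := by
    have := (modesCondition_iff hγ m).1 hm
    have : 0 ≤ β ^ 4 := by positivity
    linarith
  have hns : n s = 0 := by
    have l1 := (abs_le.1 (lower s)).1
    have l2 : (1 - a) * n s ^ 2 ≤ 0 := by linarith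
    have l3 : n s ^ 2 ≤ 0 := nonpos_of_mul_nonpos_right l2 (by linarith)
    exact pow_eq_zero_iff two_ne_zero |>.1 (le_antisymm l3 (sq_nonneg _))
  have w1 : (u s).1.2.1 - (v s).1.2.1 = 0 := norm_eq_zero.1 hns
  have w0 : (u s).1.1 - (v s).1.1 = 0 := by
    have := poinc s
    change _ ≤ ε * n s at this
    rw [hns, mul_zero] at this
    exact norm_le_zero_iff.1 this
  have e1 := sub_eq_zero.1 w1
  have e0 := sub_eq_zero.1 w0
  have e2 : (u s).1.2.2 = (v s).1.2.2 :=
    deriv_unique (a := (u s).1.2.1) (j1 (u s).toH2).2 (by rw [e1]; exact (j1 (v s).toH2).2)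
  exact Subtype.ext (Prod.ext e0 (Prod.ext e1 e2))

/-! ### The number of modes -/

/-- The cube makes the fractional powers integral: R_0^{10/3} is at most Z¹⁰ and sets the size of
R_1², whose other terms are of order Z⁹ and Z⁶. So R_1 is of order Z⁵ and R_∞² = R_0R_1 of order Z⁸.
-/
theorem Rinf_le_of_le (hγ : 0 < γ) {Z : ℝ} (hZ : 1 ≤ Z) (h0 : R0 γ f ≤ Z ^ 3)
    (hf : normH2 f ≤ γ * Z ^ 3) : Rinf γ f ≤ 2 * Z ^ 4 := by
  have hr := R0_nonneg (f := f) hγ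
  have hZ0 : 0 ≤ Z := by linarith
  have hf0 : 0 ≤ normH2 f := norm_nonneg _
  have hφ : normH2 f / γ ≤ Z ^ 3 := by rwa [div_le_iff₀' hγ]
  have e1 : R0 γ f ^ (10 / 3 : ℝ) ≤ Z ^ 10 := by
    have e : (Z ^ 3) ^ (10 / 3 : ℝ) = Z ^ 10 := by
      rw [← Real.rpow_natCast_mul hZ0]
      norm_num
    rw [← e]
    gcongr
  have e2 : normH2 f * R0 γ f ^ 2 / γ ≤ Z ^ 10 := by
    calc normH2 f * R0 γ f ^ 2 / γ = normH2 f / γ * R0 γ f ^ 2 := by ring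
      _ ≤ Z ^ 3 * (Z ^ 3) ^ 2 := by gcongr
      _ = Z ^ 9 := by ring
      _ ≤ Z ^ 10 := pow_le_pow_right₀ hZ (by norm_num)
  have e3 : normH2 f * R0 γ f / γ ≤ Z ^ 10 := by
    calc normH2 f * R0 γ f / γ = normH2 f / γ * R0 γ f := by ring
      _ ≤ Z ^ 3 * Z ^ 3 := by gcongr
      _ = Z ^ 6 := by ring
      _ ≤ Z ^ 10 := pow_le_pow_right₀ hZ (by norm_num)
  have e4 : R1 γ f ≤ 4 * Z ^ 5 := by
    refine (pow_le_pow_iff_left₀ R1_nonneg (by positivity) two_ne_zero).1 ?_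
    have e : (4 * Z ^ 5) ^ 2 = 16 * Z ^ 10 := by ring
    have : 0 ≤ Z ^ 10 := by positivity
    rw [R1_sq hγ, e]
    linarith
  refine (pow_le_pow_iff_left₀ (Rinf_nonneg hγ) (by positivity) two_ne_zero).1 ?_
  rw [Rinf_sq hγ]
  calc R0 γ f * R1 γ f ≤ Z ^ 3 * (4 * Z ^ 5) := mul_le_mul h0 e4 R1_nonneg (by positivity)
    _ = _ := by ring

/-- The leading terms are γR_0R_∞ and |f|_∞R_0 in `C1`, both of order γZ⁷; for the second, the
supremum of f is again compared with γR_∞. -/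
theorem R2_le_of_le (hγ : 0 < γ) {Z : ℝ} (hZ : 1 ≤ Z) (h0 : R0 γ f ≤ Z ^ 3)
    (hf : normH2 f ≤ γ * Z ^ 3) : R2 γ f ≤ 9 * Z ^ 7 := by
  have hr := R0_nonneg (f := f) hγ
  have hi := Rinf_nonneg (f := f) hγ
  have hi' := Rinf_le_of_le hγ hZ h0 hf
  have hZ0 : 0 ≤ Z := by linarith
  have hf0 : 0 ≤ normH2 f := norm_nonneg _
  have hs0 := normSup_nonneg f
  have hs : normSup f ≤ γ * (2 * Z ^ 4) :=
    ((normSup_le f).trans (sqrt_source_le hγ)).trans (by gcongr)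
  have hN : R0 γ f * Rinf γ f ≤ 2 * Z ^ 7 := by
    calc R0 γ f * Rinf γ f ≤ Z ^ 3 * (2 * Z ^ 4) := by gcongr
      _ = _ := by ring
  have hN0 : 0 ≤ R0 γ f * Rinf γ f := by positivity
  have mono : ∀ {k : ℕ}, k ≤ 7 → Z ^ k ≤ Z ^ 7 := fun hk => pow_le_pow_right₀ hZ hk
  have hC1 : C1 γ f ≤ γ * (22 * Z ^ 7) := by
    rw [C1, mul_assoc (3 * γ), rpow_three_halves_mul hγ]
    calc 3 * γ * (R0 γ f * Rinf γ f) + 3 * normSup f * R0 γ f + 18 / 5 * normH2 f +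
          6 * normH2 f * R0 γ f
        ≤ 3 * γ * (2 * Z ^ 7) + 3 * (γ * (2 * Z ^ 4)) * Z ^ 3 + 18 / 5 * (γ * Z ^ 3) +
          6 * (γ * Z ^ 3) * Z ^ 3 := by gcongr
      _ = γ * (12 * Z ^ 7 + 18 / 5 * Z ^ 3 + 6 * Z ^ 6) := by ring
      _ ≤ γ * (22 * Z ^ 7) := by
        have h1 := mono (k := 3) (by norm_num)
        have h2 := mono (k := 6) (by norm_num)
        have h3 : 0 ≤ Z ^ 7 := by positivity
        gcongr
        linarith
  have hC1' : 0 ≤ C1 γ f := by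
    rw [C1, mul_assoc (3 * γ), rpow_three_halves_mul hγ]
    positivity
  have hC2 : C2 γ f ≤ γ * (5 * Z ^ 14) := by
    rw [C2, mul_assoc (3 / 2 : ℝ), mul_assoc (normH2 f), rpow_three_halves_mul hγ,
      rpow_five_halves_mul hγ]
    calc 3 / 2 * (R0 γ f * Rinf γ f) * normH2 f + normH2 f * (R0 γ f ^ 2 * Rinf γ f)
        ≤ 3 / 2 * (2 * Z ^ 7) * (γ * Z ^ 3) + γ * Z ^ 3 * ((Z ^ 3) ^ 2 * (2 * Z ^ 4)) := by gcongr
      _ = γ * (3 * Z ^ 10 + 2 * Z ^ 13) := by ring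
      _ ≤ γ * (5 * Z ^ 14) := by
        have h1 : Z ^ 10 ≤ Z ^ 14 := pow_le_pow_right₀ hZ (by norm_num)
        have h2 : Z ^ 13 ≤ Z ^ 14 := pow_le_pow_right₀ hZ (by norm_num)
        gcongr
        linarith
  have hN2 : R0 γ f ^ 3 * R1 γ f = (R0 γ f * Rinf γ f) ^ 2 := by
    rw [mul_pow, Rinf_sq hγ]; ring
  rw [R2, mul_assoc (45 / 64 : ℝ), hN2]
  refine Real.sqrt_le_iff.2 ⟨by positivity, ?_⟩
  calc 5 / (36 * γ ^ 2) * C1 γ f ^ 2 + 1 / γ * C2 γ f + 45 / 64 * (R0 γ f * Rinf γ f) ^ 2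
      ≤ 5 / (36 * γ ^ 2) * (γ * (22 * Z ^ 7)) ^ 2 + 1 / γ * (γ * (5 * Z ^ 14)) +
        45 / 64 * (2 * Z ^ 7) ^ 2 := by gcongr
    _ = (5 / 36 * 22 ^ 2 + 5 + 45 / 64 * 2 ^ 2) * Z ^ 14 := by field_simp
    -- The numerical factor is slightly above 75; 81 is a convenient larger square.
    _ ≤ 81 * Z ^ 14 := by
      gcongr
      norm_num
    _ = (9 * Z ^ 7) ^ 2 := by ring

theorem Rprime_le_of_le (hγ : 0 < γ) {Z : ℝ} (hZ : 1 ≤ Z) (h0 : R0 γ f ≤ Z ^ 3)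
    (hf : normH2 f ≤ γ * Z ^ 3) : Rprime γ f ≤ (10 + 2 * γ) * Z ^ 7 := by
  have hr := R0_nonneg (f := f) hγ
  have hi := Rinf_nonneg (f := f) hγ
  have hi' := Rinf_le_of_le hγ hZ h0 hf
  have h2 := R2_le_of_le hγ hZ h0 hf
  have hZ0 : 0 ≤ Z := by linarith
  have hN : R0 γ f * Rinf γ f ≤ 2 * Z ^ 7 := by
    calc R0 γ f * Rinf γ f ≤ Z ^ 3 * (2 * Z ^ 4) := by gcongr
      _ = _ := by ring
  have hn : normL2 f = γ * R0 γ f := norm_eq_mul_R0 hγ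
  have h7 : Z ^ 3 ≤ Z ^ 7 := pow_le_pow_right₀ hZ (by norm_num)
  have h3 := mul_le_mul_of_nonneg_left (h0.trans h7) hγ.le
  rw [Rprime_eq hγ, hn]
  linarith

theorem Rprime_nonneg (hγ : 0 < γ) : 0 ≤ Rprime γ f := by
  have hr := R0_nonneg (f := f) hγ
  have hi := Rinf_nonneg (f := f) hγ
  have h2 : 0 ≤ R2 γ f := R2_nonneg
  have hn : 0 ≤ normL2 f := norm_nonneg _
  rw [Rprime_eq hγ]
  positivity

theorem normL2_le (f : H2per L) : normL2 f ≤ (L / (2 * Real.pi)) ^ 2 * normH2 f := by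
  have hL0 := hL.out
  have h1 := norm_le_norm_deriv (j0 f.toH2).2 f.2.1
  have h2 := norm_le_norm_deriv (j1 f.toH2).2 (integral_deriv (j0 f.toH2).2)
  calc normL2 f ≤ L / (2 * Real.pi) * ‖f.1.2.1‖ := h1
    _ ≤ L / (2 * Real.pi) * (L / (2 * Real.pi) * ‖f.1.2.2‖) := by
      have := Real.pi_pos
      gcongr
      exact h2
    _ = _ := by rw [normH2]; ring

/-- Condition on the modes in terms of a scale `Z` dominating the source. -/
theorem modesCondition_of_le (hγ : 0 < γ) {γ₀ : ℝ} (hγ₀ : γ ≤ γ₀) {Z : ℝ} (hZ : 1 ≤ Z)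
    (h0 : R0 γ f ≤ Z ^ 3) (hf : normH2 f ≤ γ * Z ^ 3) {m : ℕ}
    (hm : L / Real.pi * √(2 * γ₀ ^ 4 + (10 + 2 * γ₀) ^ 4) * (Z ^ 14 / γ ^ 2) ≤ m) :
    ModesCondition γ f m := by
  have hL0 := hL.out
  have hpi := Real.pi_pos
  have hZ0 : 0 < Z := by linarith
  set D := 2 * γ₀ ^ 4 + (10 + 2 * γ₀) ^ 4 with hD
  have hD0 : 0 ≤ D := by positivity
  -- Both terms are brought to the common scale Z²⁸/γ⁴: the first at the cost of γ⁴ ≤ γ₀⁴, the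
  -- second because `Rprime` is of order Z⁷.
  have h1 : Rinf γ f + (Rprime γ f / γ) ^ 4 ≤ D * (Z ^ 28 / γ ^ 4) := by
    have i1 : Rinf γ f ≤ 2 * γ₀ ^ 4 * (Z ^ 28 / γ ^ 4) := by
      calc Rinf γ f ≤ 2 * Z ^ 4 := Rinf_le_of_le hγ hZ h0 hf
        _ ≤ 2 * Z ^ 28 := by
          have := pow_le_pow_right₀ hZ (by norm_num : 4 ≤ 28)
          gcongr
        _ = 2 * γ ^ 4 * (Z ^ 28 / γ ^ 4) := by field_simp
        _ ≤ _ := by gcongr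
    have i2 : (Rprime γ f / γ) ^ 4 ≤ (10 + 2 * γ₀) ^ 4 * (Z ^ 28 / γ ^ 4) := by
      have := Rprime_nonneg (f := f) hγ
      have := Rprime_le_of_le hγ hZ h0 hf
      calc (Rprime γ f / γ) ^ 4 ≤ ((10 + 2 * γ) * Z ^ 7 / γ) ^ 4 := by gcongr
        _ = (10 + 2 * γ) ^ 4 * (Z ^ 28 / γ ^ 4) := by rw [div_pow, mul_pow]; ring
        _ ≤ _ := by gcongr
    rw [hD, add_mul]
    exact add_le_add i1 i2
  have h2 : (L / (Real.pi * (m + 1))) ^ 2 * (D * (Z ^ 28 / γ ^ 4)) ≤ 1 := by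
    have e : (L / (Real.pi * (m + 1))) ^ 2 * (D * (Z ^ 28 / γ ^ 4)) =
        (L / Real.pi * √D * (Z ^ 14 / γ ^ 2) / (m + 1)) ^ 2 := by
      have : L / Real.pi * √D * (Z ^ 14 / γ ^ 2) / (m + 1) =
        L / (Real.pi * (m + 1)) * √D * (Z ^ 14 / γ ^ 2) := by field_simp
      rw [this, mul_pow, mul_pow, Real.sq_sqrt hD0]
      ring
    rw [e]
    refine pow_le_one₀ (by positivity) ?_
    rw [div_le_one (by positivity)]
    linarith
  rw [modesCondition_iff hγ, ← mul_add]
  have h3 := mul_le_mul_of_nonneg_left h1 (sq_nonneg (L / (2 * Real.pi * (m + 1))))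
  have h4 : (L / (2 * Real.pi * (m + 1))) ^ 2 = 1 / 4 * (L / (Real.pi * (m + 1))) ^ 2 := by
    field_simp
    norm_num
  rw [h4] at h3 ⊢
  linarith

theorem exists_modesCondition {γ₀ F₀ : ℝ} (hγ₀ : 0 < γ₀) (hF₀ : 0 < F₀) :
    ∃ C : ℝ, ∀ (γ : ℝ) (f : H2per L), 0 < γ → γ ≤ γ₀ → F₀ ≤ normH2 f →
      ∃ m : ℕ, ModesCondition γ f m ∧
        (m : ℝ) ≤ C * (γ ^ (-(26 / 3) : ℝ) * normH2 f ^ (14 / 3 : ℝ)) := by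
  have hL0 := hL.out
  have hpi := Real.pi_pos
  set D := L / Real.pi * √(2 * γ₀ ^ 4 + (10 + 2 * γ₀) ^ 4) with hD
  have hD0 : 0 ≤ D := by positivity
  set Y₀ := (F₀ / γ₀) ^ (1 / 3 : ℝ) with hY₀
  have hY₀' : 0 < Y₀ := by positivity
  -- The scale will be Z = κY. The three summands of κ ensure in turn |f|_{H²} ≤ γZ³, R_0 ≤ Z³ (by
  -- the Poincaré inequality used twice on f) and Z ≥ 1.
  set κ := 1 + (L / (2 * Real.pi)) ^ 2 + 1 / Y₀ with hκ
  have hκ1 : 1 ≤ κ := by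
    have : 0 ≤ (L / (2 * Real.pi)) ^ 2 + 1 / Y₀ := by positivity
    linarith
  have hκL : (L / (2 * Real.pi)) ^ 2 ≤ κ := by
    have : 0 ≤ 1 / Y₀ := by positivity
    linarith
  have hκY : 1 / Y₀ ≤ κ := by
    have : 0 ≤ (L / (2 * Real.pi)) ^ 2 := by positivity
    linarith
  refine ⟨(D + γ₀ ^ 2) * κ ^ 14 * γ₀ ^ 2, fun γ f hγ hγγ hF => ?_⟩
  have hf : 0 < normH2 f := hF₀.trans_le hF
  set Y := (normH2 f / γ) ^ (1 / 3 : ℝ) with hY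
  have hY0 : 0 < Y := by positivity
  have hYY : Y₀ ≤ Y := by
    rw [hY₀, hY]
    gcongr
  have hY3 : Y ^ 3 = normH2 f / γ := by
    rw [hY, ← Real.rpow_mul_natCast (by positivity)]
    norm_num
  have hκ3 : κ ≤ κ ^ 3 := le_self_pow₀ hκ1 (by norm_num)
  have hZ : 1 ≤ κ * Y := by
    calc 1 = 1 / Y₀ * Y₀ := by field_simp
      _ ≤ κ * Y := by gcongr
  have h0 : R0 γ f ≤ (κ * Y) ^ 3 := by
    rw [mul_pow, hY3, R0]
    calc normL2 f / γ ≤ (L / (2 * Real.pi)) ^ 2 * normH2 f / γ := by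
          gcongr
          exact normL2_le f
      _ = (L / (2 * Real.pi)) ^ 2 * (normH2 f / γ) := by ring
      _ ≤ κ ^ 3 * (normH2 f / γ) := by
          gcongr
          exact hκL.trans hκ3
  have h1 : normH2 f ≤ γ * (κ * Y) ^ 3 := by
    rw [mul_pow, hY3]
    calc normH2 f = γ * (1 * (normH2 f / γ)) := by field_simp
      _ ≤ _ := by
        gcongr
        exact one_le_pow₀ hκ1
  refine ⟨⌈D * ((κ * Y) ^ 14 / γ ^ 2)⌉₊,
    modesCondition_of_le hγ hγγ hZ h0 h1 (Nat.le_ceil _), ?_⟩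
  -- The left side is γ^{−20/3}|f|_{H²}^{14/3}; the claimed power of γ is weaker by γ², which is
  -- finally replaced by γ₀².
  have hE : Y ^ 14 / γ ^ 2 = γ ^ 2 * (γ ^ (-(26 / 3) : ℝ) * normH2 f ^ (14 / 3 : ℝ)) := by
    have e1 : Y ^ 14 = normH2 f ^ (14 / 3 : ℝ) * γ ^ (-(14 / 3) : ℝ) := by
      rw [hY, ← Real.rpow_mul_natCast (by positivity), Real.div_rpow hf.le hγ.le,
        Real.rpow_neg hγ.le]
      norm_num
      rfl
    have e2 : γ ^ (-(14 / 3) : ℝ) = γ ^ 4 * γ ^ (-(26 / 3) : ℝ) := by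
      rw [← Real.rpow_natCast γ 4, ← Real.rpow_add hγ]
      norm_num
    rw [e1, e2]
    field_simp
  -- Absorbs the unit lost in rounding m up to an integer.
  have hone : 1 ≤ γ₀ ^ 2 * ((κ * Y) ^ 14 / γ ^ 2) := by
    calc (1 : ℝ) ≤ (κ * Y) ^ 14 := one_le_pow₀ hZ
      _ = γ ^ 2 * ((κ * Y) ^ 14 / γ ^ 2) := by field_simp
      _ ≤ _ := by gcongr
  calc ((⌈D * ((κ * Y) ^ 14 / γ ^ 2)⌉₊ : ℕ) : ℝ) ≤ D * ((κ * Y) ^ 14 / γ ^ 2) + 1 :=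
        (Nat.ceil_lt_add_one (by positivity)).le
    _ ≤ (D + γ₀ ^ 2) * ((κ * Y) ^ 14 / γ ^ 2) := by linarith
    _ = (D + γ₀ ^ 2) * κ ^ 14 * (Y ^ 14 / γ ^ 2) := by ring
    _ ≤ _ := by
      rw [hE, mul_assoc _ (γ₀ ^ 2)]
      gcongr

end KdV

end

theorem theorem6 (L : ℝ) (hL : 0 < L) :
    (∀ (γ : ℝ) (f : KdV.H2per L) (m : ℕ), 0 < γ → KdV.ModesCondition γ f m →
      KdV.IsDetermining γ f m) ∧
    (∀ γ₀ F₀ : ℝ, 0 < γ₀ → 0 < F₀ → ∃ C : ℝ, ∀ (γ : ℝ) (f : KdV.H2per L),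
      0 < γ → γ ≤ γ₀ → F₀ ≤ KdV.normH2 f →
        ∃ m : ℕ, KdV.ModesCondition γ f m ∧
          (m : ℝ) ≤ C * (γ ^ (-(26 / 3) : ℝ) * KdV.normH2 f ^ (14 / 3 : ℝ))) := by
  have : Fact (0 < L) := ⟨hL⟩
  exact ⟨fun _ _ _ hγ hm => KdV.isDetermining_of_modesCondition hγ hm,
    fun _ _ hγ₀ hF₀ => KdV.exists_modesCondition hγ₀ hF₀⟩
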